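/- Let $\Theta$ be the group with generators $a,b,c,d,e,f$ and the following relations: the Coxeter relations of the string diagram $[3,3,4,3,3]$ (with nodes $a,b,c,d,e,f$ in this order, i.e. $a^2=\dots=f^2=1$, $(ab)^3=(bc)^3=(cd)^4=(de)^3=(ef)^3=1$, and non-adjacent generators commute), together with $(a\sigma\tau)^4=(f\tau\sigma\tau)^3=1$, where $\sigma:=d^{cb}$, $\tau:=c^{de}$ and $x^y:=y^{-1}xy$. Let $\hat b,\hat c,\hat d,\hat e$ be the $24\times 24$ permutation matrices over $\mathbb{F}_2$ of $$\hat b=\prod_{i\in\{0,8,16\}}(i+3,i+8)(i+4,i+7),\qquad \hat c=(3,6)(4,5)(11,14)(12,13)(17,24)(18,23),$$ $$\hat d=(5,6)\prod_{i=9}^{16}(i,i+8),\qquad \hat e=(21,22)\prod_{i=1}^{8}(i,i+8),$$ and let $$\hat a:=I_3\otimes A,\qquad \hat f:=\begin{pmatrix} I_8+E_{21}&0&0\\0&0&F\\0&F&0\end{pmatrix},$$ $$A:=\begin{pmatrix}1&0&0&0&0&0&0&0\\0&1&1&1&1&1&0&0\\1&0&1&0&0&0&0&1\\1&0&0&1&0&0&0&1\\1&0&0&0&1&0&0&1\\1&0&0&0&0&1&0&1\\0&0&1&1&1&1&1&0\\0&0&0&0&0&0&0&1\end{pmatrix},\qquad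 F:=\begin{pmatrix}0&0&0&0&1&1&0&0\\0&0&0&0&1&0&0&0\\0&0&0&0&0&0&1&1\\0&0&0&0&0&0&1&0\\0&1&0&0&0&0&0&0\\1&1&0&0&0&0&0&0\\0&0&0&1&0&0&0&0\\0&0&1&1&0&0&0&0\end{pmatrix},$$ where $E_{21}$ is the $8\times 8$ matrix whose only non-zero entry is a $1$ in position $(2,1)$. Then there is a homomorphism $\Theta\to \mathrm{GL}_{24}(2)$ that maps $a,\dots,f$ to $\hat a,\dots,\hat f$. Its image $\hat\Theta$ preserves (acting on row vectors) the quadratic form $\Phi=\sum_{j=1}^{24}x_j^2+\sum_{i=1}^{12}x_{2i-1}x_{2i}$ and is isomorphic to $O_8^+(2){:}S_3$, so that $\Theta$ maps onto $O_8^+(2){:}S_3$. Here $O_8^+(2)$ is the simple group in ATLAS notation, i.e. the commutator subgroup of the isometry group of the quadratic form $x_1x_2+x_3x_4+x_5x_6+x_7x_8$ on $\mathbb{F}_2^8$, and $O_8^+(2){:}S_3$ is its split extension by $S_3$ in which no non-trivial element of $S_3$ induces an inner automorphism. Moreover, $\hat\Theta$ satisfies the intersection property: writing $(g_0,\dots,g_5):=(\hat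 a,\dots,\hat f)$ and $\hat\Theta_I:=\langle g_i\mid i\in I\rangle$, one has $\hat\Theta_I\cap\hat\Theta_J=\hat\Theta_{I\cap J}$ for all $I,J\subseteq\{0,\dots,5\}$. With these generators $\hat\Theta$ is the group of the abstract regular polytope $\Gamma_1$, that is: * $\hat\Theta$ is a string C-group of type $\{3,3,4,3,3\}$: the order of each $g_ig_j$ is the one in the Coxeter diagram (so each $g_i$ is an involution), and the intersection property holds; * the facet group $\langle\hat a,\hat b,\hat c,\hat d,\hat e\rangle$ is, with these generators, $[3,3,4,3]_{(2,2,0,0)}$; * the vertex-figure group $\langle\hat b,\hat c,\hat d,\hat e,\hat f\rangle$ is, with these generators, $[3,4,3,3]_{(3,0,0,0)}$; * $\langle\hat b,\hat c,\hat d,\hat e,\hat f\rangle$ has index $11200$ (the number of vertices) in $\hat\Theta$, and $\langle\hat a,\hat b,\hat c,\hat d,\hat e\rangle$ has index $14175$ (the number of facets) in $\hat\Theta$. Here, on generators $a,b,c,d,e$ with $\sigma,\tau$ as above, $[3,3,4,3]_{(s,s,0,0)}$ is the Coxeter group $[3,3,4,3]$ with the extra relation $(a\sigma\tau)^{2s}=1$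 and $[3,3,4,3]_{(s,0,0,0)}$ is the same Coxeter group with the extra relation $(a\sigma\tau\sigma)^s=1$. The group $[3,4,3,3]_{(s,0,0,0)}$ is $[3,3,4,3]_{(s,0,0,0)}$ with the order of its generators reversed. -/

import Mathlib

open scoped Matrix Kronecker

namespace Polytope33433

/-! ### The finitely presented groups -/

/-- The Coxeter matrix with string diagram and Schläfli symbol `[3,3,4,3,3]`. -/
def cox33433 : CoxeterMatrix (Fin 6) where
  M := !![1, 3, 2, 2, 2, 2;
          3, 1, 3, 2, 2, 2;
          2, 3, 1, 4, 2, 2;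
          2, 2, 4, 1, 3, 2;
          2, 2, 2, 3, 1, 3;
          2, 2, 2, 2, 3, 1]
  off_diagonal i j h := by fin_cases i <;> fin_cases j <;> simp at h ⊢

/-- The Coxeter matrix with string diagram and Schläfli symbol `[3,3,4,3]`. -/
def cox3343 : CoxeterMatrix (Fin 5) where
  M := !![1, 3, 2, 2, 2;
          3, 1, 3, 2, 2;
          2, 3, 1, 4, 2;
          2, 2, 4, 1, 3;
          2, 2, 2, 3, 1]
  off_diagonal i j h := by fin_cases i <;> fin_cases j <;> simp at h ⊢

/-- Conjugation `x ^ y = y⁻¹ x y`. -/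
def conjBy {G : Type*} [Group G] (x y : G) : G := y⁻¹ * x * y

/-- The word `σ = d ^ (cb)`. -/
def sigma {G : Type*} [Group G] (b c d : G) : G := conjBy d (c * b)

/-- The word `τ = c ^ (de)`. -/
def tau {G : Type*} [Group G] (c d e : G) : G := conjBy c (d * e)

/-- The two non-Coxeter relators `(a σ τ) ^ 4` and `(f τ σ τ) ^ 3` of `Θ`; the generators
`a, b, c, d, e, f` are numbered `0, 1, 2, 3, 4, 5`. -/
def thetaExtraRels : Set (FreeGroup (Fin 6)) :=
  let a := FreeGroup.of (0 : Fin 6)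
  let b := FreeGroup.of (1 : Fin 6)
  let c := FreeGroup.of (2 : Fin 6)
  let d := FreeGroup.of (3 : Fin 6)
  let e := FreeGroup.of (4 : Fin 6)
  let f := FreeGroup.of (5 : Fin 6)
  {(a * sigma b c d * tau c d e) ^ 4,
   (f * tau c d e * sigma b c d * tau c d e) ^ 3}

/-- The group `Θ`: the Coxeter group `[3,3,4,3,3]` modulo `(a σ τ) ^ 4 = (f τ σ τ) ^ 3 = 1`. -/
abbrev Theta : Type := PresentedGroup (cox33433.relationsSet ∪ thetaExtraRels)

/-- The generators `a, b, c, d, e, f` of `Θ`. -/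
def Theta.gen (i : Fin 6) : Theta := PresentedGroup.of i

/-- The relator `(a σ τ) ^ (2s)` on generators `a, b, c, d, e` numbered `0, 1, 2, 3, 4`. -/
def relss00 (s : ℕ) : FreeGroup (Fin 5) :=
  let a := FreeGroup.of (0 : Fin 5)
  let b := FreeGroup.of (1 : Fin 5)
  let c := FreeGroup.of (2 : Fin 5)
  let d := FreeGroup.of (3 : Fin 5)
  let e := FreeGroup.of (4 : Fin 5)
  (a * sigma b c d * tau c d e) ^ (2 * s)

/-- The relator `(a σ τ σ) ^ s` on generators `a, b, c, d, e` numbered `0, 1, 2, 3, 4`. -/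
def rels000 (s : ℕ) : FreeGroup (Fin 5) :=
  let a := FreeGroup.of (0 : Fin 5)
  let b := FreeGroup.of (1 : Fin 5)
  let c := FreeGroup.of (2 : Fin 5)
  let d := FreeGroup.of (3 : Fin 5)
  let e := FreeGroup.of (4 : Fin 5)
  (a * sigma b c d * tau c d e * sigma b c d) ^ s

/-- The group `[3,3,4,3]_{(s,s,0,0)}`. -/
abbrev Group3343ss00 (s : ℕ) : Type := PresentedGroup (cox3343.relationsSet ∪ {relss00 s})

/-- The group `[3,3,4,3]_{(s,0,0,0)}`. Read with its generators in the opposite order, it is the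
group `[3,4,3,3]_{(s,0,0,0)}`. -/
abbrev Group3343s000 (s : ℕ) : Type := PresentedGroup (cox3343.relationsSet ∪ {rels000 s})

/-! ### String C-groups -/

section StringC

variable {G : Type*} [Group G] {n : ℕ}

/-- The parabolic subgroup `G_I = ⟨u i | i ∈ I⟩`. -/
def parabolic (u : Fin n → G) (I : Set (Fin n)) : Subgroup G := Subgroup.closure (u '' I)

/-- The intersection property `G_I ∩ G_J = G_{I ∩ J}` for all sets `I`, `J` of generators. -/
def IntersectionProperty (u : Fin n → G) : Prop :=
  ∀ I J : Set (Fin n), parabolic u I ⊓ parabolic u J = parabolic u (I ∩ J)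

/-- The involutions `u 0, …, u (n - 1)` are the distinguished generators of a string C-group (the
group of an abstract regular `n`-polytope): non-adjacent ones commute and the intersection
property holds. -/
structure IsStringCGroup (u : Fin n → G) : Prop where
  orderOf_gen : ∀ i, orderOf (u i) = 2
  commute : ∀ i j : Fin n, (i : ℕ) + 1 < j → Commute (u i) (u j)
  inter : IntersectionProperty u

/-- The group of facets: it is generated by all generators but the last one. -/
def facetGroup (u : Fin 6 → G) : Subgroup G := parabolic u {i | i ≠ 5}

/-- The group of vertex figures: it is generated by all generators but the first one. -/
def vertexGroup (u : Fin 6 → G) : Subgroup G := parabolic u {i | i ≠ 0}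

/-- The subgroup generated by `u 0, …, u 5` is, with these generators, the group of the abstract
regular polytope `Γ₁`: a polytope of type `{3,3,4,3,3}` with facets `{3,3,4,3}_{(2,2,0,0)}`, vertex
figures `{3,4,3,3}_{(3,0,0,0)}`, `11200` vertices and `14175` facets. -/
structure IsGroupOfGammaOne (u : Fin 6 → G) : Prop where
  stringC : IsStringCGroup u
  type : ∀ i j, orderOf (u i * u j) = cox33433 i j
  /-- The facet group is `[3,3,4,3]_{(2,2,0,0)}`, with `u 0, …, u 4` as `a, …, e`. -/
  facets : ∃ φ : Group3343ss00 2 ≃* facetGroup u,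
    ∀ i : Fin 5, (φ (PresentedGroup.of i) : G) = u i.castSucc
  /-- The vertex-figure group is `[3,4,3,3]_{(3,0,0,0)}`, with `u 5, …, u 1` as `a, …, e` in the
  relations of the dual group `[3,3,4,3]_{(3,0,0,0)}`. -/
  vertexFigures : ∃ φ : Group3343s000 3 ≃* vertexGroup u,
    ∀ i : Fin 5, (φ (PresentedGroup.of i) : G) = u i.rev.succ
  card_vertices : (vertexGroup u).relIndex (parabolic u Set.univ) = 11200
  card_facets : (facetGroup u).relIndex (parabolic u Set.univ) = 14175

end StringC

/-! ### The groups `O₈⁺(2)` and `O₈⁺(2):S₃` -/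

/-- The group of isometries of a quadratic form. -/
def isometryGroup {R V : Type*} [CommRing R] [AddCommGroup V] [Module R V]
    (Q : QuadraticForm R V) : Subgroup (V ≃ₗ[R] V) where
  carrier := {g | ∀ x, Q (g x) = Q x}
  mul_mem' {g h} hg hh x := by
    rw [LinearEquiv.mul_apply, hg, hh]
  one_mem' _ := rfl
  inv_mem' {g} hg x := by
    rw [← hg (g⁻¹ x)]
    exact congrArg Q (LinearEquiv.apply_symm_apply g x)

/-- The quadratic form `x₁x₂ + x₃x₄ + x₅x₆ + x₇x₈` of plus type on `𝔽₂⁸`. -/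
def hyperbolicForm : QuadraticForm (ZMod 2) (Fin 8 → ZMod 2) :=
  ∑ i : Fin 4, QuadraticMap.linMulLin
    (LinearMap.proj (⟨2 * i, by omega⟩ : Fin 8)) (LinearMap.proj (⟨2 * i + 1, by omega⟩ : Fin 8))

/-- The simple group `O₈⁺(2)` in the notation of the ATLAS (also written `Ω₈⁺(2)`), namely the
commutator subgroup of the full orthogonal group `GO₈⁺(2)`, in which it has index 2. -/
abbrev O8Plus2 : Type := commutator (isometryGroup hyperbolicForm)

/-- `G` is isomorphic to `O₈⁺(2):S₃`, the split extension of `O₈⁺(2)` by the symmetric group `S₃`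
acting by outer automorphisms: no non-trivial element of `S₃` induces an inner automorphism. (As
the outer automorphism group of `O₈⁺(2)` is `S₃`, this determines `G` up to isomorphism: it is the
automorphism group of `O₈⁺(2)`.) -/
def IsO8Plus2S3 (G : Type*) [Group G] : Prop :=
  ∃ φ : Equiv.Perm (Fin 3) →* MulAut O8Plus2,
    (∀ s, φ s ∈ (MulAut.conj : O8Plus2 →* MulAut O8Plus2).range → s = 1) ∧
    Nonempty (G ≃* O8Plus2 ⋊[φ] Equiv.Perm (Fin 3))

/-! ### The explicit matrices -/

/-- The transposition `(i, j)` of the points `1, …, 24` (the point `i` is `i - 1 : Fin 24`). -/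
def tr (i j : ℕ) : Equiv.Perm (Fin 24) := Equiv.swap (Fin.ofNat 24 (i - 1)) (Fin.ofNat 24 (j - 1))

def permB : Equiv.Perm (Fin 24) :=
  ([0, 8, 16].map fun i => tr (i + 3) (i + 8) * tr (i + 4) (i + 7)).prod

def permC : Equiv.Perm (Fin 24) :=
  tr 3 6 * tr 4 5 * tr 11 14 * tr 12 13 * tr 17 24 * tr 18 23

def permD : Equiv.Perm (Fin 24) :=
  tr 5 6 * ([9, 10, 11, 12, 13, 14, 15, 16].map fun i => tr i (i + 8)).prod

def permE : Equiv.Perm (Fin 24) :=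
  tr 21 22 * ([1, 2, 3, 4, 5, 6, 7, 8].map fun i => tr i (i + 8)).prod

def matA : Matrix (Fin 8) (Fin 8) (ZMod 2) :=
  !![1, 0, 0, 0, 0, 0, 0, 0;
     0, 1, 1, 1, 1, 1, 0, 0;
     1, 0, 1, 0, 0, 0, 0, 1;
     1, 0, 0, 1, 0, 0, 0, 1;
     1, 0, 0, 0, 1, 0, 0, 1;
     1, 0, 0, 0, 0, 1, 0, 1;
     0, 0, 1, 1, 1, 1, 1, 0;
     0, 0, 0, 0, 0, 0, 0, 1]

def matF : Matrix (Fin 8) (Fin 8) (ZMod 2) :=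
  !![0, 0, 0, 0, 1, 1, 0, 0;
     0, 0, 0, 0, 1, 0, 0, 0;
     0, 0, 0, 0, 0, 0, 1, 1;
     0, 0, 0, 0, 0, 0, 1, 0;
     0, 1, 0, 0, 0, 0, 0, 0;
     1, 1, 0, 0, 0, 0, 0, 0;
     0, 0, 0, 1, 0, 0, 0, 0;
     0, 0, 1, 1, 0, 0, 0, 0]

/-- The identification of `3 × 8` block indices with `24` indices, `(p, i) ↦ 8 p + i`. -/
def blockEquiv : Fin 3 × Fin 8 ≃ Fin 24 := finProdFinEquiv

/-- The `24 × 24` matrix with the given `3 × 3` array of `8 × 8` blocks. -/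
def ofBlocks (M : Matrix (Fin 3) (Fin 3) (Matrix (Fin 8) (Fin 8) (ZMod 2))) :
    Matrix (Fin 24) (Fin 24) (ZMod 2) :=
  Matrix.reindex blockEquiv blockEquiv (Matrix.comp _ _ _ _ _ M)

/-- `â = I₃ ⊗ A`. -/
def hatA : Matrix (Fin 24) (Fin 24) (ZMod 2) :=
  Matrix.reindex blockEquiv blockEquiv ((1 : Matrix (Fin 3) (Fin 3) (ZMod 2)) ⊗ₖ matA)

/-- The matrix `f̂`, with the blocks `I₈ + E₂₁`, `F` and `F`. -/
def hatF : Matrix (Fin 24) (Fin 24) (ZMod 2) :=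
  ofBlocks !![1 + Matrix.single 1 0 1, 0, 0;
              0, 0, matF;
              0, matF, 0]

/-- The matrices `â, b̂, ĉ, d̂, ê, f̂`. -/
def hat : Fin 6 → Matrix (Fin 24) (Fin 24) (ZMod 2) :=
  ![hatA, permB.permMatrix (ZMod 2), permC.permMatrix (ZMod 2), permD.permMatrix (ZMod 2),
    permE.permMatrix (ZMod 2), hatF]

/-- The quadratic form `Φ = ∑_{j=1}^{24} x_j² + ∑_{i=1}^{12} x_{2i-1} x_{2i}` on `𝔽₂²⁴`. -/
def Phi : QuadraticForm (ZMod 2) (Fin 24 → ZMod 2) :=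
  ∑ j : Fin 24, QuadraticMap.linMulLin (LinearMap.proj j) (LinearMap.proj j) +
  ∑ i : Fin 12, QuadraticMap.linMulLin
    (LinearMap.proj (⟨2 * i, by omega⟩ : Fin 24)) (LinearMap.proj (⟨2 * i + 1, by omega⟩ : Fin 24))

end Polytope33433

/-! The matrices satisfy the relations of `Θ` by direct computation, which gives `Theta.rep`. What
remains is to identify its image and to find the orders of the parabolic subgroups.

The generators permute the three blocks of eight coordinates. This maps the image onto `S₃`, and the
map splits because `d̂` and `ê` generate a complement of the kernel. On each block `Φ` is a sum of
four anisotropic planes, hence of plus type. The stabilizer of the first block acts on it as the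
full orthogonal group: `d̂` acts as a reflection, all vectors of norm 1 in the block are conjugate
to its centre, and reflections generate the orthogonal group (`restrict_surjective`,
`reflectionGroup_eq_top`). The action is faithful by triality: the group preserves a bilinear
product `mulVec` under which vectors of two different blocks multiply into the third, and an element
fixing the first block pointwise commutes with multiplication by its vectors
(`eq_one_of_fixes_block`). So the image has order `3 · |GO₈⁺(2)|`, and the kernel of the action on
the blocks corresponds to the commutator subgroup of `GO₈⁺(2)` (`map_restrict_ker`). The complement
acts by outer automorphisms because the kernel has trivial centralizer (`eq_one_of_commute_ker`).

For the facet and vertex-figure groups, coset enumeration bounds the presented group from above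
(`CosetTable.relIndex_le`) and a chain of orbits of vectors bounds the matrix group from below. The
bounds `73728 = 64 · 1152` and `93312 = 81 · 1152` agree, so both groups are the presented ones and
the indices follow by division.

The intersection property reduces to neighbouring intervals of generators
(`intersectionProperty_of_interval`). There an enumeration bounds the index of the expected
intersection in one group, and an orbit of a vector fixed by the other group shows that the true
intersection has at least that index (`inf_le_of_orbit`).

Vectors and matrices over `𝔽₂` are coded by binary digits of natural numbers, so that the finite
checks can be evaluated. -/

namespace Polytope33433

/-! ### Reduction of the intersection property to intervals of generators -/

section Parabolic

variable {G : Type*} [Group G] {n : ℕ} {u : Fin n → G}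

theorem parabolic_mono {I J : Set (Fin n)} (h : I ⊆ J) : parabolic u I ≤ parabolic u J :=
  Subgroup.closure_mono (Set.image_mono h)

theorem mem_parabolic {I : Set (Fin n)} {i : Fin n} (h : i ∈ I) : u i ∈ parabolic u I :=
  Subgroup.subset_closure (Set.mem_image_of_mem u h)

theorem parabolic_le {I : Set (Fin n)} {H : Subgroup G} : parabolic u I ≤ H ↔ ∀ i ∈ I, u i ∈ H := by
  simp [parabolic, Subgroup.closure_le, Set.subset_def]

theorem parabolic_empty : parabolic u ∅ = ⊥ := by
  simp [parabolic]

theorem commute_of_mem_parabolic {I J : Set (Fin n)}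
    (h : ∀ i ∈ I, ∀ j ∈ J, Commute (u i) (u j)) {x y : G}
    (hx : x ∈ parabolic u I) (hy : y ∈ parabolic u J) : Commute x y := by
  have h1 : parabolic u J ≤ Subgroup.centralizer (u '' I) := by
    refine parabolic_le.2 fun j hj => Subgroup.mem_centralizer_iff.2 ?_
    rintro _ ⟨i, hi, rfl⟩
    exact h i hi j hj
  have h2 : parabolic u I ≤ Subgroup.centralizer {y} := by
    refine parabolic_le.2 fun i hi => Subgroup.mem_centralizer_iff.2 ?_
    rintro _ rfl
    exact (Subgroup.mem_centralizer_iff.1 (h1 hy) (u i) ⟨i, hi, rfl⟩).symm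
  exact (Subgroup.mem_centralizer_iff.1 (h2 hx) y rfl).symm

theorem exists_mul_of_mem_parabolic_union {I J : Set (Fin n)}
    (h : ∀ i ∈ I, ∀ j ∈ J, Commute (u i) (u j)) {x : G} (hx : x ∈ parabolic u (I ∪ J)) :
    ∃ y ∈ parabolic u I, ∃ z ∈ parabolic u J, x = y * z := by
  induction hx using Subgroup.closure_induction with
  | mem x hx =>
    obtain ⟨i, hi | hi, rfl⟩ := hx
    · exact ⟨_, mem_parabolic hi, 1, one_mem _, by simp⟩
    · exact ⟨1, one_mem _, _, mem_parabolic hi, by simp⟩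
  | one => exact ⟨1, one_mem _, 1, one_mem _, by simp⟩
  | mul x x' _ _ hx hx' =>
    obtain ⟨y, hy, z, hz, rfl⟩ := hx
    obtain ⟨y', hy', z', hz', rfl⟩ := hx'
    refine ⟨y * y', mul_mem hy hy', z * z', mul_mem hz hz', ?_⟩
    have := (commute_of_mem_parabolic h hy' hz).eq
    rw [mul_assoc, mul_assoc, ← mul_assoc z, ← this, mul_assoc]
  | inv x _ hx =>
    obtain ⟨y, hy, z, hz, rfl⟩ := hx
    refine ⟨y⁻¹, inv_mem hy, z⁻¹, inv_mem hz, ?_⟩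
    rw [mul_inv_rev, (commute_of_mem_parabolic h (inv_mem hy) (inv_mem hz)).eq]

/-- The half-open interval `[a, b)` of indices. -/
def interval (n a b : ℕ) : Set (Fin n) := {i | a ≤ i ∧ (i : ℕ) < b}

/-- The intersection property for subsets of the set `W` of generators. -/
def InterOn (u : Fin n → G) (W : Set (Fin n)) : Prop :=
  ∀ I J : Set (Fin n), I ⊆ W → J ⊆ W → ∀ x, x ∈ parabolic u I → x ∈ parabolic u J →
    x ∈ parabolic u (I ∩ J)

/-- If a generator `i` is missing from `I` and `j` from `J`, with `i ≤ j`, then an element of both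
subgroups factors at `i` inside `G_I` and at `j` inside `G_J`. The two factorizations differ by an
element `w` supported strictly between `i` and `j`. Uniqueness of factorizations over disjoint
commuting intervals then puts all three pieces `y`, `w⁻¹`, `z'` of the element in `G_{I ∩ J}`. -/
theorem InterOn.step (hc : ∀ i j : Fin n, (i : ℕ) + 1 < j → Commute (u i) (u j)) {a b : ℕ}
    (hL : InterOn u (interval n a b)) (hR : InterOn u (interval n (a + 1) (b + 1)))
    (hM : parabolic u (interval n a b) ⊓ parabolic u (interval n (a + 1) (b + 1)) ≤
      parabolic u (interval n (a + 1) b)) :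
    InterOn u (interval n a (b + 1)) := by
  intro I J hI hJ x hxI hxJ
  by_cases hIW : interval n a (b + 1) ⊆ I
  · rwa [Set.inter_eq_right.2 (hJ.trans hIW)]
  by_cases hJW : interval n a (b + 1) ⊆ J
  · rwa [Set.inter_eq_left.2 (hI.trans hJW)]
  obtain ⟨i, hiW, hiI⟩ := Set.not_subset.1 hIW
  obtain ⟨j, hjW, hjJ⟩ := Set.not_subset.1 hJW
  wlog hij : (i : ℕ) ≤ j generalizing I J i j
  · rw [Set.inter_comm]
    exact this J I hJ hI hxJ hxI hJW hIW j hjW hjJ i hiW hiI (le_of_not_ge hij)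
  have split : ∀ (k : Fin n) (K : Set (Fin n)), k ∉ K → K ⊆ interval n a (b + 1) →
      K = (K ∩ interval n a k) ∪ (K ∩ interval n (k + 1) (b + 1)) := by
    intro k K hk hK
    ext m
    simp only [Set.mem_union, Set.mem_inter_iff]
    constructor
    · intro hm
      have h1 := hK hm
      have h2 : (m : ℕ) ≠ k := fun h => hk (Fin.ext h ▸ hm)
      simp only [interval, Set.mem_ofPred_eq] at h1 ⊢
      rcases lt_or_gt_of_ne h2 with h | h
      · exact Or.inl ⟨hm, by omega⟩
      · exact Or.inr ⟨hm, by omega⟩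
    · rintro (h | h) <;> exact h.1
  have comm : ∀ (p q r s : ℕ) (A B : Set (Fin n)), A ⊆ interval n p q → B ⊆ interval n r s →
      q < r → ∀ x ∈ parabolic u A, ∀ y ∈ parabolic u B, Commute x y := by
    intro p q r s A B hA hB hqr x hx y hy
    refine commute_of_mem_parabolic (fun i hi j hj => hc i j ?_) hx hy
    have h1 := hA hi
    have h2 := hB hj
    simp only [interval, Set.mem_ofPred_eq] at h1 h2
    omega
  have decomp : ∀ (p q r s : ℕ) (A B : Set (Fin n)), A ⊆ interval n p q → B ⊆ interval n r s →
      q < r → ∀ x ∈ parabolic u (A ∪ B), ∃ y ∈ parabolic u A, ∃ z ∈ parabolic u B, x = y * z := by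
    intro p q r s A B hA hB hqr x hx
    exact exists_mul_of_mem_parabolic_union (fun i hi j hj =>
      comm p q r s A B hA hB hqr _ (mem_parabolic hi) _ (mem_parabolic hj)) hx
  simp only [interval, Set.mem_ofPred_eq] at hiW hjW
  have hIs := split i I hiI hI
  have hJs := split j J hjJ hJ
  set I₁ := I ∩ interval n a i
  set I₂ := I ∩ interval n (i + 1) (b + 1)
  set J₁ := J ∩ interval n a j
  set J₂ := J ∩ interval n (j + 1) (b + 1)
  obtain ⟨y, hy, z, hz, rfl⟩ := decomp _ _ _ _ I₁ I₂ Set.inter_subset_right Set.inter_subset_right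
    (Nat.lt_succ_self _) x (hIs ▸ hxI)
  obtain ⟨y', hy', z', hz', hyz⟩ := decomp _ _ _ _ J₁ J₂ Set.inter_subset_right
    Set.inter_subset_right (Nat.lt_succ_self _) _ (hJs ▸ hxJ)
  -- The left side involves only generators below `j`, the right side only generators above `i`.
  have hw : y'⁻¹ * y = z' * z⁻¹ := by
    rw [inv_mul_eq_iff_eq_mul, ← mul_assoc, ← hyz, mul_inv_cancel_right]
  have sub : ∀ p q r s : ℕ, r ≤ p → q ≤ s → interval n p q ⊆ interval n r s := by
    intro p q r s h1 h2 m hm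
    simp only [interval, Set.mem_ofPred_eq] at hm ⊢
    omega
  obtain ⟨w, hwdef⟩ : ∃ w, w = y'⁻¹ * y := ⟨_, rfl⟩
  have hw2 : w = z' * z⁻¹ := hwdef.trans hw
  have hwj : w ∈ parabolic u (interval n a j) := by
    rw [hwdef]
    refine mul_mem (inv_mem (parabolic_mono Set.inter_subset_right hy'))
      (parabolic_mono (Set.inter_subset_right.trans (sub _ _ _ _ le_rfl hij)) hy)
  have hwi : w ∈ parabolic u (interval n (i + 1) (b + 1)) := by
    rw [hw2]
    refine mul_mem (parabolic_mono (Set.inter_subset_right.trans (sub _ _ _ _ (by omega) le_rfl))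
      hz') (inv_mem (parabolic_mono Set.inter_subset_right hz))
  have hwM : w ∈ parabolic u (interval n (a + 1) b) :=
    hM ⟨parabolic_mono (sub _ _ _ _ le_rfl (by omega)) hwj,
      parabolic_mono (sub _ _ _ _ (by omega) le_rfl) hwi⟩
  have hwj' := hL _ _ (sub _ _ _ _ le_rfl (by omega)) (sub _ _ _ _ (by omega) le_rfl) _ hwj hwM
  have hwi' := hR _ _ (sub _ _ _ _ (by omega) le_rfl) (sub _ _ _ _ le_rfl (by omega)) _ hwi hwM
  have hwm : w ∈ parabolic u (interval n (i + 1) j) := by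
    refine parabolic_mono ?_ (hL _ _ ?_ ?_ _ hwj' hwi')
    · intro m hm
      simp only [interval, Set.mem_ofPred_eq, Set.mem_inter_iff] at hm ⊢
      omega
    · exact Set.inter_subset_right.trans (sub _ _ _ _ (by omega) le_rfl)
    · exact Set.inter_subset_right.trans (sub _ _ _ _ (by omega) le_rfl)
  -- the left-hand factor
  have hy'eq : y' = y * w⁻¹ := by rw [hwdef]; group
  have h1 : y' ∈ parabolic u ((I₁ ∪ interval n (i + 1) j) ∩ J₁) := by
    refine hL _ _ (Set.union_subset (Set.inter_subset_right.trans (sub _ _ _ _ le_rfl (by omega)))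
      (sub _ _ _ _ (by omega) (by omega)))
      (Set.inter_subset_right.trans (sub _ _ _ _ le_rfl (by omega))) _ ?_ hy'
    rw [hy'eq]
    exact mul_mem (parabolic_mono Set.subset_union_left hy)
      (inv_mem (parabolic_mono Set.subset_union_right hwm))
  rw [Set.union_inter_distrib_right] at h1
  obtain ⟨p, hp, q, hq, hpq⟩ := decomp a i (i + 1) j _ _
    (Set.inter_subset_left.trans Set.inter_subset_right) Set.inter_subset_left
    (Nat.lt_succ_self _) _ h1
  have hpy : p⁻¹ * y = q * w := by
    rw [inv_mul_eq_iff_eq_mul, ← mul_assoc, ← hpq, hy'eq, inv_mul_cancel_right]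
  have h2 : p⁻¹ * y ∈ parabolic u (interval n a i ∩ interval n (i + 1) j) := by
    refine hL _ _ (sub _ _ _ _ le_rfl (by omega)) (sub _ _ _ _ (by omega) (by omega)) _
      (mul_mem (inv_mem (parabolic_mono (Set.inter_subset_left.trans Set.inter_subset_right) hp))
        (parabolic_mono Set.inter_subset_right hy)) ?_
    rw [hpy]
    exact mul_mem (parabolic_mono Set.inter_subset_left hq) hwm
  have disj : ∀ p q r s : ℕ, q ≤ r → interval n p q ∩ interval n r s = ∅ := by
    intro p q r s h
    ext m
    simp only [interval, Set.mem_inter_iff, Set.mem_ofPred_eq, Set.mem_empty_iff_false, iff_false]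
    omega
  rw [disj _ _ _ _ (Nat.le_succ _), parabolic_empty, Subgroup.mem_bot] at h2
  have hyp : y = p := (inv_mul_eq_one.1 h2).symm
  have hwq : w⁻¹ = q := by
    rw [hpy] at h2
    exact (eq_inv_of_mul_eq_one_left h2).symm
  -- the right-hand factor
  have hzeq : z = w⁻¹ * z' := by rw [hw2]; group
  have h3 : z ∈ parabolic u (I₂ ∩ (interval n (i + 1) j ∪ J₂)) := by
    refine hR _ _ (Set.inter_subset_right.trans (sub _ _ _ _ (by omega) le_rfl))
      (Set.union_subset (sub _ _ _ _ (by omega) (by omega))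
      (Set.inter_subset_right.trans (sub _ _ _ _ (by omega) le_rfl))) _ hz ?_
    rw [hzeq]
    exact mul_mem (inv_mem (parabolic_mono Set.subset_union_left hwm))
      (parabolic_mono Set.subset_union_right hz')
  rw [Set.inter_union_distrib_left] at h3
  obtain ⟨r, hr, s, hs, hrs⟩ := decomp (i + 1) j (j + 1) (b + 1) _ _
    Set.inter_subset_right (Set.inter_subset_right.trans Set.inter_subset_right)
    (Nat.lt_succ_self _) _ h3
  have hrw : r⁻¹ * w⁻¹ = s * z'⁻¹ := by
    rw [inv_mul_eq_iff_eq_mul, ← mul_assoc, ← hrs, hzeq, mul_inv_cancel_right]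
  have h4 : r⁻¹ * w⁻¹ ∈ parabolic u (interval n (i + 1) j ∩ interval n (j + 1) (b + 1)) := by
    refine hR _ _ (sub _ _ _ _ (by omega) (by omega)) (sub _ _ _ _ (by omega) le_rfl) _
      (mul_mem (inv_mem (parabolic_mono Set.inter_subset_right hr)) (inv_mem hwm)) ?_
    rw [hrw]
    exact mul_mem (parabolic_mono (Set.inter_subset_right.trans Set.inter_subset_right) hs)
      (inv_mem (parabolic_mono Set.inter_subset_right hz'))
  rw [disj _ _ _ _ (Nat.le_succ _), parabolic_empty, Subgroup.mem_bot] at h4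
  have hwr : w⁻¹ = r := (inv_mul_eq_one.1 h4).symm
  have hzs : z' = s := by
    rw [hrw, mul_inv_eq_one] at h4
    exact h4.symm
  -- As `w⁻¹ = r` it lies in the part of `I` above `i`, and as `w⁻¹ = q` in the part of `J` below
  -- `j`.
  have h5 : w⁻¹ ∈ parabolic u ((I₂ ∩ interval n (i + 1) j) ∩ (interval n (i + 1) j ∩ J₁)) := by
    refine hL _ _ (Set.inter_subset_right.trans (sub _ _ _ _ (by omega) (by omega)))
      (Set.inter_subset_left.trans (sub _ _ _ _ (by omega) (by omega))) _ (hwr ▸ hr) (hwq ▸ hq)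
  rw [hzeq]
  refine mul_mem ?_ (mul_mem (parabolic_mono ?_ h5) ?_)
  · rw [hyp]
    exact parabolic_mono (Set.inter_subset_inter Set.inter_subset_left Set.inter_subset_left) hp
  · exact fun m hm => ⟨hm.1.1.1, hm.2.2.1⟩
  · rw [hzs]
    exact parabolic_mono (Set.inter_subset_inter Set.inter_subset_left Set.inter_subset_left) hs

/-- The intersection property of string groups generated by involutions follows from the
intersection properties of the pairs of maximal string subgroups of all string subgroups. -/
theorem intersectionProperty_of_interval
    (hc : ∀ i j : Fin n, (i : ℕ) + 1 < j → Commute (u i) (u j))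
    (hM : ∀ a b, a < b → b < n →
      parabolic u (interval n a b) ⊓ parabolic u (interval n (a + 1) (b + 1)) ≤
      parabolic u (interval n (a + 1) b)) : IntersectionProperty u := by
  have key : ∀ k a, a + k ≤ n → InterOn u (interval n a (a + k)) := by
    intro k
    induction k with
    | zero =>
      intro a _ I J hI hJ x hx hx'
      have h0 : interval n a (a + 0) = ∅ := by
        ext m
        simp only [interval, Set.mem_ofPred_eq, Set.mem_empty_iff_false, iff_false]
        omega
      rw [h0] at hI hJ
      rwa [Set.subset_empty_iff.1 hI, Set.empty_inter, ← Set.subset_empty_iff.1 hI]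
    | succ k ih =>
      intro a ha
      rcases Nat.eq_zero_or_pos k with rfl | hk
      · intro I J hI hJ x hx hx'
        by_cases hIJ : I ⊆ J
        · rwa [Set.inter_eq_left.2 hIJ]
        · obtain ⟨i, hi, -⟩ := Set.not_subset.1 hIJ
          suffices h : J ⊆ I by rwa [Set.inter_eq_right.2 h]
          intro j hj
          have h1 := hI hi
          have h2 := hJ hj
          simp only [interval, Set.mem_ofPred_eq] at h1 h2
          rwa [show j = i from Fin.ext (by omega)]
      · refine InterOn.step hc (ih a (by omega)) ?_ (hM a (a + k) (by omega) (by omega))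
        have := ih (a + 1) (by omega)
        rwa [Nat.add_right_comm] at this
  intro I J
  have huniv : ∀ K : Set (Fin n), K ⊆ interval n 0 (0 + n) := fun K m _ => by
    simp [interval]
  refine le_antisymm (fun x hx => key n 0 (by omega) I J (huniv I) (huniv J) x hx.1 hx.2) ?_
  exact le_inf (parabolic_mono Set.inter_subset_left) (parabolic_mono Set.inter_subset_right)

end Parabolic

/-! ### Certified coset enumeration -/

section CosetEnumeration

/-- The field of 32 bits at position `i` of a packed table. -/
def packedEntry (T i : ℕ) : ℕ := (T >>> (32 * i)) % 4294967296

/-- A packed coset table for words in at most 6 involutory generators. The entry of a coset `x` and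
a generator `g` consists of the coset `g • x`, of a rank, and of the position and the number of the
relator from which the entry follows by means of entries of smaller rank. -/
structure CosetTable where
  /-- the relators -/
  rels : List (List ℕ)
  /-- the generators of the group -/
  gens : List ℕ
  /-- the generators of the subgroup -/
  subgens : List ℕ
  /-- the pairs `(x, g)` such that the cosets `1, 2, …` are defined as `g • x` -/
  tree : List (ℕ × ℕ)
  /-- the packed entries -/
  entries : ℕ

namespace CosetTable

variable (t : CosetTable)

def size : ℕ := t.tree.length + 1

def entry (x g : ℕ) : ℕ := packedEntry t.entries (6 * x + g)

def next (x g : ℕ) : ℕ := t.entry x g % 256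

def rank (x g : ℕ) : ℕ := t.entry x g / 256 % 256

def pos (x g : ℕ) : ℕ := t.entry x g / 65536 % 256

def rel (x g : ℕ) : ℕ := t.entry x g / 16777216

/-- Apply the letters of a word to a coset, by means of entries of rank less than `r`. -/
def trace (r : ℕ) : List ℕ → ℕ → Option ℕ
  | [], x => some x
  | g :: w, x =>
    bif Nat.blt (t.rank x g) r && (Nat.blt x t.size && t.gens.elem g) then trace r w (t.next x g)
    else none

def isDefined (x g y : ℕ) : Bool := Nat.blt x y && (t.tree.getD (y - 1) (0, 0) == (x, g))

/-- The cyclic permutation of the word `w` that starts at position `k`. -/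
def rotateWord (w : List ℕ) (k : ℕ) : List ℕ := w.drop k ++ w.take k

def followsFrom (x g : ℕ) : List ℕ → Bool
  | [] => false
  | h :: w => h == g && t.trace (t.rank x g) w x == some (t.next x g)

def checkEntry (x g : ℕ) : Bool :=
  Nat.blt (t.next x g) t.size &&
  (t.isDefined x g (t.next x g) || t.isDefined (t.next x g) g x ||
    (x == 0 && t.next x g == 0 && t.subgens.elem g) ||
    t.followsFrom x g (rotateWord (t.rels.getD (t.rel x g) []) (t.pos x g)))

def check : Bool := (List.range t.size).all fun x => t.gens.all fun g => t.checkEntry x g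

variable {t} {G X : Type*} [Group G] [MulAction G X] {v : ℕ → G} {p : ℕ → X}

/-- Tracing applies the first letter first, while the product acts with its last letter first. As
the letters are involutions, the product therefore leads from the end of the path back to its start.
-/
theorem trace_eq {r : ℕ} (hinv : ∀ g ∈ t.gens, v g * v g = 1)
    (h : ∀ x g, x < t.size → g ∈ t.gens → t.rank x g < r → v g • p x = p (t.next x g))
    {w : List ℕ} {x z : ℕ} (ht : t.trace r w x = some z) : (w.map v).prod • p z = p x := by
  induction w generalizing x with
  | nil =>
    simp only [trace, Option.some.injEq] at ht
    simp [ht]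
  | cons g w ih =>
    rw [trace, Bool.cond_eq_ite] at ht
    split at ht
    · rename_i hc
      simp only [Bool.and_eq_true, Nat.blt_eq, List.elem_eq_mem, decide_eq_true_eq] at hc
      have := ih ht
      rw [List.map_cons, List.prod_cons, mul_smul, this, ← h x g hc.2.1 hc.2.2 hc.1, smul_smul,
        hinv g hc.2.2, one_smul]
    · cases ht

theorem prod_rotateWord {w : List ℕ} (hw : (w.map v).prod = 1) (k : ℕ) :
    ((rotateWord w k).map v).prod = 1 := by
  rw [rotateWord, List.map_append, List.prod_append, mul_eq_one_comm, ← List.prod_append,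
    ← List.map_append, List.take_append_drop, hw]

/-- Each entry is a definition, the inverse of one, a subgroup generator fixing coset `0`, or the
deduction that closes a rotated relator. Deductions use only entries of smaller rank, which makes
induction on the rank possible. Distinctness of the `p x` is never claimed, so a table yields only
an upper bound for the index. -/
theorem smul_eq (hinv : ∀ g ∈ t.gens, v g * v g = 1) (hrel : ∀ r ∈ t.rels, (r.map v).prod = 1)
    (hsub : ∀ g ∈ t.subgens, v g • p 0 = p 0)
    (hp : ∀ x g y, t.isDefined x g y = true → v g • p x = p y) (hc : t.check = true) (r : ℕ) :
    ∀ x g, x < t.size → g ∈ t.gens → t.rank x g = r → v g • p x = p (t.next x g) := by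
  have hc' : ∀ x g, x < t.size → g ∈ t.gens → t.checkEntry x g = true := by
    intro x g hx hg
    rw [check, List.all_eq_true] at hc
    exact List.all_eq_true.1 (hc x (List.mem_range.2 hx)) g hg
  induction r using Nat.strong_induction_on with
  | _ r ih =>
    intro x g hx hg hr
    have h := hc' x g hx hg
    simp only [checkEntry, Bool.and_eq_true, Bool.or_eq_true, Nat.blt_eq, beq_iff_eq,
      List.elem_eq_mem, decide_eq_true_eq] at h
    obtain ⟨hlt, ((h | h) | h) | h⟩ := h
    · exact hp _ _ _ h
    · rw [← hp _ _ _ h, smul_smul, hinv g hg, one_smul]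
    · obtain ⟨⟨rfl, h1⟩, h2⟩ := h
      rw [h1]
      exact hsub g h2
    · have hw : ((rotateWord (t.rels.getD (t.rel x g) []) (t.pos x g)).map v).prod = 1 := by
        apply prod_rotateWord
        rw [List.getD_eq_getElem?_getD]
        rcases hi : t.rels[t.rel x g]? with _ | w
        · simp
        · exact hrel w (List.mem_of_getElem? hi)
      generalize rotateWord (t.rels.getD (t.rel x g) []) (t.pos x g) = w at h hw
      cases w with
      | nil => cases h
      | cons g' w =>
        simp only [followsFrom, Bool.and_eq_true, beq_iff_eq] at h
        obtain ⟨rfl, h⟩ := h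
        have := trace_eq (v := v) (p := p) hinv
          (fun x' g' hx' hg' hlt' => ih _ (hr ▸ hlt') x' g' hx' hg' rfl) h
        rw [List.map_cons, List.prod_cons] at hw
        rw [← this, smul_smul, hw, one_smul]

end CosetTable

/-- Todd-Coxeter: a complete table bounds the index of a subgroup. -/
theorem CosetTable.relIndex_le (t : CosetTable) (hc : t.check = true) {G : Type*} [Group G]
    {v : ℕ → G} (hinv : ∀ g ∈ t.gens, v g * v g = 1) (hrel : ∀ r ∈ t.rels, (r.map v).prod = 1)
    {H K : Subgroup G} (hH : ∀ g ∈ t.subgens, v g ∈ H)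
    (hK : K ≤ Subgroup.closure (v '' {g | g ∈ t.gens})) :
    H.relIndex K ≠ 0 ∧ H.relIndex K ≤ t.size := by
  obtain ⟨p, hp0, hp⟩ : ∃ p : ℕ → G ⧸ H, p 0 = ((1 : G) : G ⧸ H) ∧
      ∀ x g y, t.isDefined x g y = true → v g • p x = p y := by
    let p : ℕ → G ⧸ H := fun y => Nat.strongRecOn y fun y ih =>
      if h : (t.tree.getD (y - 1) (0, 0)).1 < y then
        v (t.tree.getD (y - 1) (0, 0)).2 • ih (t.tree.getD (y - 1) (0, 0)).1 h
      else ((1 : G) : G ⧸ H)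
    have hp : ∀ y, p y = if (t.tree.getD (y - 1) (0, 0)).1 < y then
        v (t.tree.getD (y - 1) (0, 0)).2 • p (t.tree.getD (y - 1) (0, 0)).1
      else ((1 : G) : G ⧸ H) := by
      intro y
      simp only [p]
      rw [Nat.strongRecOn_eq]
      split <;> rfl
    -- For `y = 0` the truncated `y - 1` reads the first tree entry, but no parent is less than `0`,
    -- so the default value, the trivial coset, is taken.
    refine ⟨p, by rw [hp]; simp, fun x g y h => ?_⟩
    simp only [CosetTable.isDefined, Bool.and_eq_true, Nat.blt_eq, beq_iff_eq] at h
    rw [hp y, h.2, if_pos h.1]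
  have hfact : ∀ x g, x < t.size → g ∈ t.gens → v g • p x = p (t.next x g) := by
    refine fun x g hx hg => CosetTable.smul_eq hinv hrel (fun g hg => ?_) hp hc _ x g hx hg rfl
    rw [hp0, MulAction.Quotient.smul_mk, smul_eq_mul, mul_one, eq_comm]
    exact QuotientGroup.eq.2 (by simpa using hH g hg)
  have hlt : ∀ x g, x < t.size → g ∈ t.gens → t.next x g < t.size := by
    intro x g hx hg
    rw [CosetTable.check, List.all_eq_true] at hc
    have := List.all_eq_true.1 (hc x (List.mem_range.2 hx)) g hg
    simp only [CosetTable.checkEntry, Bool.and_eq_true, Nat.blt_eq] at this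
    exact this.1
  have horb : ∀ k ∈ Subgroup.closure (v '' {g | g ∈ t.gens}), ∀ x < t.size,
      ∃ y < t.size, k • p x = p y := by
    intro k hk
    induction hk using Subgroup.closure_induction'' with
    | mem k hk =>
      obtain ⟨g, hg, rfl⟩ := hk
      exact fun x hx => ⟨_, hlt x g hx hg, hfact x g hx hg⟩
    | inv_mem k hk =>
      obtain ⟨g, hg, rfl⟩ := hk
      rw [inv_eq_of_mul_eq_one_left (hinv g hg)]
      exact fun x hx => ⟨_, hlt x g hx hg, hfact x g hx hg⟩
    | one => exact fun x hx => ⟨x, hx, one_smul _ _⟩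
    | mul a b _ _ ha hb =>
      intro x hx
      obtain ⟨y, hy, hxy⟩ := hb x hx
      obtain ⟨z, hz, hyz⟩ := ha y hy
      exact ⟨z, hz, by rw [mul_smul, hxy, hyz]⟩
  have hsize : 0 < t.size := Nat.succ_pos _
  have hst : MulAction.stabilizer K ((1 : G) : G ⧸ H) = H.subgroupOf K := by
    ext ⟨k, hk⟩
    rw [MulAction.mem_stabilizer_iff, Subgroup.mem_subgroupOf]
    change ((k * 1 : G) : G ⧸ H) = ((1 : G) : G ⧸ H) ↔ k ∈ H
    rw [mul_one, eq_comm, QuotientGroup.eq]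
    simp
  have hsub : MulAction.orbit K ((1 : G) : G ⧸ H) ⊆ p '' Set.Iio t.size := by
    rintro _ ⟨⟨k, hk⟩, rfl⟩
    obtain ⟨y, hy, h⟩ := horb k (hK hk) 0 hsize
    rw [hp0] at h
    exact ⟨y, hy, h.symm⟩
  have hfin : (p '' Set.Iio t.size).Finite := (Set.finite_Iio _).image p
  -- An infinite index has the value `0`, so the bound is useful only together with its being
  -- non-zero.
  rw [Subgroup.relIndex, ← hst, MulAction.index_stabilizer]
  constructor
  · exact ((Set.ncard_pos (hfin.subset hsub)).2 ⟨_, MulAction.mem_orbit_self _⟩).ne'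
  · refine (Set.ncard_le_ncard hsub hfin).trans ((Set.ncard_image_le (Set.finite_Iio _)).trans ?_)
    simp [Set.ncard_eq_toFinset_card']

end CosetEnumeration

/-! ### Orbits and point stabilizers -/

section Orbit

variable {G X : Type*} [Group G] (φ : G →* Equiv.Perm X)

/-- The stabilizer of a point in a permutation representation. -/
def pointStabilizer (x : X) : Subgroup G where
  carrier := {g | φ g x = x}
  mul_mem' {g h} hg hh := by
    change φ (g * h) x = x
    rw [map_mul, Equiv.Perm.mul_apply, hh, hg]
  one_mem' := by simp
  inv_mem' {g} hg := by
    change φ g⁻¹ x = x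
    rw [map_inv, Equiv.Perm.inv_eq_iff_eq, hg]

variable {φ}

theorem mem_pointStabilizer {x : X} {g : G} : g ∈ pointStabilizer φ x ↔ φ g x = x := Iff.rfl

theorem pointStabilizer_relIndex (x : X) (A : Subgroup G) :
    (pointStabilizer φ x).relIndex A = {y | ∃ g ∈ A, φ g x = y}.ncard := by
  let _ : MulAction A X := MulAction.compHom X (φ.comp A.subtype)
  have h1 : MulAction.stabilizer A x = (pointStabilizer φ x).subgroupOf A := by
    ext g
    rfl
  have h2 : {y | ∃ g ∈ A, φ g x = y} = MulAction.orbit A x := by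
    ext y
    exact ⟨fun ⟨g, hg, h⟩ => ⟨⟨g, hg⟩, h⟩, fun ⟨⟨g, hg⟩, h⟩ => ⟨g, hg, h⟩⟩
  rw [Subgroup.relIndex, ← h1, MulAction.index_stabilizer, h2]

end Orbit

/-! ### Linear algebra over `𝔽₂` in binary digits -/

section Bits

/-- The vector over `𝔽₂` with the given binary digits. -/
def vec (n x : ℕ) : Fin n → ZMod 2 := fun j => bif x.testBit j then 1 else 0

/-- The matrix over `𝔽₂` whose rows have the given binary digits. -/
def ofRows (m n : ℕ) (M : List ℕ) : Matrix (Fin m) (Fin n) (ZMod 2) :=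
  Matrix.of fun i => vec n (M.getD i 0)

/-- The product of a row vector and a matrix, in terms of binary digits. -/
def act : List ℕ → ℕ → ℕ
  | [], _ => 0
  | r :: M, x => bif Nat.beq (x % 2) 1 then Nat.xor r (act M (x / 2)) else act M (x / 2)

@[simp] theorem vec_zero (n : ℕ) : vec n 0 = 0 := by
  ext j
  simp [vec]

theorem vec_xor (n x y : ℕ) : vec n (x ^^^ y) = vec n x + vec n y := by
  ext j
  simp only [vec, Nat.testBit_xor, Pi.add_apply]
  cases x.testBit j <;> cases y.testBit j <;> decide

theorem vec_injOn {n x y : ℕ} (hx : x < 2 ^ n) (hy : y < 2 ^ n) (h : vec n x = vec n y) :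
    x = y := by
  apply Nat.eq_of_testBit_eq
  intro i
  by_cases hi : i < n
  · have := congrFun h ⟨i, hi⟩
    simp only [vec] at this
    revert this
    cases x.testBit i <;> cases y.testBit i <;> decide
  · rw [Nat.testBit_lt_two_pow, Nat.testBit_lt_two_pow]
    · exact hy.trans_le (Nat.pow_le_pow_right (by norm_num) (by omega))
    · exact hx.trans_le (Nat.pow_le_pow_right (by norm_num) (by omega))

theorem exists_vec {n : ℕ} (v : Fin n → ZMod 2) : ∃ x < 2 ^ n, vec n x = v := by
  have h : Function.Bijective fun x : Fin (2 ^ n) => vec n x := by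
    rw [Fintype.bijective_iff_injective_and_card]
    refine ⟨fun x y hxy => Fin.ext (vec_injOn x.2 y.2 hxy), ?_⟩
    simp [ZMod.card]
  obtain ⟨x, hx⟩ := h.2 v
  exact ⟨x, x.2, hx⟩

theorem vec_two_pow {n i : ℕ} (hi : i < n) : vec n (2 ^ i) = Pi.single ⟨i, hi⟩ 1 := by
  ext j
  simp only [vec, Nat.testBit_two_pow, Pi.single_apply, Fin.ext_iff]
  by_cases h : i = j <;> simp [h, eq_comm]

theorem vecMul_ofRows (n : ℕ) (M : List ℕ) (x : ℕ) :
    vec M.length x ᵥ* ofRows M.length n M = vec n (act M x) := by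
  induction M generalizing x with
  | nil => simp [act]
  | cons r M ih =>
    ext j
    have := congrFun (ih (x / 2)) j
    simp only [Matrix.vecMul, dotProduct, ofRows, Matrix.of_apply] at this
    simp only [List.length_cons, Matrix.vecMul, dotProduct, Fin.sum_univ_succ, ofRows,
      Matrix.of_apply]
    simp only [Fin.val_zero, List.getD_cons_zero, Fin.val_succ, List.getD_cons_succ]
    have h1 : ∀ i : Fin M.length, vec (M.length + 1) x i.succ = vec M.length (x / 2) i := by
      intro i
      simp [vec, Nat.testBit_succ]
    simp only [h1, this, act]
    have h2 : vec (M.length + 1) x 0 = if x % 2 = 1 then 1 else 0 := by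
      simp [vec, Nat.testBit_zero, Bool.cond_eq_ite]
    rw [h2]
    simp only [Bool.cond_eq_ite, Nat.beq_eq]
    by_cases h : x % 2 = 1
    · simp only [h, if_true, one_mul]
      exact (congrFun (vec_xor n r (act M (x / 2))) j).symm
    · simp [h]

theorem vecMul_ofRows' {m : ℕ} (n : ℕ) {M : List ℕ} (hM : M.length = m) (x : ℕ) :
    vec m x ᵥ* ofRows m n M = vec n (act M x) := by
  subst hM
  exact vecMul_ofRows n M x

theorem ofRows_mul {l m : ℕ} (n : ℕ) {M M' : List ℕ} (hM : M.length = l) (hM' : M'.length = m) :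
    ofRows l m M * ofRows m n M' = ofRows l n (M.map (act M')) := by
  ext i j
  have h1 : (ofRows l m M * ofRows m n M') i = ofRows l m M i ᵥ* ofRows m n M' :=
    Matrix.mul_apply_eq_vecMul _ _ _
  rw [h1]
  change (vec m (M.getD i 0) ᵥ* ofRows m n M') j = vec n ((M.map (act M')).getD i 0) j
  rw [vecMul_ofRows' n hM']
  congr 2
  have : (i : ℕ) < M.length := hM ▸ i.2
  simp [this]

theorem linearMap_ext_vec {m : ℕ} {N : Type*} [AddCommGroup N] [Module (ZMod 2) N]
    {f g : (Fin m → ZMod 2) →ₗ[ZMod 2] N} (h : ∀ i < m, f (vec m (2 ^ i)) = g (vec m (2 ^ i))) :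
    f = g := by
  refine (Pi.basisFun (ZMod 2) (Fin m)).ext fun i => ?_
  have := h i i.2
  rw [vec_two_pow i.2] at this
  simpa using this

end Bits

/-! ### Orbit search -/

section OrbitList

/-- Evaluate the argument before passing it on. -/
def forced {α : Sort*} (x : ℕ) (k : ℕ → α) : α := Nat.rec (k 0) (fun y _ => k (Nat.succ y)) x

@[simp] theorem forced_eq {α : Sort*} (x : ℕ) (k : ℕ → α) : forced x k = k x := by
  cases x <;> rfl

/-- Add the images of `x` under the matrices `Ms` to the queue and to the list of points, then pass
on the results. -/
def orbitStep {α : Sort*} (x : ℕ) (k : List ℕ → List ℕ → α) : List (List ℕ) → List ℕ → List ℕ → α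
  | [], q, s => k q s
  | M :: Ms, q, s => forced (act M x) fun y =>
    bif s.any (Nat.beq y) then orbitStep x k Ms q s else orbitStep x k Ms (y :: q) (y :: s)

/-- Search for the orbit of a vector. -/
def orbitSearch (Ms : List (List ℕ)) : ℕ → List ℕ → List ℕ → List ℕ
  | 0, _, s => s
  | _ + 1, [], s => s
  | f + 1, x :: q, s => orbitStep x (orbitSearch Ms f) Ms q s

theorem orbitStep_induction {α : Sort*} {C : α → Prop} {P : List ℕ → List ℕ → Prop} {x : ℕ}
    {k : List ℕ → List ℕ → α} {Ms : List (List ℕ)} (hk : ∀ q s, P q s → C (k q s))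
    (h : ∀ M ∈ Ms, ∀ q s, P q s → act M x ∉ s → P (act M x :: q) (act M x :: s)) :
    ∀ q s, P q s → C (orbitStep x k Ms q s) := by
  induction Ms with
  | nil => exact hk
  | cons M Ms ih =>
    intro q s hP
    have ih := ih fun M hM => h M (List.mem_cons_of_mem _ hM)
    rw [orbitStep, forced_eq, Bool.cond_eq_ite]
    split
    · exact ih q s hP
    · rename_i hs
      refine ih _ _ (h M List.mem_cons_self q s hP fun hmem => hs ?_)
      exact List.any_eq_true.2 ⟨_, hmem, by simp⟩

theorem orbitSearch_induction {P : List ℕ → List ℕ → Prop} {Ms : List (List ℕ)}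
    (hq : ∀ x q s, P (x :: q) s → x ∈ s ∧ P q s)
    (h : ∀ x q s, x ∈ s → ∀ M ∈ Ms, P q s → act M x ∉ s → P (act M x :: q) (act M x :: s)) :
    ∀ f q s, P q s → ∃ q', P q' (orbitSearch Ms f q s) := by
  intro f
  induction f with
  | zero => exact fun q s hP => ⟨q, hP⟩
  | succ f ih =>
    intro q s hP
    cases q with
    | nil => exact ⟨_, hP⟩
    | cons x q =>
      refine orbitStep_induction (C := fun s => ∃ q', P q' s)
        (P := fun q s => x ∈ s ∧ P q s) (fun q s h => ih q s h.2) ?_ q s (hq x q s hP)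
      intro M hM q s hs hn
      exact ⟨List.mem_cons_of_mem _ hs.1, h x q s hs.1 M hM hs.2 hn⟩

/-- The points of the orbit of a vector that are found in at most `f` steps. -/
def orbitList (Ms : List (List ℕ)) (f x : ℕ) : List ℕ := orbitSearch Ms f [x] [x]

/-- Only soundness is proved: the points found are distinct and share every property that holds at
`x` and is passed on by the matrices. Completeness is not needed, since the lists serve to bound
orbits from below and to propagate fixed vectors. -/
theorem orbitList_spec {Ms : List (List ℕ)} {R : ℕ → Prop} {x : ℕ} (h0 : R x)
    (h : ∀ M ∈ Ms, ∀ y, R y → R (act M y)) (f : ℕ) :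
    (orbitList Ms f x).Nodup ∧ ∀ y ∈ orbitList Ms f x, R y := by
  obtain ⟨q', hq'⟩ := orbitSearch_induction (Ms := Ms)
    (P := fun q s => (∀ y ∈ q, y ∈ s) ∧ s.Nodup ∧ ∀ y ∈ s, R y)
    (fun y q s hP => ⟨hP.1 y List.mem_cons_self,
      fun z hz => hP.1 z (List.mem_cons_of_mem _ hz), hP.2⟩) (by
      intro y q s hy M hM hP hn
      refine ⟨fun z hz => ?_, List.nodup_cons.2 ⟨hn, hP.2.1⟩, fun z hz => ?_⟩
      · rcases List.mem_cons.1 hz with rfl | hz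
        · exact List.mem_cons_self
        · exact List.mem_cons_of_mem _ (hP.1 z hz)
      · rcases List.mem_cons.1 hz with rfl | hz
        · exact h M hM y (hP.2.2 y hy)
        · exact hP.2.2 z hz) f [x] [x] (by simpa using h0)
  exact hq'.2

end OrbitList

/-! ### The generating matrices in binary digits -/

section Generators

/-- The rows of the generating matrices. -/
def genRows : ℕ → List ℕ
  | 0 =>
      [1, 62, 133, 137, 145, 161, 124, 128, 256, 15872, 34048, 35072, 37120, 41216, 31744,
       32768, 65536, 4063232, 8716288, 8978432, 9502720, 10551296, 8126464, 8388608]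
  | 1 =>
      [1, 2, 128, 64, 16, 32, 8, 4, 256, 512, 32768, 16384, 4096, 8192, 2048, 1024, 65536,
       131072, 8388608, 4194304, 1048576, 2097152, 524288, 262144]
  | 2 =>
      [1, 2, 32, 16, 8, 4, 64, 128, 256, 512, 8192, 4096, 2048, 1024, 16384, 32768, 8388608,
       4194304, 262144, 524288, 1048576, 2097152, 131072, 65536]
  | 3 =>
      [1, 2, 4, 8, 32, 16, 64, 128, 65536, 131072, 262144, 524288, 1048576, 2097152, 4194304,
       8388608, 256, 512, 1024, 2048, 4096, 8192, 16384, 32768]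
  | 4 =>
      [256, 512, 1024, 2048, 4096, 8192, 16384, 32768, 1, 2, 4, 8, 16, 32, 64, 128, 65536,
       131072, 262144, 524288, 2097152, 1048576, 4194304, 8388608]
  | _ =>
      [1, 3, 4, 8, 16, 32, 64, 128, 3145728, 1048576, 12582912, 4194304, 131072, 196608,
       524288, 786432, 12288, 4096, 49152, 16384, 512, 768, 2048, 3072]
end Generators

/-! ### The coset tables -/

section Tables

/-- The power of a word. -/
def wordPow (n : ℕ) (w : List ℕ) : List ℕ := (List.replicate n w).flatten

theorem prod_wordPow {G : Type*} [Group G] (v : ℕ → G) (n : ℕ) (w : List ℕ) :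
    ((wordPow n w).map v).prod = (w.map v).prod ^ n := by
  induction n with
  | zero => simp [wordPow]
  | succ n ih =>
    rw [pow_succ', ← ih]
    simp [wordPow, List.replicate_succ]

/-- Two cosets of the trivial group in a group of order 2. -/
def tableA1 : CosetTable where
  rels :=
    []
  gens := [1]
  subgens := []
  tree :=
    [(0, 1)]
  entries :=
    0x100000000

/-- The cosets of `⟨b⟩` in `⟨b, c⟩` for the diagram `[3]`. -/
def tableA2 : CosetTable where
  rels :=
    [wordPow 3 [1,2]]
  gens := [1, 2]
  subgens := [1]
  tree :=
    [(0, 2), (1, 1)]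
  entries :=
    0x101020000000100000000000000000000000000000000000000000000000200000000000000000000000000000000000000010000000000000000

/-- The cosets of `⟨b, c⟩` in `⟨a, b, c⟩` for the diagram `[3, 3]`. -/
def tableA3 : CosetTable where
  rels :=
    [wordPow 3 [0,1], wordPow 2 [0,2], wordPow 3 [1,2]]
  gens := [0, 1, 2]
  subgens := [1, 2]
  tree :=
    [(0, 0), (1, 1), (2, 2)]
  entries :=
    0x20200020301000203000000000000000000000000000000030000000100000102000000000000000000000000010101010000000200000000000000000000000000000000000000000000000000000001

/-- The cosets of `⟨c, d⟩` in `⟨b, c, d⟩` for the diagram `[3, 4]`. -/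
def tableB3overB2 : CosetTable where
  rels :=
    [wordPow 3 [1,2], wordPow 2 [1,3], wordPow 4 [2,3]]
  gens := [1, 2, 3]
  subgens := [2, 3]
  tree :=
    [(0, 1), (1, 2), (2, 3), (3, 2), (4, 1)]
  entries :=
    0x1010305000103050000000400000000000000000000000002010204000000030000000500000000000000000000000000000002000000040100020300000000000000000000000000000003000000010000010200000000000000000000000001010101000000020000000000000000000000000000000000000000000000000000000100000000

/-- The cosets of `⟨b, c⟩` in `⟨b, c, d⟩` for the diagram `[3, 4]`. -/
def tableB3overA2 : CosetTable where
  rels :=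
    [wordPow 3 [1,2], wordPow 2 [1,3], wordPow 4 [2,3]]
  gens := [1, 2, 3]
  subgens := [1, 2]
  tree :=
    [(0, 3), (1, 2), (2, 1), (2, 3), (3, 3), (5, 2), (6, 3)]
  entries :=
    0x6020003070100030700000000000000000000000000000007000000050000020600000000000000000000000000000003000000060100010400000000000000000000000000000002020001040100010500000000000000000000000000000005000102030000000200000000000000000000000000000004000000010000000300000000000000000000000000000000000000020100010100000000000000000000000000000001000000000000000000000000

/-- The cosets of `⟨b, c, d⟩` in `⟨b, c, d, e⟩` for the diagram `[3, 4, 3]`. -/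
def tableF4 : CosetTable where
  rels :=
    [wordPow 3 [1,2], wordPow 2 [1,3], wordPow 2 [1,4], wordPow 4 [2,3], wordPow 2 [2,4],
     wordPow 3 [3,4]]
  gens := [1, 2, 3, 4]
  subgens := [1, 2, 3]
  tree :=
    [(0, 4), (1, 3), (2, 2), (3, 1), (3, 3), (4, 3), (5, 4), (6, 2), (6, 4), (8, 3), (8, 4),
     (10, 4), (11, 3), (12, 3), (13, 2), (14, 2), (15, 1), (16, 1), (16, 3), (18, 3), (20, 2),
     (21, 3), (22, 4)]
  entries :=
    0x1605000917040009170200091700000000000000000000001700000015030008160100081600000000000000000401081500000016000000140000071500000000000000000201071400000012000000150100011300000000000000000501061300000010030006130100011400000000000000000201031100000014000107120000001000000000000000000201031201010611000106110000000f00000000000000000401020f000000130000000e000000120000000000000000040102100301050f0000000d0000001100000000000000000501010d0000000c000000100100060e00000000000000000501010e0000000b0000000f0100050d00000000000000000000000a0000000e0400050c0200050c0000000000000000000000080000000d040001090000040b00000000000000000000000c000000080300040a0100040a000000000000000000000006010104090400010b0200020700000000000000000000000b0000000a0000000600000308000000000000000000000005050003070400030702000209000000000000000000000009000000040000000801000105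00000000000000000000000700000003030002050100010600000000000000000201030400000006000103040000000300000000000000000401020300000005000000020000000400000000000000000501010200000001000000030100020200000000000000000000000000000002040001010200010100000000000000000000000100000000000000000000000000000000

/-- The cosets of `⟨b, c, d, e⟩` in `[3, 3, 4, 3]_{(2, 2, 0, 0)}`. -/
def tableFacet : CosetTable where
  rels :=
    [wordPow 3 [0,1], wordPow 2 [0,2], wordPow 2 [0,3], wordPow 2 [0,4], wordPow 3 [1,2],
     wordPow 2 [1,3], wordPow 2 [1,4], wordPow 4 [2,3], wordPow 2 [2,4], wordPow 3 [3,4],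
     -- The reversed word is listed as well because only cyclic rotations of a relator are read; for
     -- a Coxeter relator the reversal is itself a rotation.
     wordPow 4 [0,1,2,3,2,1,4,3,2,3,4], wordPow 4 [4,3,2,3,4,1,2,3,2,1,0]]
  gens := [0, 1, 2, 3, 4]
  subgens := [1, 2, 3, 4]
  tree :=
    [(0, 0), (1, 1), (2, 2), (3, 3), (4, 2), (4, 4), (5, 1), (5, 4), (7, 0), (7, 4), (8, 3),
     (9, 4), (10, 3), (11, 2), (12, 3), (13, 2), (14, 1), (15, 2), (16, 1), (16, 3), (17, 0),
     (18, 1), (18, 3), (19, 0), (19, 3), (20, 4), (22, 0), (22, 3), (23, 4), (24, 3), (25, 2),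
     (25, 4), (27, 3), (28, 2), (28, 4), (30, 2), (30, 4), (31, 4), (33, 2), (33, 4), (34, 3),
     (34, 4), (36, 1), (36, 4), (38, 3), (39, 1), (39, 3), (39, 4), (43, 4), (44, 3), (45, 2),
     (46, 3), (46, 4), (49, 3), (50, 2), (51, 1), (52, 2), (54, 2), (55, 1), (56, 0), (58, 1),
     (59, 0), (61, 0)]
  entries :=
    0x3010d3f02010b3f0101043e00010c3f0000003d0000000003010c3e02010c3e0101043f0001063c0000003b0000000006010c3d05010a3d0401033b0000003a0000003f0000000003010b3c02010b3c01010b3c0001063e000000380000000006010b3b05010b3b0401033d000000370000003e0000000008010b3a0701093a000000360000003d01000b3a0000000008010a3907010a390000003404000b3901000b390000000006010a3805010a3804010a38000000330000003c0000000003010a3702010a37000000320000003b010005330000000006010a36000000310000003a0500023200000a36000000000000002e05010835040107310600013000000a3500000000060109340000002e000000390500012f00000a340000000008010933070109330000002d000000380100053700000000030109320000002c00000037050002360200042d000000000000002b00000036040107350600012c0000093100000000000000270201073008000128060001350100032a000000000301082f0000002701010a2f05000134020003290000000000000035000000340401062b000000270000092e000000000901082d00000026000000330500092d0200043200000000000000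240000003208000125060001310100032600000000000000310501092b0401062e000000240000082b00000000000000220a03062a080001230400092a0100033000000000090107290000002207000929050009290200032f000000000000002102010a2808000130000106250300022300000000000000300000002f000000210000002e01000222000000000000001f0000002d08000120040008260100032c000000000000001e020109250800012c0001062803000220000000000000002c020108240000001e0000002b0100021f000000000000001c050109230800012a0600021d03000228000000000000002a000000290000001c040008220100022700000000000000280000001b000000270001051e0200011c000000000000001905010820080001260600021a0300022500000000000000260701071f000000190400071f0100022400000000000000250000001800000024000105210200011900000000000000170201081d0101081d060002230300051a000000000000002300000016000000220500011702000121000000000301091b000000210101091b000104180000001600000000000000140900071a0800071a060002200300051d0000000000000020000000130000001f050001140200011e00000000030108180000001e010104150001041b00000013000000000000001d00000012010107170500011c0200041400000000060108160000001c04010816000000120000001b000000000301071502010715010104180001081500000011000000000000001a000000100700061405000119020004170000000006010713000000190401031100000010000000180000000003010712000000170000000f0000001601000310000000000601061105010611040103130000000e000000150000000008010610000000140000000d0000001301000312000000000301060f0000000c000000120001070f0200020d000000000801050e0701050e0000000b000000110100070e000000000601050d0000000a000000100500020b0200020f00000000000000090000000f0101060c0001060c0300010a000000000901040b000000080000000e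0500020d0200060b00000000000000070000000d0401050a060001080300010c000000000000000c0201050901010509000105090000000700000000000000050000000b080001060600010a01000508000000000000000a05010407040104070000000500000009000000000000000409000406080001080600040603000406000000000000000807010305000000040000000701000405000000000000000600000003000000050500030402000304000000000801030300000004000000020400020301000203000000000601020205010202000000030000000100000102000000000301010102010101010101010000000200000000000000000000000000000000000000000000000000000001

/-- The cosets of `⟨b, c, d, e⟩` in `[3, 3, 4, 3]_{(3, 0, 0, 0)}`. -/
def tableVertex : CosetTable where
  rels :=
    [wordPow 3 [0,1], wordPow 2 [0,2], wordPow 2 [0,3], wordPow 2 [0,4], wordPow 3 [1,2],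
     wordPow 2 [1,3], wordPow 2 [1,4], wordPow 4 [2,3], wordPow 2 [2,4], wordPow 3 [3,4],
     wordPow 3 [0,1,2,3,2,1,4,3,2,3,4,1,2,3,2,1], wordPow 3 [1,2,3,2,1,4,3,2,3,4,1,2,3,2,1,0]]
  gens := [0, 1, 2, 3, 4]
  subgens := [1, 2, 3, 4]
  tree :=
    [(0, 0), (1, 1), (2, 2), (3, 3), (4, 2), (4, 4), (5, 1), (5, 4), (7, 0), (7, 4), (8, 3),
     (9, 4), (10, 3), (11, 2), (12, 3), (13, 2), (14, 1), (15, 2), (16, 1), (16, 3), (17, 0),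
     (18, 1), (18, 3), (19, 0), (19, 3), (20, 4), (22, 0), (22, 3), (23, 4), (24, 3), (25, 2),
     (25, 4), (27, 3), (28, 2), (28, 4), (30, 2), (30, 4), (31, 4), (33, 2), (33, 4), (34, 3),
     (34, 4), (36, 1), (36, 4), (38, 3), (39, 1), (39, 3), (39, 4), (41, 4), (42, 3), (43, 4),
     (44, 3), (45, 2), (46, 3), (46, 4), (47, 4), (48, 3), (49, 3), (50, 2), (51, 3), (52, 2),
     (53, 1), (54, 2), (54, 4), (55, 3), (56, 3), (57, 2), (58, 2), (59, 1), (63, 4), (64, 3),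
     (66, 2), (68, 1), (68, 3), (70, 3), (72, 3), (73, 3), (77, 2), (78, 3), (79, 4)]
  entries :=
    0x4f09000e5008000e5006000c5003000b5000000000000000500000004e07000d4f05000b4f02000a4f0000000008010d4e0000004f0000004d04000a4e0100094e0000000006010c4d000000490000004e0500014a0200084d0000000003010c4c000000480a08084c0001094c0200074a0000000009010b4b0000004607000a4b05000b4b02000c4b0000000009010b4a000000440101094a0500014d0200074c00000000060103450000004d04010c49000000440300074900000000080102430000004c000000420001084801000644000000000901014100000040040109470500034200000c47000000000000003f0000004b0800014004000a460a000b46000000000601034905010b4504010b450000003b0a000645000000000801023b0000004a0000003a0000004901000648000000000801024802010b4300000039000107430100053b00000000090101390000003800000048050003470200053a000000000901014700000037040108410500023900000b41000000000000003600000047080001460600023800000b40000000000000004607010a3f0000003604000b3f01000b3f0000000006010a3e05010a3e04010a3e000000350a00033e0000000003010a3d02010a3d000000340001063d010005350000000006010a3c000000330401073c0500023400000a3c000000000801024407010a3b0000003200000045010005430000000009010132000000310000004405000b3a02000542000000000901014200000030000000430500024102000432000000000000002f00000042070009380600024003000431000000000000002e00000041040107330600013000000a3700000000000000400000002e0000003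f0500012f00000a360000000008010935070109350000002d0000003e0100053d00000000030109340000002c0000003d0500023c0200042d000000000000002b0000003c040107370600012c00000933000000000901013a0000002a0000003b05000a320200043900000000000000290000003a01010a3106000a310300043800000000000000270000003908000128060001370100032a00000000000000380000002701010a2f05000136020003290000000000000037000000360401062b000000270000092e000000000901082d00000026000000350500092d0200043400000000000000240000003408000125060001330100032600000000000000330501092b0401062e000000240000082b000000000000002200000032080001230400092a0100033000000000000000310000002207000929050009290200032f000000000000002102010a2808000130000106250300022300000000000000300000002f000000210000002e01000222000000000000001f0000002d08000120040008260100032c000000000000001e020109250800012c0001062803000220000000000000002c020108240000001e0000002b0100021f000000000000001c050109230800012a0600021d03000228000000000000002a000000290000001c040008220100022700000000000000280000001b000000270001051e0200011c000000000000001905010820080001260600021a0300022500000000000000260701071f000000190400071f0100022400000000000000250000001800000024000105210200011900000000000000170201081d0101081d060002230300051a000000000000002300000016000000220500011702000121000000000301091b000000210101091b000104180000001600000000000000140900071a0800071a060002200300051d0000000000000020000000130000001f050001140200011e00000000030108180000001e010104150001041b00000013000000000000001d00000012010107170500011c0200041400000000060108160000001c04010816000000120000001b0000000003010715020107150101041800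01081500000011000000000000001a000000100700061405000119020004170000000006010713000000190401031100000010000000180000000003010712000000170000000f0000001601000310000000000601061105010611040103130000000e000000150000000008010610000000140000000d0000001301000312000000000301060f0000000c000000120001070f0200020d000000000801050e0701050e0000000b000000110100070e000000000601050d0000000a000000100500020b0200020f00000000000000090000000f0101060c0001060c0300010a000000000901040b000000080000000e0500020d0200060b00000000000000070000000d0401050a060001080300010c000000000000000c0201050901010509000105090000000700000000000000050000000b080001060600010a01000508000000000000000a05010407040104070000000500000009000000000000000409000406080001080600040603000406000000000000000807010305000000040000000701000405000000000000000600000003000000050500030402000304000000000801030300000004000000020400020301000203000000000601020205010202000000030000000100000102000000000301010102010101010101010000000200000000000000000000000000000000000000000000000000000001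

theorem tableA1_check : tableA1.check = true := by decide +kernel

theorem tableA2_check : tableA2.check = true := by decide +kernel

theorem tableA3_check : tableA3.check = true := by decide +kernel

theorem tableB3overB2_check : tableB3overB2.check = true := by decide +kernel

theorem tableB3overA2_check : tableB3overA2.check = true := by decide +kernel

theorem tableF4_check : tableF4.check = true := by decide +kernel

theorem tableFacet_check : tableFacet.check = true := by decide +kernel

theorem tableVertex_check : tableVertex.check = true := by decide +kernel

end Tables

/-! ### Upper bounds for the orders of the presented groups -/

section Presented

/-- The subgroup generated by the letters `v g` with `g` in the list `l`. -/
def lettersSubgroup {G : Type*} [Group G] (v : ℕ → G) (l : List ℕ) : Subgroup G :=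
  Subgroup.closure (v '' {g | g ∈ l})

section

variable {G : Type*} [Group G] {v : ℕ → G}

theorem lettersSubgroup_le {l : List ℕ} {H : Subgroup G} :
    lettersSubgroup v l ≤ H ↔ ∀ g ∈ l, v g ∈ H := by
  simp [lettersSubgroup, Subgroup.closure_le, Set.subset_def]

theorem mem_lettersSubgroup {l : List ℕ} {g : ℕ} (h : g ∈ l) : v g ∈ lettersSubgroup v l :=
  Subgroup.subset_closure (Set.mem_image_of_mem v h)

theorem lettersSubgroup_mono {l l' : List ℕ} (h : l ⊆ l') :
    lettersSubgroup v l ≤ lettersSubgroup v l' :=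
  lettersSubgroup_le.2 fun _ hg => mem_lettersSubgroup (h hg)

/-- The relations of the Coxeter group `[3,3,4,3]`. -/
def CoxeterRelations (v : ℕ → G) : Prop := ∀ i j : Fin 5, (v i * v j) ^ cox3343 i j = 1

theorem CoxeterRelations.mul_self (h : CoxeterRelations v) {g : ℕ} (hg : g < 5) :
    v g * v g = 1 := by
  have := h ⟨g, hg⟩ ⟨g, hg⟩
  rwa [cox3343.diagonal, pow_one] at this

/-- All relators of a table are Coxeter relators of `[3,3,4,3]` or members of the list `R`. -/
def CosetTable.relatorsIn (t : CosetTable) (R : List (List ℕ)) : Prop :=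
  (∀ g ∈ t.gens, g < 5) ∧ ∀ r ∈ t.rels, r ∈ R ∨ ∃ i : Fin 5, ∃ j : Fin 5,
    r = wordPow (cox3343 i j) [(i : ℕ), (j : ℕ)]

instance (t : CosetTable) (R : List (List ℕ)) : Decidable (t.relatorsIn R) :=
  inferInstanceAs (Decidable (_ ∧ _))

/-- One link of a chain of subgroups: an order is the index from the table times the order of the
smaller group. -/
theorem card_lettersSubgroup_le {t : CosetTable} (hc : t.check = true) {R : List (List ℕ)}
    (ht : t.relatorsIn R) (hv : CoxeterRelations v) (hR : ∀ r ∈ R, (r.map v).prod = 1)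
    (hsub : t.subgens ⊆ t.gens) {m : ℕ} (hm : Nat.card (lettersSubgroup v t.subgens) ≠ 0 ∧
      Nat.card (lettersSubgroup v t.subgens) ≤ m) :
    Nat.card (lettersSubgroup v t.gens) ≠ 0 ∧
      Nat.card (lettersSubgroup v t.gens) ≤ t.size * m := by
  have h1 := t.relIndex_le hc (v := v) (H := lettersSubgroup v t.subgens)
    (K := lettersSubgroup v t.gens) (fun g hg => hv.mul_self (ht.1 g hg)) (by
      intro r hr
      rcases ht.2 r hr with h | ⟨i, j, rfl⟩
      · exact hR r h
      · rw [prod_wordPow]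
        simpa using hv i j) (fun g hg => mem_lettersSubgroup hg) le_rfl
  have h2 := Subgroup.relIndex_mul_relIndex ⊥ (lettersSubgroup v t.subgens)
    (lettersSubgroup v t.gens) bot_le (lettersSubgroup_mono hsub)
  rw [Subgroup.relIndex_bot_left, Subgroup.relIndex_bot_left] at h2
  rw [← h2, mul_comm]
  exact ⟨mul_ne_zero h1.1 hm.1, Nat.mul_le_mul h1.2 hm.2⟩

/-- The chain has indices `2`, `3`, `8`, `24`, with product `1152`, the order of the Weyl group of
type `F₄`. -/
theorem card_lettersSubgroup_F4_le (hv : CoxeterRelations v) :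
    Nat.card (lettersSubgroup v [1, 2, 3, 4]) ≠ 0 ∧
      Nat.card (lettersSubgroup v [1, 2, 3, 4]) ≤ 1152 := by
  have h0 : Nat.card (lettersSubgroup v []) ≠ 0 ∧ Nat.card (lettersSubgroup v []) ≤ 1 := by
    have : lettersSubgroup v [] = ⊥ := by simp [lettersSubgroup]
    rw [this]
    simp
  have h1 := card_lettersSubgroup_le (R := []) tableA1_check (by decide +kernel) hv (by simp)
    (by decide) h0
  have h2 := card_lettersSubgroup_le (R := []) tableA2_check (by decide +kernel) hv (by simp)
    (by decide) h1
  have h3 := card_lettersSubgroup_le (R := []) tableB3overA2_check (by decide +kernel) hv (by simp)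
    (by decide) h2
  exact card_lettersSubgroup_le (R := []) tableF4_check (by decide +kernel) hv (by simp)
    (by decide) h3

theorem sigma_eq {b c d : G} (hb : b * b = 1) (hc : c * c = 1) :
    sigma b c d = b * c * d * c * b := by
  rw [sigma, conjBy, mul_inv_rev, inv_eq_of_mul_eq_one_left hb, inv_eq_of_mul_eq_one_left hc]
  group

theorem tau_eq {c d e : G} (hd : d * d = 1) (he : e * e = 1) :
    tau c d e = e * d * c * d * e := by
  rw [tau, conjBy, mul_inv_rev, inv_eq_of_mul_eq_one_left hd, inv_eq_of_mul_eq_one_left he]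
  group

theorem map_sigma {H : Type*} [Group H] (f : G →* H) (b c d : G) :
    f (sigma b c d) = sigma (f b) (f c) (f d) := by
  simp [sigma, conjBy]

theorem map_tau {H : Type*} [Group H] (f : G →* H) (c d e : G) :
    f (tau c d e) = tau (f c) (f d) (f e) := by
  simp [tau, conjBy]

theorem prod_map_reverse {w : List ℕ} (hw : ∀ g ∈ w, v g * v g = 1) :
    (w.reverse.map v).prod = ((w.map v).prod)⁻¹ := by
  induction w with
  | nil => simp
  | cons g w ih =>
    rw [List.reverse_cons, List.map_append, List.prod_append,
      ih fun g hg => hw g (List.mem_cons_of_mem _ hg)]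
    simp [← eq_inv_of_mul_eq_one_left (hw g List.mem_cons_self)]

end

/-- The word `a σ τ`. -/
def wordST : List ℕ := [0, 1, 2, 3, 2, 1, 4, 3, 2, 3, 4]

/-- The word `a σ τ σ`. -/
def wordSTS : List ℕ := [0, 1, 2, 3, 2, 1, 4, 3, 2, 3, 4, 1, 2, 3, 2, 1]

theorem prod_wordST {G : Type*} [Group G] {v : ℕ → G} (hv : ∀ g < 5, v g * v g = 1) :
    (wordST.map v).prod = v 0 * sigma (v 1) (v 2) (v 3) * tau (v 2) (v 3) (v 4) := by
  rw [sigma_eq (hv 1 (by norm_num)) (hv 2 (by norm_num)),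
    tau_eq (hv 3 (by norm_num)) (hv 4 (by norm_num))]
  simp [wordST, mul_assoc]

theorem prod_wordSTS {G : Type*} [Group G] {v : ℕ → G} (hv : ∀ g < 5, v g * v g = 1) :
    (wordSTS.map v).prod = v 0 * sigma (v 1) (v 2) (v 3) * tau (v 2) (v 3) (v 4) *
      sigma (v 1) (v 2) (v 3) := by
  rw [sigma_eq (hv 1 (by norm_num)) (hv 2 (by norm_num)),
    tau_eq (hv 3 (by norm_num)) (hv 4 (by norm_num))]
  simp [wordSTS, mul_assoc]

/-- The letters of a tuple of group elements. -/
def lettersOf {G : Type*} [Group G] {n : ℕ} (u : Fin n → G) (g : ℕ) : G :=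
  if h : g < n then u ⟨g, h⟩ else 1

theorem lettersOf_val {G : Type*} [Group G] {n : ℕ} (u : Fin n → G) (i : Fin n) :
    lettersOf u i = u i := by
  simp [lettersOf]

theorem lettersSubgroup_lettersOf {G : Type*} [Group G] (u : Fin 5 → G) :
    lettersSubgroup (lettersOf u) [0, 1, 2, 3, 4] = Subgroup.closure (Set.range u) := by
  refine le_antisymm (lettersSubgroup_le.2 fun g hg => ?_) ?_
  · have h : g < 5 := by
      simp only [List.mem_cons, List.not_mem_nil, or_false] at hg
      omega
    simp only [lettersOf, dif_pos h]
    exact Subgroup.subset_closure (Set.mem_range_self _)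
  · rw [Subgroup.closure_le]
    rintro _ ⟨i, rfl⟩
    rw [← lettersOf_val u i]
    refine mem_lettersSubgroup ?_
    revert i
    decide

section

variable {R : Set (FreeGroup (Fin 5))}

theorem coxeterRelations_of (hR : cox3343.relationsSet ⊆ R) :
    CoxeterRelations (lettersOf fun i : Fin 5 => (PresentedGroup.of i : PresentedGroup R)) := by
  intro i j
  rw [lettersOf_val, lettersOf_val]
  have := PresentedGroup.one_of_mem (rels := R) (hR ⟨(i, j), rfl⟩)
  simpa [CoxeterMatrix.relation, Function.uncurry, PresentedGroup.of] using this

/-- The cosets are those of the subgroup of type `F₄`. The reversed relator holds because reversing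
a word in involutions inverts it. -/
theorem card_presentedGroup_le {t : CosetTable} (hc : t.check = true)
    (hR : cox3343.relationsSet ⊆ R) {w : List ℕ} {k : ℕ} (ht : t.relatorsIn
      [wordPow k w, (wordPow k w).reverse]) (hw : ∀ g ∈ wordPow k w, g < 5)
    (hwR : ((w.map (lettersOf fun i : Fin 5 => (PresentedGroup.of i : PresentedGroup R))).prod) ^ k
      = 1) (hg : t.gens = [0, 1, 2, 3, 4]) (hs : t.subgens = [1, 2, 3, 4]) :
    Nat.card (PresentedGroup R) ≠ 0 ∧ Nat.card (PresentedGroup R) ≤ t.size * 1152 := by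
  have hv := coxeterRelations_of hR
  have h1 := card_lettersSubgroup_F4_le hv
  rw [← hs] at h1
  have h2 := card_lettersSubgroup_le hc ht hv (by
    intro r hr
    simp only [List.mem_cons, List.not_mem_nil, or_false] at hr
    rcases hr with rfl | rfl
    · rw [prod_wordPow, hwR]
    · rw [prod_map_reverse fun g hg => hv.mul_self (hw g hg), prod_wordPow, hwR, inv_one])
    (by rw [hg, hs]; decide) h1
  rw [hg, lettersSubgroup_lettersOf, PresentedGroup.closure_range_of, Subgroup.card_top] at h2
  exact h2

end

theorem card_group3343ss00_le : Nat.card (Group3343ss00 2) ≠ 0 ∧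
    Nat.card (Group3343ss00 2) ≤ 73728 := by
  refine card_presentedGroup_le tableFacet_check Set.subset_union_left (w := wordST) (k := 4)
    (by decide +kernel) (by decide +kernel) ?_ rfl rfl
  rw [prod_wordST fun g hg => (coxeterRelations_of Set.subset_union_left).mul_self hg]
  have := PresentedGroup.one_of_mem (rels := cox3343.relationsSet ∪ {relss00 2}) (Or.inr rfl)
  rw [relss00, map_pow, map_mul, map_mul, map_sigma, map_tau] at this
  exact this

theorem card_group3343s000_le : Nat.card (Group3343s000 3) ≠ 0 ∧
    Nat.card (Group3343s000 3) ≤ 93312 := by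
  refine card_presentedGroup_le tableVertex_check Set.subset_union_left (w := wordSTS) (k := 3)
    (by decide +kernel) (by decide +kernel) ?_ rfl rfl
  rw [prod_wordSTS fun g hg => (coxeterRelations_of Set.subset_union_left).mul_self hg]
  have := PresentedGroup.one_of_mem (rels := cox3343.relationsSet ∪ {rels000 3}) (Or.inr rfl)
  rw [rels000, map_pow, map_mul, map_mul, map_mul, map_sigma, map_tau] at this
  exact this

end Presented

/-! ### The relations of `Θ` for the matrices -/

section Generators

theorem hat_eq (k : Fin 6) : hat k = ofRows 24 24 (genRows k) := by
  have h : ∀ (k : Fin 6) (p : Fin 24 × Fin 24),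
      hat k p.1 p.2 = ofRows 24 24 (genRows k) p.1 p.2 := by decide +kernel
  ext i j
  exact h k (i, j)

theorem length_genRows (i : ℕ) : (genRows i).length = 24 := by
  unfold genRows
  split <;> rfl

/-- The image of a vector under a word in the generators. -/
def actWord : List ℕ → ℕ → ℕ
  | [], x => x
  | i :: w, x => forced (act (genRows i) x) (actWord w)

/-- The matrix of a word. -/
def wordMatrix (w : List ℕ) : Matrix (Fin 24) (Fin 24) (ZMod 2) :=
  (w.map fun i => ofRows 24 24 (genRows i)).prod

theorem vecMul_wordMatrix (w : List ℕ) (x : ℕ) :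
    vec 24 x ᵥ* wordMatrix w = vec 24 (actWord w x) := by
  induction w generalizing x with
  | nil => simp [wordMatrix, actWord]
  | cons i w ih =>
    rw [actWord, forced_eq, ← ih, ← vecMul_ofRows' 24 (length_genRows i), Matrix.vecMul_vecMul]
    simp [wordMatrix]

theorem matrix_ext_vec {m n : ℕ} {A B : Matrix (Fin m) (Fin n) (ZMod 2)}
    (h : ∀ i < m, vec m (2 ^ i) ᵥ* A = vec m (2 ^ i) ᵥ* B) : A = B := by
  ext i j
  have := congrFun (h i i.2) j
  rw [vec_two_pow i.2] at this
  simpa using this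

/-- The word is trivial. -/
def wordIsOne (w : List ℕ) : Bool :=
  (List.range 24).all fun i => Nat.beq (actWord w (2 ^ i)) (2 ^ i)

/-- The word is seen to be non-trivial. -/
def wordNeOne (w : List ℕ) : Bool := (List.range 24).any fun i =>
  !Nat.beq (actWord w (2 ^ i)) (2 ^ i) && Nat.blt (actWord w (2 ^ i)) (2 ^ 24)

theorem wordMatrix_eq_one {w : List ℕ} (h : wordIsOne w = true) : wordMatrix w = 1 := by
  refine matrix_ext_vec fun i hi => ?_
  have := List.all_eq_true.1 h i (List.mem_range.2 hi)
  rw [vecMul_wordMatrix, Nat.eq_of_beq_eq_true this, Matrix.vecMul_one]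

theorem wordMatrix_ne_one {w : List ℕ} (h : wordNeOne w = true) : wordMatrix w ≠ 1 := by
  intro hw
  obtain ⟨i, hi, h⟩ := List.any_eq_true.1 h
  simp only [Bool.and_eq_true, Bool.not_eq_true', Nat.blt_eq] at h
  have h1 := vecMul_wordMatrix w (2 ^ i)
  rw [hw, Matrix.vecMul_one] at h1
  have := vec_injOn (Nat.pow_lt_pow_right (by norm_num) (List.mem_range.1 hi)) h.2 h1
  exact Nat.ne_of_beq_eq_false h.1 this.symm

theorem genRows_mul_self (i : ℕ) :
    ofRows 24 24 (genRows i) * ofRows 24 24 (genRows i) = 1 := by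
  have h : wordMatrix [i, i] = 1 := by
    refine wordMatrix_eq_one ?_
    rcases lt_or_ge i 5 with h | h
    · revert i
      decide +kernel
    -- All indices from `5` on name the last matrix, so involutivity holds for letters without a
    -- bound.
    · have : genRows i = genRows 5 := by
        unfold genRows
        split <;> first | rfl | omega
      simp only [wordIsOne, actWord, this]
      decide +kernel
  simpa [wordMatrix] using h

/-- The generating matrices as elements of the general linear group. -/
def gen (i : ℕ) : GL (Fin 24) (ZMod 2) where
  val := ofRows 24 24 (genRows i)
  inv := ofRows 24 24 (genRows i)
  val_inv := genRows_mul_self i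
  inv_val := genRows_mul_self i

theorem coe_gen (i : ℕ) : (gen i : Matrix (Fin 24) (Fin 24) (ZMod 2)) = ofRows 24 24 (genRows i) :=
  rfl

theorem gen_inv (i : ℕ) : (gen i)⁻¹ = gen i := rfl

theorem gen_mul_self (i : ℕ) : gen i * gen i = 1 := Units.ext (genRows_mul_self i)

attribute [irreducible] gen

theorem coe_prod_gen (w : List ℕ) :
    ((w.map gen).prod : Matrix (Fin 24) (Fin 24) (ZMod 2)) = wordMatrix w := by
  rw [← Units.coeHom_apply, map_list_prod, List.map_map, wordMatrix]
  exact congrArg List.prod (List.map_congr_left fun i _ => coe_gen i)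

theorem prod_gen_eq_one {w : List ℕ} (h : wordIsOne w = true) : (w.map gen).prod = 1 :=
  Units.ext ((coe_prod_gen w).trans (wordMatrix_eq_one h))

theorem prod_gen_ne_one {w : List ℕ} (h : wordNeOne w = true) : (w.map gen).prod ≠ 1 := by
  intro hw
  refine wordMatrix_ne_one h ?_
  rw [← coe_prod_gen, hw, Units.val_one]

/-- All orders are below `5`, so finitely many powers remain to be distinguished from `1`. -/
theorem orderOf_gen_mul_gen (i j : Fin 6) : orderOf (gen i * gen j) = cox33433 i j := by
  have h : ∀ p : Fin 6 × Fin 6, 0 < cox33433 p.1 p.2 ∧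
      wordIsOne (wordPow (cox33433 p.1 p.2) [(p.1 : ℕ), (p.2 : ℕ)]) = true ∧
      ∀ m : Fin 5, (m : ℕ) < cox33433 p.1 p.2 → 0 < (m : ℕ) →
        wordNeOne (wordPow m [(p.1 : ℕ), (p.2 : ℕ)]) = true := by decide +kernel
  have h4 : ∀ p : Fin 6 × Fin 6, cox33433 p.1 p.2 < 5 := by decide +kernel
  have hp : ∀ n, (gen i * gen j) ^ n = ((wordPow n [(i : ℕ), (j : ℕ)]).map gen).prod := by
    intro n
    rw [prod_wordPow]
    simp
  obtain ⟨h1, h2, h3⟩ := h (i, j)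
  refine (orderOf_eq_iff h1).2 ⟨?_, fun m hm hm0 => ?_⟩
  · rw [hp]
    exact prod_gen_eq_one h2
  · rw [hp]
    exact prod_gen_ne_one (h3 ⟨m, hm.trans (h4 (i, j))⟩ hm hm0)

theorem gen_pow (i j : Fin 6) : (gen i * gen j) ^ cox33433 i j = 1 := by
  rw [← orderOf_gen_mul_gen, pow_orderOf_eq_one]

theorem gen_facet_relation :
    (gen 0 * sigma (gen 1) (gen 2) (gen 3) * tau (gen 2) (gen 3) (gen 4)) ^ 4 = 1 := by
  have h : wordIsOne (wordPow 4 wordST) = true := by decide +kernel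
  have h1 := @prod_wordST (GL (Fin 24) (ZMod 2)) _ gen
  rw [← h1 fun g _ => gen_mul_self g, ← prod_wordPow, prod_gen_eq_one h]

theorem gen_vertex_relation : (gen 5 * tau (gen 2) (gen 3) (gen 4) *
    sigma (gen 1) (gen 2) (gen 3) * tau (gen 2) (gen 3) (gen 4)) ^ 3 = 1 := by
  have h1 := @sigma_eq (GL (Fin 24) (ZMod 2)) _ (gen 1) (gen 2) (gen 3)
  have h2 := @tau_eq (GL (Fin 24) (ZMod 2)) _ (gen 2) (gen 3) (gen 4)
  rw [h1 (gen_mul_self 1) (gen_mul_self 2), h2 (gen_mul_self 3) (gen_mul_self 4)]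
  have h : wordIsOne (wordPow 3 [5, 4, 3, 2, 3, 4, 1, 2, 3, 2, 1, 4, 3, 2, 3, 4]) = true := by
    decide +kernel
  have := prod_gen_eq_one h
  rw [prod_wordPow] at this
  simpa only [List.map_cons, List.map_nil, List.prod_cons, List.prod_nil, mul_one, mul_assoc]
    using this

/-- A homomorphism from `Θ` is given by a tuple that satisfies the relations. -/
def Theta.lift {G : Type*} [Group G] (u : Fin 6 → G)
    (h : ∀ i j, (u i * u j) ^ cox33433 i j = 1)
    (h1 : (u 0 * sigma (u 1) (u 2) (u 3) * tau (u 2) (u 3) (u 4)) ^ 4 = 1)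
    (h2 : (u 5 * tau (u 2) (u 3) (u 4) * sigma (u 1) (u 2) (u 3) * tau (u 2) (u 3) (u 4)) ^ 3 = 1) :
    Theta →* G :=
  PresentedGroup.toGroup (f := u) (by
    rintro r (⟨⟨i, j⟩, rfl⟩ | hr)
    · simpa [CoxeterMatrix.relation, Function.uncurry] using h i j
    · simp only [thetaExtraRels, Set.mem_insert_iff, Set.mem_singleton_iff] at hr
      rcases hr with rfl | rfl
      · simpa only [map_pow, map_mul, map_sigma, map_tau, FreeGroup.lift_apply_of] using h1
      · simpa only [map_pow, map_mul, map_sigma, map_tau, FreeGroup.lift_apply_of] using h2)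

theorem Theta.lift_gen {G : Type*} [Group G] {u : Fin 6 → G}
    (h : ∀ i j, (u i * u j) ^ cox33433 i j = 1)
    (h1 : (u 0 * sigma (u 1) (u 2) (u 3) * tau (u 2) (u 3) (u 4)) ^ 4 = 1)
    (h2 : (u 5 * tau (u 2) (u 3) (u 4) * sigma (u 1) (u 2) (u 3) * tau (u 2) (u 3) (u 4)) ^ 3 = 1)
    (i : Fin 6) : Theta.lift u h h1 h2 (Theta.gen i) = u i :=
  PresentedGroup.toGroup.of _

/-- The representation of `Θ` by matrices. -/
def Theta.rep : Theta →* GL (Fin 24) (ZMod 2) :=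
  Theta.lift (fun i : Fin 6 => Polytope33433.gen i) gen_pow gen_facet_relation gen_vertex_relation

theorem Theta.rep_gen (i : Fin 6) : Theta.rep (Theta.gen i) = Polytope33433.gen i :=
  Theta.lift_gen _ _ _ i

theorem Theta.closure_range_gen : Subgroup.closure (Set.range Theta.gen) = ⊤ :=
  PresentedGroup.closure_range_of _

theorem Theta.range_rep :
    Theta.rep.range = lettersSubgroup Polytope33433.gen [0, 1, 2, 3, 4, 5] := by
  rw [MonoidHom.range_eq_map, ← Theta.closure_range_gen, MonoidHom.map_closure, lettersSubgroup,
    ← Set.range_comp]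
  congr 1
  ext g
  constructor
  · rintro ⟨i, rfl⟩
    refine ⟨i, ?_, (Theta.rep_gen i).symm⟩
    revert i
    decide
  · rintro ⟨i, hi, rfl⟩
    have h : i < 6 := by
      simp only [Set.mem_ofPred_eq, List.mem_cons, List.not_mem_nil, or_false] at hi
      omega
    exact ⟨⟨i, h⟩, Theta.rep_gen _⟩

end Generators

/-! ### Lower bounds from orbits of row vectors -/

section RowAction

/-- The action of matrices on row vectors. -/
def rowAction : GL (Fin 24) (ZMod 2) →* Equiv.Perm (Fin 24 → ZMod 2) where
  toFun g :=
    -- Row vectors carry a right action; the inverse turns it into a left action. On the generators,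
    -- which are involutions, it makes no difference.
    { toFun := fun x => x ᵥ* ((g⁻¹ : GL (Fin 24) (ZMod 2)) : Matrix (Fin 24) (Fin 24) (ZMod 2))
      invFun := fun x => x ᵥ* (g : Matrix (Fin 24) (Fin 24) (ZMod 2))
      left_inv := fun x => by simp [Matrix.vecMul_vecMul]
      right_inv := fun x => by simp [Matrix.vecMul_vecMul] }
  map_one' := by
    ext x
    simp
  map_mul' g h := by
    ext1 x
    change x ᵥ* ((g * h)⁻¹ : GL (Fin 24) (ZMod 2)).val = (x ᵥ* h⁻¹.val) ᵥ* g⁻¹.val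
    rw [mul_inv_rev, Units.val_mul, Matrix.vecMul_vecMul]

theorem rowAction_apply (g : GL (Fin 24) (ZMod 2)) (x : Fin 24 → ZMod 2) :
    rowAction g x = x ᵥ* ((g⁻¹ : GL (Fin 24) (ZMod 2)) : Matrix (Fin 24) (Fin 24) (ZMod 2)) := rfl

theorem rowAction_gen (i x : ℕ) :
    rowAction (gen i) (vec 24 x) = vec 24 (act (genRows i) x) := by
  rw [rowAction_apply, gen_inv, coe_gen, vecMul_ofRows' 24 (length_genRows i)]

instance : Finite (GL (Fin 24) (ZMod 2)) := inferInstance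

/-- The orbit of a vector has `n` elements or more. -/
def orbitCheck (l : List ℕ) (x n : ℕ) : Bool :=
  Nat.beq ((orbitList (l.map genRows) n x).filter fun y => Nat.blt y (2 ^ 24)).length n

/-- By orbit-stabilizer it suffices to exhibit `n` distinct points of the orbit. Distinct codes
below `2 ^ 24` give distinct vectors, which is why `orbitCheck` discards larger ones. -/
theorem le_relIndex_pointStabilizer {l : List ℕ} {x n : ℕ} (h : orbitCheck l x n = true) :
    n ≤ (pointStabilizer rowAction (vec 24 x)).relIndex (lettersSubgroup gen l) := by
  rw [pointStabilizer_relIndex]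
  obtain ⟨h1, h2⟩ := orbitList_spec (Ms := l.map genRows) (x := x)
    (R := fun y => ∃ g ∈ lettersSubgroup gen l, rowAction g (vec 24 x) = vec 24 y)
    ⟨1, one_mem _, by simp⟩ (by
      rintro M hM y ⟨g, hg, hy⟩
      obtain ⟨i, hi, rfl⟩ := List.mem_map.1 hM
      refine ⟨gen i * g, mul_mem (mem_lettersSubgroup hi) hg, ?_⟩
      rw [map_mul, Equiv.Perm.mul_apply, hy, rowAction_gen]) n
  set o := orbitList (l.map genRows) n x
  have hlen := Nat.eq_of_beq_eq_true h
  have hinj : Set.InjOn (vec 24) {y | y ∈ o.filter fun y => Nat.blt y (2 ^ 24)} := by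
    intro y hy z hz hyz
    simp only [Set.mem_ofPred_eq, List.mem_filter, Nat.blt_eq] at hy hz
    exact vec_injOn hy.2 hz.2 hyz
  calc n = {y | y ∈ o.filter fun y => Nat.blt y (2 ^ 24)}.ncard := by
        have : {y | y ∈ o.filter fun y => Nat.blt y (2 ^ 24)} =
            ((o.filter fun y => Nat.blt y (2 ^ 24)).toFinset : Set ℕ) := by
          ext y
          simp
        rw [this, Set.ncard_coe_finset, List.toFinset_card_of_nodup (h1.filter _), hlen]
    _ = (vec 24 '' {y | y ∈ o.filter fun y => Nat.blt y (2 ^ 24)}).ncard :=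
        hinj.ncard_image.symm
    _ ≤ _ := by
        refine Set.ncard_le_ncard ?_ (Set.toFinite _)
        rintro _ ⟨y, hy, rfl⟩
        exact h2 y (List.mem_filter.1 hy).1

/-- The vector is fixed by the generators in the list. -/
def fixedCheck (l : List ℕ) (x : ℕ) : Bool := l.all fun i => Nat.beq (act (genRows i) x) x

theorem lettersSubgroup_le_pointStabilizer {l : List ℕ} {x : ℕ} (h : fixedCheck l x = true) :
    lettersSubgroup gen l ≤ pointStabilizer rowAction (vec 24 x) := by
  refine lettersSubgroup_le.2 fun i hi => ?_
  rw [mem_pointStabilizer, rowAction_gen, Nat.eq_of_beq_eq_true (List.all_eq_true.1 h i hi)]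

/-- Orbit length times a lower bound for the stabilizer, which contains the subgroup generated by
the letters fixing `x`. -/
theorem mul_le_card_lettersSubgroup {l l' : List ℕ} {x n m : ℕ} (hn : orbitCheck l x n = true)
    (hf : fixedCheck l' x = true) (hs : l' ⊆ l) (hm : m ≤ Nat.card (lettersSubgroup gen l')) :
    n * m ≤ Nat.card (lettersSubgroup gen l) := by
  have h1 := le_relIndex_pointStabilizer hn
  set S := pointStabilizer rowAction (vec 24 x)
  have h2 := Subgroup.relIndex_mul_relIndex ⊥ (S ⊓ lettersSubgroup gen l) (lettersSubgroup gen l)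
    bot_le inf_le_right
  rw [Subgroup.relIndex_bot_left, Subgroup.relIndex_bot_left, Subgroup.inf_relIndex_right] at h2
  rw [← h2, mul_comm]
  refine Nat.mul_le_mul (hm.trans ?_) h1
  exact Nat.card_mono (Set.toFinite _) (SetLike.coe_subset_coe.2
    (le_inf (lettersSubgroup_le_pointStabilizer hf) (lettersSubgroup_mono hs)))

theorem one_le_card_lettersSubgroup_nil : 1 ≤ Nat.card (lettersSubgroup gen []) := Nat.card_pos

/-- At each step the vector is fixed by the group already treated, and the orbit lengths multiply to
`2 · 3 · 4 · 16 · 192 = 73728`. -/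
theorem le_card_facetGroup : 73728 ≤ Nat.card (lettersSubgroup gen [0, 1, 2, 3, 4]) := by
  have h1 := mul_le_card_lettersSubgroup (l := [0]) (x := 2) (n := 2) (by decide +kernel) rfl
    (by decide) one_le_card_lettersSubgroup_nil
  have h2 := mul_le_card_lettersSubgroup (l := [0, 1]) (x := 12) (n := 3) (by decide +kernel)
    (by decide +kernel) (by decide) h1
  have h3 := mul_le_card_lettersSubgroup (l := [0, 1, 2]) (x := 48) (n := 4) (by decide +kernel)
    (by decide +kernel) (by decide) h2
  have h4 := mul_le_card_lettersSubgroup (l := [0, 1, 2, 3]) (x := 256) (n := 16)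
    (by decide +kernel) (by decide +kernel) (by decide) h3
  exact mul_le_card_lettersSubgroup (l := [0, 1, 2, 3, 4]) (x := 1) (n := 192)
    (by decide +kernel) (by decide +kernel) (by decide) h4

/-- Here `2 · 3 · 8 · 24 · 81 = 93312`. The last vector, `16777215 = 2 ^ 24 - 1`, has all
coordinates `1` and is therefore fixed by the permutation matrices `b̂, ĉ, d̂, ê`. -/
theorem le_card_vertexGroup : 93312 ≤ Nat.card (lettersSubgroup gen [1, 2, 3, 4, 5]) := by
  have h1 := mul_le_card_lettersSubgroup (l := [1]) (x := 4) (n := 2) (by decide +kernel) rfl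
    (by decide) one_le_card_lettersSubgroup_nil
  have h2 := mul_le_card_lettersSubgroup (l := [1, 2]) (x := 16) (n := 3) (by decide +kernel)
    (by decide +kernel) (by decide) h1
  have h3 := mul_le_card_lettersSubgroup (l := [1, 2, 3]) (x := 88) (n := 8) (by decide +kernel)
    (by decide +kernel) (by decide) h2
  have h4 := mul_le_card_lettersSubgroup (l := [1, 2, 3, 4]) (x := 1) (n := 24)
    (by decide +kernel) (by decide +kernel) (by decide) h3
  exact mul_le_card_lettersSubgroup (l := [1, 2, 3, 4, 5]) (x := 16777215) (n := 81)
    (by decide +kernel) (by decide +kernel) (by decide) h4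

/-- From `C ≤ S ⊓ A ≤ A` and `[A : C] ≤ n ≤ [A : S ⊓ A]` it follows that `C = S ⊓ A`, and `B ≤ S`.
-/
theorem inf_le_of_relIndex_le {G : Type*} [Group G] {A B C S : Subgroup G} {n : ℕ} (hn : 0 < n)
    (hCS : C ≤ S) (hCA : C ≤ A) (hB : B ≤ S) (hS : n ≤ S.relIndex A)
    (hC : C.relIndex A ≠ 0 ∧ C.relIndex A ≤ n) : A ⊓ B ≤ C := by
  have h3 := Subgroup.relIndex_mul_relIndex C (S ⊓ A) A (le_inf hCS hCA) inf_le_right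
  rw [Subgroup.inf_relIndex_right] at h3
  have h4 : C.relIndex (S ⊓ A) = 1 := by
    have h5 : C.relIndex (S ⊓ A) ≠ 0 := fun h => hC.1 (by rw [← h3, h, zero_mul])
    by_contra h6
    have h7 : 2 ≤ C.relIndex (S ⊓ A) := by omega
    have := Nat.mul_le_mul h7 hS
    omega
  exact (le_inf (inf_le_right.trans hB) inf_le_left).trans (Subgroup.relIndex_eq_one.1 h4)

theorem CosetTable.relIndex_gen_le (t : CosetTable) (hc : t.check = true) (f : ℕ → ℕ)
    (hrel : ∀ r ∈ t.rels, wordIsOne (r.map f) = true) :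
    (lettersSubgroup gen (t.subgens.map f)).relIndex (lettersSubgroup gen (t.gens.map f)) ≠ 0 ∧
    (lettersSubgroup gen (t.subgens.map f)).relIndex (lettersSubgroup gen (t.gens.map f)) ≤
      t.size := by
  have h := @CosetTable.relIndex_le t hc (GL (Fin 24) (ZMod 2)) _ fun g => gen (f g)
  refine h (fun g _ => gen_mul_self (f g)) ?_ ?_ ?_
  · intro r hr
    have := prod_gen_eq_one (hrel r hr)
    rwa [List.map_map] at this
  · exact fun g hg => mem_lettersSubgroup (List.mem_map_of_mem hg)
  · refine lettersSubgroup_le.2 fun g hg => ?_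
    obtain ⟨i, hi, rfl⟩ := List.mem_map.1 hg
    exact Subgroup.subset_closure ⟨i, hi, rfl⟩

/-- If a vector that is fixed by one subgroup has an orbit under another subgroup that is as large
as the index of a common subgroup, then the latter is the intersection of the two groups. -/
theorem inf_le_of_orbit (t : CosetTable) (hc : t.check = true) (f : ℕ → ℕ) {l : List ℕ} {x : ℕ}
    (hrel : ∀ r ∈ t.rels, wordIsOne (r.map f) = true)
    (ho : orbitCheck (t.gens.map f) x t.size = true)
    (hf : fixedCheck l x = true) (hs : t.subgens ⊆ t.gens) (hl : t.subgens.map f ⊆ l) :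
    lettersSubgroup gen (t.gens.map f) ⊓ lettersSubgroup gen l ≤
      lettersSubgroup gen (t.subgens.map f) :=
  inf_le_of_relIndex_le (Nat.succ_pos _)
    ((lettersSubgroup_mono hl).trans (lettersSubgroup_le_pointStabilizer hf))
    (lettersSubgroup_mono (List.map_subset f hs)) (lettersSubgroup_le_pointStabilizer hf)
    (le_relIndex_pointStabilizer ho) (t.relIndex_gen_le hc f hrel)

end RowAction

/-! ### The matrices generate the group of the polytope `Γ₁` -/

section GammaOne

theorem parabolic_gen {I : Set (Fin 6)} {l : List ℕ} (h : ∀ i : Fin 6, i ∈ I ↔ (i : ℕ) ∈ l)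
    (hl : ∀ i ∈ l, i < 6) :
    parabolic (fun i : Fin 6 => gen i) I = lettersSubgroup gen l := by
  refine le_antisymm (parabolic_le.2 fun i hi => mem_lettersSubgroup ((h i).1 hi)) ?_
  refine lettersSubgroup_le.2 fun i hi => ?_
  exact mem_parabolic (u := fun i : Fin 6 => gen i) (i := ⟨i, hl i hi⟩) ((h _).2 hi)

/-- The list consists of the indices in the interval `[a, b)`. -/
def isIntervalList (a b : ℕ) (l : List ℕ) : Prop :=
  (∀ i : Fin 6, (a ≤ i ∧ (i : ℕ) < b) ↔ (i : ℕ) ∈ l) ∧ ∀ i ∈ l, i < 6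

instance (a b : ℕ) (l : List ℕ) : Decidable (isIntervalList a b l) :=
  inferInstanceAs (Decidable (_ ∧ _))

theorem parabolic_interval {a b : ℕ} {l : List ℕ} (h : isIntervalList a b l) :
    parabolic (fun i : Fin 6 => gen i) (interval 6 a b) = lettersSubgroup gen l :=
  parabolic_gen h.1 h.2

/-- The hypotheses of `inf_le_of_orbit` for the table `t`, whose letters are renamed by means of the
list `f`, and for the subgroup generated by the letters in the list `R`. -/
def intervalCheck (t : CosetTable) (f R : List ℕ) (x : ℕ) : Prop :=
  (∀ r ∈ t.rels, wordIsOne (r.map fun g => f.getD g 0) = true) ∧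
    orbitCheck (t.gens.map fun g => f.getD g 0) x t.size = true ∧ fixedCheck R x = true ∧
    t.subgens ⊆ t.gens ∧ (t.subgens.map fun g => f.getD g 0) ⊆ R

instance (t : CosetTable) (f R : List ℕ) (x : ℕ) : Decidable (intervalCheck t f R x) :=
  inferInstanceAs (Decidable (_ ∧ _))

theorem parabolic_interval_inf {a b : ℕ} (t : CosetTable) (hc : t.check = true) (f R : List ℕ)
    (x : ℕ) (h : intervalCheck t f R x) (h' : isIntervalList a b (t.gens.map fun g => f.getD g 0) ∧
      isIntervalList (a + 1) (b + 1) R ∧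
      isIntervalList (a + 1) b (t.subgens.map fun g => f.getD g 0)) :
    parabolic (fun i : Fin 6 => gen i) (interval 6 a b) ⊓
      parabolic (fun i : Fin 6 => gen i) (interval 6 (a + 1) (b + 1)) ≤
      parabolic (fun i : Fin 6 => gen i) (interval 6 (a + 1) b) := by
  rw [parabolic_interval h'.1, parabolic_interval h'.2.1, parabolic_interval h'.2.2]
  exact inf_le_of_orbit t hc _ h.1 h.2.1 h.2.2.1 h.2.2.2.1 h.2.2.2.2

/-- The mirror image of `parabolic_interval_inf`: the vector is fixed by the lower interval and
moved by the upper one. -/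
theorem parabolic_interval_inf' {a b : ℕ} (t : CosetTable) (hc : t.check = true) (f R : List ℕ)
    (x : ℕ) (h : intervalCheck t f R x)
    (h' : isIntervalList (a + 1) (b + 1) (t.gens.map fun g => f.getD g 0) ∧
      isIntervalList a b R ∧ isIntervalList (a + 1) b (t.subgens.map fun g => f.getD g 0)) :
    parabolic (fun i : Fin 6 => gen i) (interval 6 a b) ⊓
      parabolic (fun i : Fin 6 => gen i) (interval 6 (a + 1) (b + 1)) ≤
      parabolic (fun i : Fin 6 => gen i) (interval 6 (a + 1) b) := by
  rw [parabolic_interval h'.1, parabolic_interval h'.2.1, parabolic_interval h'.2.2, inf_comm]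
  exact inf_le_of_orbit t hc _ h.1 h.2.1 h.2.2.1 h.2.2.2.1 h.2.2.2.2

theorem commute_gen (i j : Fin 6) (h : (i : ℕ) + 1 < j) : Commute (gen i) (gen j) := by
  have h2 : ∀ p : Fin 6 × Fin 6, (p.1 : ℕ) + 1 < p.2 → cox33433 p.1 p.2 = 2 := by decide +kernel
  have h1 := gen_pow i j
  rw [h2 (i, j) h, pow_two] at h1
  have h3 := eq_inv_of_mul_eq_one_left h1
  rw [mul_inv_rev, gen_inv, gen_inv] at h3
  exact h3

/-- Each case needs a vector that is fixed by one of the two interval groups and whose orbit under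
the other is as long as the index of the common subgroup. The lists rename the letters of a table,
in reverse order where the diagram has to be read from the other end. -/
theorem intersectionProperty_gen : IntersectionProperty fun i : Fin 6 => gen i := by
  refine intersectionProperty_of_interval commute_gen fun a b hab hb => ?_
  have hb0 : 0 < b := by omega
  interval_cases b
  · interval_cases a
    refine parabolic_interval_inf tableA1 tableA1_check [0, 0] [1] 2 ?_ ?_ <;>
        decide +kernel
  · interval_cases a
    · refine parabolic_interval_inf tableA2 tableA2_check [0, 1, 0] [1, 2] 2 ?_ ?_ <;>
        decide +kernel
    · refine parabolic_interval_inf tableA1 tableA1_check [0, 1] [2] 24 ?_ ?_ <;>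
        decide +kernel
  · interval_cases a
    · refine parabolic_interval_inf tableA3 tableA3_check [0, 1, 2] [1, 2, 3] 2 ?_ ?_ <;>
        decide +kernel
    · refine parabolic_interval_inf tableA2 tableA2_check [0, 2, 1] [2, 3] 60 ?_ ?_ <;>
        decide +kernel
    · refine parabolic_interval_inf tableA1 tableA1_check [0, 2] [3] 4 ?_ ?_ <;>
        decide +kernel
  · interval_cases a
    · refine parabolic_interval_inf' tableF4 tableF4_check [0, 1, 2, 3, 4] [0, 1, 2, 3] 1 ?_ ?_ <;>
        decide +kernel
    · refine parabolic_interval_inf tableB3overB2 tableB3overB2_check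
          [0, 1, 2, 3] [2, 3, 4] 3947580 ?_ ?_ <;>
        decide +kernel
    · refine parabolic_interval_inf' tableA2 tableA2_check [0, 3, 4] [2, 3] 1 ?_ ?_ <;>
        decide +kernel
    · refine parabolic_interval_inf tableA1 tableA1_check [0, 3] [4] 257 ?_ ?_ <;>
        decide +kernel
  · interval_cases a
    · refine parabolic_interval_inf' tableVertex tableVertex_check
          [5, 4, 3, 2, 1] [0, 1, 2, 3, 4] 16777215 ?_ ?_ <;>
        decide +kernel
    · refine parabolic_interval_inf tableF4 tableF4_check
          [5, 4, 3, 2, 1] [2, 3, 4, 5] 12434877 ?_ ?_ <;>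
        decide +kernel
    · refine parabolic_interval_inf tableB3overA2 tableB3overA2_check
          [0, 4, 3, 2] [3, 4, 5] 3223857 ?_ ?_ <;>
        decide +kernel
    · refine parabolic_interval_inf tableA2 tableA2_check [0, 4, 3] [4, 5] 77872 ?_ ?_ <;>
        decide +kernel
    · refine parabolic_interval_inf tableA1 tableA1_check [0, 4] [5] 1 ?_ ?_ <;>
        decide +kernel

/-- A homomorphism from a presented group onto a group with no fewer elements is an
isomorphism. -/
theorem exists_mulEquiv_of_card_le {n m : ℕ} {R : Set (FreeGroup (Fin n))} {G : Type*} [Group G]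
    [Finite G] {u : Fin n → G} (h : ∀ r ∈ R, FreeGroup.lift u r = 1) {H : Subgroup G}
    (hH : H = Subgroup.closure (Set.range u))
    (hR : Nat.card (PresentedGroup R) ≠ 0 ∧ Nat.card (PresentedGroup R) ≤ m)
    (hm : m ≤ Nat.card H) :
    ∃ φ : PresentedGroup R ≃* H, ∀ i, (φ (PresentedGroup.of i) : G) = u i := by
  have : Finite (PresentedGroup R) := Nat.finite_of_card_ne_zero hR.1
  have hrange : (PresentedGroup.toGroup h).range = H := by
    rw [hH, MonoidHom.range_eq_map, ← PresentedGroup.closure_range_of, MonoidHom.map_closure,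
      ← Set.range_comp]
    congr 2
    ext i
    exact PresentedGroup.toGroup.of h
  subst hrange
  have hb := (PresentedGroup.toGroup h).rangeRestrict_surjective.bijective_of_nat_card_le
    (hR.2.trans hm)
  exact ⟨MulEquiv.ofBijective _ hb, fun i => PresentedGroup.toGroup.of h⟩

theorem facetGroup_gen :
    facetGroup (fun i : Fin 6 => gen i) = lettersSubgroup gen [0, 1, 2, 3, 4] :=
  parabolic_gen (by simp only [Set.mem_ofPred_eq]; decide) (by decide)

theorem vertexGroup_gen :
    vertexGroup (fun i : Fin 6 => gen i) = lettersSubgroup gen [1, 2, 3, 4, 5] :=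
  parabolic_gen (by simp only [Set.mem_ofPred_eq]; decide) (by decide)

theorem lettersSubgroup_eq_closure_range {n : ℕ} {f : Fin n → ℕ} {l : List ℕ}
    (h : ∀ g ∈ l, ∃ i, f i = g) (h' : ∀ i, f i ∈ l) {G : Type*} [Group G] (v : ℕ → G) :
    lettersSubgroup v l = Subgroup.closure (Set.range fun i => v (f i)) := by
  refine le_antisymm (lettersSubgroup_le.2 fun g hg => ?_) ?_
  · obtain ⟨i, rfl⟩ := h g hg
    exact Subgroup.subset_closure ⟨i, rfl⟩
  · rw [Subgroup.closure_le]
    rintro _ ⟨i, rfl⟩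
    exact mem_lettersSubgroup (h' i)

theorem exists_facet_mulEquiv : ∃ φ : Group3343ss00 2 ≃* facetGroup fun i : Fin 6 => gen i,
    ∀ i : Fin 5, (φ (PresentedGroup.of i) : GL (Fin 24) (ZMod 2)) = gen i.castSucc := by
  refine exists_mulEquiv_of_card_le (m := 73728) (u := fun i : Fin 5 => gen i.castSucc) ?_ ?_
    card_group3343ss00_le (by rw [facetGroup_gen]; exact le_card_facetGroup)
  · rintro r (⟨⟨i, j⟩, rfl⟩ | rfl)
    · have h : ∀ p : Fin 5 × Fin 5, cox33433 p.1.castSucc p.2.castSucc = cox3343 p.1 p.2 := by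
        decide +kernel
      have := gen_pow i.castSucc j.castSucc
      rw [h (i, j)] at this
      simpa [CoxeterMatrix.relation, Function.uncurry] using this
    · rw [relss00, map_pow, map_mul, map_mul, map_sigma, map_tau]
      simp only [FreeGroup.lift_apply_of]
      exact gen_facet_relation
  · rw [facetGroup_gen]
    exact lettersSubgroup_eq_closure_range (f := fun i : Fin 5 => (i.castSucc : ℕ))
      (by decide) (by decide) gen

theorem exists_vertex_mulEquiv : ∃ φ : Group3343s000 3 ≃* vertexGroup fun i : Fin 6 => gen i,
    ∀ i : Fin 5, (φ (PresentedGroup.of i) : GL (Fin 24) (ZMod 2)) = gen i.rev.succ := by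
  refine exists_mulEquiv_of_card_le (m := 93312) (u := fun i : Fin 5 => gen i.rev.succ) ?_ ?_
    card_group3343s000_le (by rw [vertexGroup_gen]; exact le_card_vertexGroup)
  · rintro r (⟨⟨i, j⟩, rfl⟩ | rfl)
    · have h : ∀ p : Fin 5 × Fin 5, cox33433 p.1.rev.succ p.2.rev.succ = cox3343 p.1 p.2 := by
        decide +kernel
      have := gen_pow i.rev.succ j.rev.succ
      rw [h (i, j)] at this
      simpa [CoxeterMatrix.relation, Function.uncurry] using this
    · rw [rels000, map_pow, map_mul, map_mul, map_mul, map_sigma, map_tau]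
      simp only [FreeGroup.lift_apply_of]
      -- Reversing the generators exchanges `σ` and `τ`, so `a σ τ σ` unfolds to `f τ σ τ`.
      exact gen_vertex_relation
  · rw [vertexGroup_gen]
    exact lettersSubgroup_eq_closure_range (f := fun i : Fin 5 => (i.rev.succ : ℕ))
      (by decide) (by decide) gen

theorem card_facetGroup : Nat.card (facetGroup fun i : Fin 6 => gen i) = 73728 := by
  refine le_antisymm ?_ (by rw [facetGroup_gen]; exact le_card_facetGroup)
  obtain ⟨φ, -⟩ := exists_facet_mulEquiv
  exact (Nat.card_congr φ.toEquiv) ▸ card_group3343ss00_le.2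

theorem card_vertexGroup : Nat.card (vertexGroup fun i : Fin 6 => gen i) = 93312 := by
  refine le_antisymm ?_ (by rw [vertexGroup_gen]; exact le_card_vertexGroup)
  obtain ⟨φ, -⟩ := exists_vertex_mulEquiv
  exact (Nat.card_congr φ.toEquiv) ▸ card_group3343s000_le.2

theorem parabolic_gen_univ :
    parabolic (fun i : Fin 6 => gen i) Set.univ = Theta.rep.range := by
  rw [Theta.range_rep]
  exact parabolic_gen (by simp only [Set.mem_univ, true_iff]; decide) (by decide)

theorem relIndex_eq_of_card {G : Type*} [Group G] {H K : Subgroup G} (hHK : H ≤ K) {m n : ℕ}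
    (hm : 0 < m) (hH : Nat.card H = m) (hK : Nat.card K = m * n) : H.relIndex K = n := by
  have h := Subgroup.relIndex_mul_relIndex ⊥ H K bot_le hHK
  rw [Subgroup.relIndex_bot_left, Subgroup.relIndex_bot_left, hH, hK] at h
  exact Nat.eq_of_mul_eq_mul_left hm h

/-- The hypothesis is the only input from the structure of the whole group; `1045094400` is `93312 ·
11200` and `73728 · 14175`. -/
theorem isGroupOfGammaOne_gen (hcard : Nat.card Theta.rep.range = 1045094400) :
    IsGroupOfGammaOne fun i : Fin 6 => gen i where
  stringC :=
    { orderOf_gen := fun i => by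
        have h := orderOf_gen_mul_gen
        refine orderOf_eq_prime (by rw [pow_two, gen_mul_self]) fun h1 => ?_
        have h2 : ∀ i : Fin 6, wordNeOne [(i : ℕ)] = true := by decide +kernel
        refine prod_gen_ne_one (h2 i) ?_
        rw [List.map_cons, List.map_nil, List.prod_singleton]
        exact h1
      commute := commute_gen
      inter := intersectionProperty_gen }
  type := orderOf_gen_mul_gen
  facets := exists_facet_mulEquiv
  vertexFigures := exists_vertex_mulEquiv
  card_vertices := by
    refine relIndex_eq_of_card (parabolic_mono (Set.subset_univ _)) (by norm_num)
      card_vertexGroup ?_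
    rw [parabolic_gen_univ, hcard]
  card_facets := by
    refine relIndex_eq_of_card (parabolic_mono (Set.subset_univ _)) (by norm_num)
      card_facetGroup ?_
    rw [parabolic_gen_univ, hcard]

end GammaOne

/-! ### Quadratic forms in binary digits -/

section HyperbolicForm

/-- The element of `𝔽₂` with the given truth value. -/
def bz (b : Bool) : ZMod 2 := bif b then 1 else 0

theorem bz_xor (a b : Bool) : bz (a ^^ b) = bz a + bz b := by
  cases a <;> cases b <;> decide

theorem bz_and (a b : Bool) : bz (a && b) = bz a * bz b := by
  cases a <;> cases b <;> decide

theorem bz_inj {a b : Bool} : bz a = bz b ↔ a = b := by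
  cases a <;> cases b <;> decide

theorem bz_true : bz true = 1 := rfl

/-- The value of a quadratic form, given by a list of monomials, in terms of binary digits. -/
def quadBits : List (ℕ × ℕ) → ℕ → Bool
  | [], _ => false
  | p :: l, x => (x.testBit p.1 && x.testBit p.2) ^^ quadBits l x

/-- The value of the polar form of a quadratic form in terms of binary digits. -/
def polarBits (l : List (ℕ × ℕ)) (x y : ℕ) : Bool :=
  quadBits l (x ^^^ y) ^^ (quadBits l x ^^ quadBits l y)

theorem bz_quadBits (l : List (ℕ × ℕ)) (x : ℕ) :
    bz (quadBits l x) = (l.map fun p => bz (x.testBit p.1) * bz (x.testBit p.2)).sum := by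
  induction l with
  | nil => rfl
  | cons p l ih => rw [quadBits, bz_xor, bz_and, ih, List.map_cons, List.sum_cons]

theorem polar_vec {n : ℕ} {Q : QuadraticForm (ZMod 2) (Fin n → ZMod 2)} {l : List (ℕ × ℕ)}
    (h : ∀ x, Q (vec n x) = bz (quadBits l x)) (x y : ℕ) :
    QuadraticMap.polar Q (vec n x) (vec n y) = bz (polarBits l x y) := by
  rw [QuadraticMap.polar, ← vec_xor, h, h, h, polarBits, bz_xor, bz_xor]
  generalize bz (quadBits l (x ^^^ y)) = a
  generalize bz (quadBits l x) = b
  generalize bz (quadBits l y) = c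
  revert a b c
  decide

/-- The monomials of the form `x₁x₂ + x₃x₄ + x₅x₆ + x₇x₈`. -/
def hypMonomials : List (ℕ × ℕ) := [(0, 1), (2, 3), (4, 5), (6, 7)]

theorem hyperbolicForm_vec (x : ℕ) :
    hyperbolicForm (vec 8 x) = bz (quadBits hypMonomials x) := by
  rw [bz_quadBits]
  simp only [hypMonomials, List.map_cons, List.map_nil, List.sum_cons, List.sum_nil]
  rw [hyperbolicForm, Fin.sum_univ_four]
  simp only [add_zero, ← add_assoc]
  rfl

theorem zmod_two_cases (a : ZMod 2) : a = 0 ∨ a = 1 := by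
  revert a
  decide

end HyperbolicForm

/-! ### Orthogonal transvections in characteristic 2 -/

section Reflections

variable {V : Type*} [AddCommGroup V] [Module (ZMod 2) V] (Q : QuadraticForm (ZMod 2) V)

theorem polar_self (v : V) : QuadraticMap.polar Q v v = 0 := by
  rw [QuadraticMap.polar_self, two_smul]
  exact CharTwo.add_self_eq_zero _

/-- The orthogonal transvection with a given non-singular centre. -/
def reflection (v : V) : V ≃ₗ[ZMod 2] V :=
  LinearEquiv.transvection (f := QuadraticMap.polarBilin Q v) (v := v) (polar_self Q v)

variable {Q}

theorem reflection_apply (v x : V) :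
    reflection Q v x = x + QuadraticMap.polar Q v x • v := rfl

theorem reflection_mem {v : V} (hv : Q v = 1) : reflection Q v ∈ isometryGroup Q := by
  intro x
  rw [reflection_apply, QuadraticMap.map_add Q, QuadraticMap.map_smul,
    QuadraticMap.polar_smul_right, QuadraticMap.polar_comm Q x v, hv, smul_eq_mul, smul_eq_mul, mul_one, add_assoc,
    CharTwo.add_self_eq_zero, add_zero]

theorem reflection_of_polar_eq_zero {v x : V} (h : QuadraticMap.polar Q v x = 0) :
    reflection Q v x = x := by
  rw [reflection_apply, h, zero_smul, add_zero]

/-- If `x` and `y` both have norm 1, so has `x + y` (`map_add_of_polar_eq_one`). Non-orthogonal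
vectors of norm 1 are thus interchanged by a reflection that fixes everything orthogonal to their
sum. -/
theorem reflection_add {x y : V} (h : QuadraticMap.polar Q x y = 1) :
    reflection Q (x + y) x = y := by
  rw [reflection_apply, QuadraticMap.polar_add_left, polar_self, QuadraticMap.polar_comm Q y x, h,
    zero_add, one_smul, ← add_assoc, ← two_smul (ZMod 2) x]
  rw [show (2 : ZMod 2) = 0 from rfl, zero_smul, zero_add]

theorem map_add_of_polar_eq_one {x y : V} (hx : Q x = 1) (hy : Q y = 1)
    (h : QuadraticMap.polar Q x y = 1) : Q (x + y) = 1 := by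
  rw [QuadraticMap.map_add Q, hx, hy, h]
  rfl

theorem polar_isometry {g : V ≃ₗ[ZMod 2] V} (hg : g ∈ isometryGroup Q) (x y : V) :
    QuadraticMap.polar Q (g x) (g y) = QuadraticMap.polar Q x y := by
  rw [QuadraticMap.polar, QuadraticMap.polar, ← map_add, hg, hg, hg]

theorem conj_reflection {g : V ≃ₗ[ZMod 2] V} (hg : g ∈ isometryGroup Q) (v : V) :
    g * reflection Q v * g⁻¹ = reflection Q (g v) := by
  ext x
  have h : g (g⁻¹ x) = x := g.apply_symm_apply x
  rw [LinearEquiv.mul_apply, LinearEquiv.mul_apply, reflection_apply, reflection_apply, map_add,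
    map_smul, h, ← polar_isometry hg v, h]

end Reflections

/-! ### The order of `GO₈⁺(2)` and its generation by reflections -/

section OrthogonalGroup

/-- The isometry group of the hyperbolic form. -/
abbrev OrthGroup : Type := isometryGroup hyperbolicForm

instance : Finite OrthGroup :=
  Finite.of_injective (fun g : OrthGroup => ((g : (Fin 8 → ZMod 2) ≃ₗ[ZMod 2] (Fin 8 → ZMod 2)) :
    (Fin 8 → ZMod 2) → (Fin 8 → ZMod 2))) fun _ _ h => Subtype.ext (DFunLike.coe_injective h)

/-- The action on vectors. -/
def orthAction : OrthGroup →* Equiv.Perm (Fin 8 → ZMod 2) where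
  toFun g := (g : (Fin 8 → ZMod 2) ≃ₗ[ZMod 2] (Fin 8 → ZMod 2)).toEquiv
  map_one' := rfl
  map_mul' _ _ := rfl

/-- The reflection in a vector of norm 1. -/
def orthReflection (v : Fin 8 → ZMod 2) (hv : hyperbolicForm v = 1) : OrthGroup :=
  ⟨reflection hyperbolicForm v, reflection_mem hv⟩

/-- The subgroup generated by the reflections. -/
def reflectionGroup : Subgroup OrthGroup :=
  Subgroup.closure {g | ∃ v hv, g = orthReflection v hv}

theorem orthReflection_mem (v : Fin 8 → ZMod 2) (hv : hyperbolicForm v = 1) :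
    orthReflection v hv ∈ reflectionGroup := Subgroup.subset_closure ⟨v, hv, rfl⟩

/-- The digits of a basis of vectors of norm 1. -/
def chainBits (k : ℕ) : ℕ := [3, 7, 11, 19, 35, 13, 67, 131].getD k 0

/-- A basis of vectors of norm 1. -/
def chainVec (k : ℕ) : Fin 8 → ZMod 2 := vec 8 (chainBits k)

/-- The pointwise stabilizer of the first `k` basis vectors. -/
def chainStabilizer (k : ℕ) : Subgroup OrthGroup :=
  ⨅ i : Fin k, pointStabilizer orthAction (chainVec i)

theorem mem_chainStabilizer {k : ℕ} {g : OrthGroup} :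
    g ∈ chainStabilizer k ↔ ∀ i < k, orthAction g (chainVec i) = chainVec i := by
  simp only [chainStabilizer, Subgroup.mem_iInf, mem_pointStabilizer]
  exact ⟨fun h i hi => h ⟨i, hi⟩, fun h i => h i i.2⟩

/-- The digits of the linear combinations of the first `k` basis vectors. -/
def chainSpan : ℕ → List ℕ
  | 0 => [0]
  | k + 1 => chainSpan k ++ (chainSpan k).map (Nat.xor (chainBits k))

/-- The digits of the possible images of a basis vector under the stabilizer of the previous basis
vectors. -/
def chainOrbit (k : ℕ) : List ℕ := (List.range 256).filter fun x =>
  quadBits hypMonomials x &&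
    ((List.range k).all fun i => polarBits hypMonomials (chainBits i) x ==
      polarBits hypMonomials (chainBits i) (chainBits k)) && !(chainSpan k).elem x

/-- All vectors of norm 1 in the list `l` are connected to `v` by two reflections or fewer. -/
def chainConnected (v : ℕ) (l : List ℕ) : Bool := l.all fun x =>
  Nat.beq x v || polarBits hypMonomials x v ||
    l.any fun z => polarBits hypMonomials x z && polarBits hypMonomials z v

/-- This is the combinatorial core of a Witt-type argument: joining non-orthogonal candidates, every
candidate is within distance two of the basis vector, and each edge is realized by a reflection that
fixes the earlier basis vectors. -/
theorem chainOrbit_connected : ∀ k < 8, chainConnected (chainBits k) (chainOrbit k) = true := by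
  decide +kernel

theorem chainBits_mem_chainOrbit : ∀ k < 8, chainBits k ∈ chainOrbit k := by
  decide +kernel

theorem chainBits_lt (k : ℕ) : chainBits k < 2 ^ 8 := by
  rcases lt_or_ge k 8 with h | h
  · revert k
    decide
  · rw [chainBits, List.getD_eq_default _ _ (by simpa using h)]
    norm_num

theorem fixed_of_mem_chainSpan {k : ℕ} {g : OrthGroup} (hg : g ∈ chainStabilizer k) {x : ℕ}
    (hx : x ∈ chainSpan k) : orthAction g (vec 8 x) = vec 8 x := by
  induction k generalizing x with
  | zero =>
    rw [List.mem_singleton.1 hx, vec_zero]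
    exact map_zero (g : (Fin 8 → ZMod 2) ≃ₗ[ZMod 2] (Fin 8 → ZMod 2))
  | succ k ih =>
    have hg' : g ∈ chainStabilizer k :=
      mem_chainStabilizer.2 fun i hi => mem_chainStabilizer.1 hg i (by omega)
    rcases List.mem_append.1 hx with h | h
    · exact ih hg' h
    · obtain ⟨y, hy, rfl⟩ := List.mem_map.1 h
      change orthAction g (vec 8 (chainBits k ^^^ y)) = vec 8 (chainBits k ^^^ y)
      rw [vec_xor]
      have h1 := mem_chainStabilizer.1 hg k (by omega)
      have h2 := ih hg' hy
      exact (map_add (g : (Fin 8 → ZMod 2) ≃ₗ[ZMod 2] (Fin 8 → ZMod 2)) _ _).trans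
        (congrArg₂ (· + ·) h1 h2)

theorem hyperbolicForm_orthAction (g : OrthGroup) (x : Fin 8 → ZMod 2) :
    hyperbolicForm (orthAction g x) = hyperbolicForm x := g.2 x

theorem polar_orthAction (g : OrthGroup) (x y : Fin 8 → ZMod 2) :
    QuadraticMap.polar hyperbolicForm (orthAction g x) (orthAction g y) =
      QuadraticMap.polar hyperbolicForm x y := polar_isometry g.2 x y

theorem mem_chainOrbit {k x : ℕ} : x ∈ chainOrbit k ↔ x < 2 ^ 8 ∧ hyperbolicForm (vec 8 x) = 1 ∧
    (∀ i < k, QuadraticMap.polar hyperbolicForm (chainVec i) (vec 8 x) =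
      QuadraticMap.polar hyperbolicForm (chainVec i) (chainVec k)) ∧ x ∉ chainSpan k := by
  simp only [chainOrbit, List.mem_filter, List.mem_range, Bool.and_eq_true, List.all_eq_true,
    beq_iff_eq, Bool.not_eq_true', List.elem_eq_mem, decide_eq_false_iff_not, hyperbolicForm_vec,
    chainVec, polar_vec hyperbolicForm_vec, bz_inj, ← bz_true, and_assoc]
  norm_num

/-- An isometry preserves norms and inner products. The image also avoids the span of the earlier
basis vectors, since that span is fixed pointwise and the isometry is injective. -/
theorem exists_mem_chainOrbit {k : ℕ} (hk : k < 8) {g : OrthGroup} (hg : g ∈ chainStabilizer k) :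
    ∃ x ∈ chainOrbit k, orthAction g (chainVec k) = vec 8 x := by
  obtain ⟨x, hx, hx'⟩ := exists_vec (orthAction g (chainVec k))
  have h0 := mem_chainOrbit.1 (chainBits_mem_chainOrbit k hk)
  refine ⟨x, mem_chainOrbit.2 ⟨hx, ?_, fun i hi => ?_, fun hmem => ?_⟩, hx'.symm⟩
  · rw [hx', hyperbolicForm_orthAction]
    exact h0.2.1
  · have h := polar_orthAction g (chainVec i) (chainVec k)
    rwa [mem_chainStabilizer.1 hg i hi, ← hx'] at h
  · have h1 := fixed_of_mem_chainSpan hg hmem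
    rw [hx'] at h1
    have h2 := (orthAction g).injective h1
    have h3 := vec_injOn hx (chainBits_lt k) (hx'.trans h2)
    rw [h3] at hmem
    exact h0.2.2.2 hmem

/-- The reflection has centre `x + y`. The earlier basis vectors have the same inner products with
`x` and `y`, hence are orthogonal to the centre and fixed. -/
theorem exists_reflection_map {k x y : ℕ} (hx : x ∈ chainOrbit k) (hy : y ∈ chainOrbit k)
    (hxy : polarBits hypMonomials x y = true) :
    ∃ g ∈ reflectionGroup ⊓ chainStabilizer k, orthAction g (vec 8 y) = vec 8 x := by
  have hx := mem_chainOrbit.1 hx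
  have hy := mem_chainOrbit.1 hy
  have hxy' : QuadraticMap.polar hyperbolicForm (vec 8 y) (vec 8 x) = 1 := by
    rw [QuadraticMap.polar_comm, polar_vec hyperbolicForm_vec, hxy, bz_true]
  refine ⟨orthReflection _ (map_add_of_polar_eq_one hy.2.1 hx.2.1 hxy'),
    ⟨orthReflection_mem _ _, mem_chainStabilizer.2 fun i hi => ?_⟩, reflection_add hxy'⟩
  refine reflection_of_polar_eq_zero ?_
  rw [QuadraticMap.polar_comm, QuadraticMap.polar_add_right, hx.2.2.1 i hi, hy.2.2.1 i hi]
  exact CharTwo.add_self_eq_zero _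

theorem exists_mem_reflectionGroup {k x : ℕ} (hk : k < 8) (hx : x ∈ chainOrbit k) :
    ∃ g ∈ reflectionGroup ⊓ chainStabilizer k, orthAction g (chainVec k) = vec 8 x := by
  have h0 := chainBits_mem_chainOrbit k hk
  have h := List.all_eq_true.1 (chainOrbit_connected k hk) x hx
  simp only [Bool.or_eq_true, List.any_eq_true, Bool.and_eq_true] at h
  rcases h with (h | h) | ⟨z, hz, hxz, hzv⟩
  · exact ⟨1, one_mem _, by rw [Nat.eq_of_beq_eq_true h]; rfl⟩
  · exact exists_reflection_map hx h0 h
  · obtain ⟨g, hg, hg'⟩ := exists_reflection_map hx hz hxz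
    obtain ⟨h, hh, hh'⟩ := exists_reflection_map hz h0 hzv
    refine ⟨g * h, mul_mem hg hh, ?_⟩
    rw [map_mul, Equiv.Perm.mul_apply, chainVec, hh', hg']

theorem chainStabilizer_zero : chainStabilizer 0 = ⊤ :=
  eq_top_iff.2 fun _ _ => mem_chainStabilizer.2 fun _ hi => absurd hi (Nat.not_lt_zero _)

theorem chainStabilizer_succ (k : ℕ) :
    chainStabilizer (k + 1) = pointStabilizer orthAction (chainVec k) ⊓ chainStabilizer k := by
  ext g
  simp only [Subgroup.mem_inf, mem_chainStabilizer, mem_pointStabilizer]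
  refine ⟨fun h => ⟨h k (by omega), fun i hi => h i (by omega)⟩, fun h i hi => ?_⟩
  rcases Nat.lt_succ_iff_lt_or_eq.1 hi with hi | rfl
  · exact h.2 i hi
  · exact h.1

theorem chainStabilizer_eight : chainStabilizer 8 = ⊥ := by
  refine (Subgroup.eq_bot_iff_forall _).2 fun g hg => Subtype.ext ?_
  have h : ∀ i < 8, 2 ^ i ∈ chainSpan 8 := by decide +kernel
  refine LinearEquiv.toLinearMap_injective (linearMap_ext_vec fun i hi => ?_)
  exact fixed_of_mem_chainSpan hg (h i hi)

/-- Induction from the trivial stabilizer of the full basis upwards: a product of reflections moves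
the next basis vector to the same place as `g`, and the quotient of the two fixes one more vector.
-/
theorem chainStabilizer_le_reflectionGroup (j : ℕ) (hj : j ≤ 8) :
    chainStabilizer (8 - j) ≤ reflectionGroup := by
  induction j with
  | zero =>
    rw [Nat.sub_zero, chainStabilizer_eight]
    exact bot_le
  | succ j ih =>
    intro g hg
    obtain ⟨x, hx, hgx⟩ := exists_mem_chainOrbit (k := 8 - (j + 1)) (by omega) hg
    obtain ⟨t, ht, htx⟩ := exists_mem_reflectionGroup (by omega) hx
    have h : t⁻¹ * g ∈ chainStabilizer (8 - j) := by
      rw [show 8 - j = 8 - (j + 1) + 1 by omega, chainStabilizer_succ]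
      refine ⟨?_, Subgroup.mul_mem _ (Subgroup.inv_mem _ ht.2) hg⟩
      change orthAction (t⁻¹ * g) _ = _
      rw [map_mul, Equiv.Perm.mul_apply, hgx, map_inv, Equiv.Perm.inv_eq_iff_eq, htx]
    rw [show g = t * (t⁻¹ * g) by group]
    exact mul_mem ht.1 (ih (by omega) h)

/-- The orthogonal group is generated by reflections. -/
theorem reflectionGroup_eq_top : reflectionGroup = ⊤ := by
  rw [eq_top_iff, ← chainStabilizer_zero]
  exact chainStabilizer_le_reflectionGroup 8 le_rfl

/-- The candidates form exactly the orbit: images are candidates, and reflections reach every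
candidate. -/
theorem card_chainStabilizer {k : ℕ} (hk : k < 8) : Nat.card (chainStabilizer k) =
    (chainOrbit k).length * Nat.card (chainStabilizer (k + 1)) := by
  have h1 := Subgroup.relIndex_mul_relIndex ⊥ (chainStabilizer (k + 1)) (chainStabilizer k)
    bot_le (by rw [chainStabilizer_succ]; exact inf_le_right)
  rw [Subgroup.relIndex_bot_left, Subgroup.relIndex_bot_left] at h1
  rw [← h1, mul_comm, chainStabilizer_succ, Subgroup.inf_relIndex_right, pointStabilizer_relIndex]
  congr 1
  have h2 : {y | ∃ g ∈ chainStabilizer k, orthAction g (chainVec k) = y} =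
      vec 8 '' ((chainOrbit k).toFinset : Set ℕ) := by
    ext y
    simp only [Set.mem_ofPred_eq, Set.mem_image, List.coe_toFinset]
    constructor
    · rintro ⟨g, hg, rfl⟩
      obtain ⟨x, hx, h⟩ := exists_mem_chainOrbit hk hg
      exact ⟨x, hx, h.symm⟩
    · rintro ⟨x, hx, rfl⟩
      obtain ⟨g, hg, h⟩ := exists_mem_reflectionGroup hk hx
      exact ⟨g, hg.2, h⟩
  rw [h2, Set.InjOn.ncard_image, Set.ncard_coe_finset, List.toFinset_card_of_nodup]
  · exact List.nodup_range.filter _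
  · intro x hx y hy hxy
    simp only [List.coe_toFinset, Set.mem_ofPred_eq] at hx hy
    exact vec_injOn (mem_chainOrbit.1 hx).1 (mem_chainOrbit.1 hy).1 hxy

theorem card_orthGroup : Nat.card OrthGroup = 348364800 := by
  have h : ((List.range 8).map fun k => (chainOrbit k).length) = [120, 63, 32, 15, 8, 6, 2, 1] := by
    decide +kernel
  have h' : ∀ k < 8, (chainOrbit k).length = [120, 63, 32, 15, 8, 6, 2, 1].getD k 0 := by
    intro k hk
    rw [← h]
    simp [hk]
  rw [← Subgroup.card_top, ← chainStabilizer_zero, card_chainStabilizer, card_chainStabilizer,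
    card_chainStabilizer, card_chainStabilizer, card_chainStabilizer, card_chainStabilizer,
    card_chainStabilizer, card_chainStabilizer, chainStabilizer_eight, h', h', h', h', h', h', h',
    h']
  all_goals simp

/-- The reflections form one class of conjugate elements. -/
theorem exists_map_chainVec {v : Fin 8 → ZMod 2} (hv : hyperbolicForm v = 1) :
    ∃ g : OrthGroup, orthAction g (chainVec 0) = v := by
  obtain ⟨x, hx, rfl⟩ := exists_vec v
  have h : ∀ x < 256, quadBits hypMonomials x = true → x ∈ chainOrbit 0 := by decide +kernel
  rw [hyperbolicForm_vec, ← bz_true, bz_inj] at hv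
  obtain ⟨g, -, hg⟩ := exists_mem_reflectionGroup (by norm_num) (h x hx hv)
  exact ⟨g, hg⟩

theorem hyperbolicForm_chainVec : hyperbolicForm (chainVec 0) = 1 :=
  (mem_chainOrbit.1 (chainBits_mem_chainOrbit 0 (by norm_num))).2.1

theorem conj_orthReflection (g : OrthGroup) {v w : Fin 8 → ZMod 2} (hv : hyperbolicForm v = 1)
    (hw : hyperbolicForm w = 1) (h : orthAction g v = w) :
    g * orthReflection v hv * g⁻¹ = orthReflection w hw := by
  subst h
  exact Subtype.ext (conj_reflection g.2 v)

theorem orthReflection_mul_self {v : Fin 8 → ZMod 2} (hv : hyperbolicForm v = 1) :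
    orthReflection v hv * orthReflection v hv = 1 := by
  refine Subtype.ext (LinearEquiv.ext fun x => ?_)
  change reflection hyperbolicForm v (reflection hyperbolicForm v x) = x
  rw [reflection_apply v x, map_add, map_smul, reflection_of_polar_eq_zero (polar_self _ v),
    reflection_apply, add_assoc]
  rw [← two_smul (ZMod 2) (QuadraticMap.polar hyperbolicForm v x • v),
    show (2 : ZMod 2) = 0 from rfl, zero_smul, add_zero]

/-- The commutator subgroup of the orthogonal group has index at most 2. -/
theorem mem_commutator_or {v : Fin 8 → ZMod 2} (hv : hyperbolicForm v = 1) (g : OrthGroup) :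
    g ∈ commutator OrthGroup ∨ orthReflection v hv * g ∈ commutator OrthGroup := by
  -- Conjugate elements agree in the abelianization, so all reflections have one image there, of
  -- order at most 2. As they generate the group, its abelianization has at most two elements.
  have hof : ∀ w hw, (Abelianization.of (orthReflection w hw) : Abelianization OrthGroup) =
      Abelianization.of (orthReflection _ hyperbolicForm_chainVec) := by
    intro w hw
    obtain ⟨g, hg⟩ := exists_map_chainVec hw
    rw [← conj_orthReflection g hyperbolicForm_chainVec hw hg, map_mul, map_mul, map_inv,
      mul_comm, inv_mul_cancel_left]
  have hsq : (Abelianization.of (orthReflection v hv) : Abelianization OrthGroup) *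
      Abelianization.of (orthReflection v hv) = 1 := by
    rw [← map_mul, orthReflection_mul_self, map_one]
  have key : Abelianization.of g = (1 : Abelianization OrthGroup) ∨
      Abelianization.of g =
        (Abelianization.of (orthReflection v hv) : Abelianization OrthGroup) := by
    have hg : g ∈ reflectionGroup := by
      rw [reflectionGroup_eq_top]
      trivial
    induction hg using Subgroup.closure_induction with
    | mem g hg =>
      obtain ⟨w, hw, rfl⟩ := hg
      exact Or.inr ((hof w hw).trans (hof v hv).symm)
    | one => exact Or.inl (map_one _)
    | mul x y _ _ hx hy =>
      rw [map_mul]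
      rcases hx with hx | hx <;> rcases hy with hy | hy <;> simp [hx, hy, hsq]
    | inv x _ hx =>
      rw [map_inv]
      rcases hx with hx | hx
      · simp [hx]
      · exact Or.inr (by rw [hx]; exact inv_eq_of_mul_eq_one_left hsq)
  rw [← Abelianization.ker_of, MonoidHom.mem_ker, MonoidHom.mem_ker, map_mul]
  rcases key with h | h
  · exact Or.inl h
  · exact Or.inr (by rw [h, hsq])

end OrthogonalGroup

/-! ### Invariance of `Φ` -/

section InvariantForm

/-- Values on basis vectors and on sums of two of them determine the polar form, and with it the
quadratic form. -/
theorem quadraticForm_ext_vec {n : ℕ} {Q Q' : QuadraticForm (ZMod 2) (Fin n → ZMod 2)}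
    (h : ∀ i < n, Q (vec n (2 ^ i)) = Q' (vec n (2 ^ i)))
    (h2 : ∀ i < n, ∀ j < n, Q (vec n (2 ^ i ^^^ 2 ^ j)) = Q' (vec n (2 ^ i ^^^ 2 ^ j))) :
    Q = Q' := by
  have hB : QuadraticMap.polarBilin Q = QuadraticMap.polarBilin Q' := by
    refine linearMap_ext_vec fun i hi => linearMap_ext_vec fun j hj => ?_
    rw [QuadraticMap.polarBilin_apply_apply, QuadraticMap.polarBilin_apply_apply,
      QuadraticMap.polar, QuadraticMap.polar, ← vec_xor, h i hi, h j hj, h2 i hi j hj]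
  ext x
  rw [← (Pi.basisFun (ZMod 2) (Fin n)).sum_repr x]
  refine Finset.sum_induction _ (fun x => Q x = Q' x) (fun x y hx hy => ?_)
    (by rw [QuadraticMap.map_zero, QuadraticMap.map_zero]) fun i _ => ?_
  · rw [QuadraticMap.map_add Q, QuadraticMap.map_add Q', hx, hy]
    exact congrArg _ (LinearMap.congr_fun₂ hB x y)
  · have := h i i.2
    rw [vec_two_pow i.2] at this
    rw [QuadraticMap.map_smul, QuadraticMap.map_smul, Pi.basisFun_apply, this]

/-- The monomials of the form `Φ`. -/
def phiMonomials : List (ℕ × ℕ) :=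
  (List.range 24).map (fun j => (j, j)) ++ (List.range 12).map fun i => (2 * i, 2 * i + 1)

theorem Phi_vec (x : ℕ) : Phi (vec 24 x) = bz (quadBits phiMonomials x) := by
  rw [bz_quadBits, phiMonomials, List.map_append, List.sum_append, List.map_map, List.map_map,
    Phi, add_apply, sum_apply, sum_apply]
  rfl

theorem quadBits_genRows : ∀ p : Fin 6 × Fin 24,
    quadBits phiMonomials (act (genRows p.1) (2 ^ (p.2 : ℕ))) =
      quadBits phiMonomials (2 ^ (p.2 : ℕ)) := by decide +kernel

theorem quadBits_xor_genRows : ((List.range 6).all fun k => (List.range 24).all fun i =>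
    forced (act (genRows k) (2 ^ i)) fun x => (List.range 24).all fun j =>
    forced (act (genRows k) (2 ^ j)) fun y => forced (x ^^^ y) fun z =>
    forced (2 ^ i ^^^ 2 ^ j) fun w => quadBits phiMonomials z == quadBits phiMonomials w) =
      true := by decide +kernel

theorem Phi_vecMul_gen (i : Fin 6) (x : Fin 24 → ZMod 2) :
    Phi (x ᵥ* (gen i : Matrix (Fin 24) (Fin 24) (ZMod 2))) = Phi x := by
  have h : Phi.comp (Matrix.vecMulLinear (ofRows 24 24 (genRows i))) = Phi := by
    have hv : ∀ x, (Matrix.vecMulLinear (ofRows 24 24 (genRows i))) (vec 24 x) =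
      vec 24 (act (genRows i) x) := vecMul_ofRows' 24 (length_genRows i)
    refine quadraticForm_ext_vec (fun j hj => ?_) fun j hj k hk => ?_
    · rw [QuadraticMap.comp_apply, hv, Phi_vec, Phi_vec, quadBits_genRows (i, ⟨j, hj⟩)]
    · have h := List.all_eq_true.1 (List.all_eq_true.1 quadBits_xor_genRows i
        (List.mem_range.2 i.2)) j (List.mem_range.2 hj)
      rw [forced_eq] at h
      have h := List.all_eq_true.1 h k (List.mem_range.2 hk)
      rw [forced_eq, forced_eq, forced_eq, beq_iff_eq] at h
      rw [QuadraticMap.comp_apply, vec_xor, map_add, hv, hv, ← vec_xor, ← vec_xor, Phi_vec,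
        Phi_vec, h]
  rw [coe_gen]
  exact DFunLike.congr_fun h x

end InvariantForm

/-! ### Induction over words in the generators of `Θ` -/

section Theta

theorem Theta.gen_inv (i : Fin 6) : (Theta.gen i)⁻¹ = Theta.gen i := by
  have h : cox33433.relation i i ∈ cox33433.relationsSet ∪ thetaExtraRels :=
    Or.inl ⟨(i, i), rfl⟩
  have h1 := PresentedGroup.one_of_mem h
  rw [CoxeterMatrix.relation, cox33433.diagonal, pow_one, map_mul] at h1
  exact inv_eq_of_mul_eq_one_left h1

theorem Theta.induction {P : Theta → Prop} (one : P 1)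
    (gen_mul : ∀ i g, P g → P (Theta.gen i * g)) (g : Theta) : P g := by
  have hg : g ∈ Subgroup.closure (Set.range Theta.gen) := by
    rw [Theta.closure_range_gen]
    exact Subgroup.mem_top g
  induction hg using Subgroup.closure_induction_left with
  | one => exact one
  | mul_left x hx y hy h =>
    obtain ⟨i, rfl⟩ := hx
    exact gen_mul i y h
  | inv_mul_cancel x hx y hy h =>
    obtain ⟨i, rfl⟩ := hx
    rw [Theta.gen_inv]
    exact gen_mul i y h

theorem Theta.val_rep_gen_mul (i : Fin 6) (g : Theta) : (Theta.rep (Theta.gen i * g)).val =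
    (Polytope33433.gen i).val * (Theta.rep g).val := by
  rw [map_mul, Theta.rep_gen, Units.val_mul]

theorem Theta.Phi_vecMul_rep (g : Theta) (x : Fin 24 → ZMod 2) :
    Phi (x ᵥ* (Theta.rep g : Matrix (Fin 24) (Fin 24) (ZMod 2))) = Phi x := by
  induction g using Theta.induction generalizing x with
  | one => rw [map_one, Units.val_one, Matrix.vecMul_one]
  | gen_mul i g ih => rw [Theta.val_rep_gen_mul, ← Matrix.vecMul_vecMul, ih, Phi_vecMul_gen]

end Theta

/-! ### The action on the three blocks -/

section Blocks

/-- The permutation of the three blocks that is induced by a generator. -/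
def genPerm : ℕ → Equiv.Perm (Fin 3)
  | 3 => Equiv.swap 1 2
  | 4 => Equiv.swap 0 1
  | 5 => Equiv.swap 1 2
  | _ => 1

/-- The action of `Θ` on the three blocks. -/
def Theta.perm : Theta →* Equiv.Perm (Fin 3) :=
  Theta.lift (fun i : Fin 6 => genPerm i) (by decide +kernel) (by decide +kernel)
    (by decide +kernel)

theorem Theta.perm_gen (i : Fin 6) : Theta.perm (Theta.gen i) = genPerm i :=
  Theta.lift_gen _ _ _ i

/-- The rows of the projection to a block. -/
def blockRows (p : ℕ) : List ℕ :=
  (List.range 24).map fun j => bif Nat.beq (j / 8) p then 2 ^ j else 0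

theorem length_blockRows (p : ℕ) : (blockRows p).length = 24 := by
  rw [blockRows, List.length_map, List.length_range]

/-- The projection to a block. -/
def blockProj (p : Fin 3) : Matrix (Fin 24) (Fin 24) (ZMod 2) := ofRows 24 24 (blockRows p)

theorem vecMul_blockProj (p : Fin 3) (x : ℕ) :
    vec 24 x ᵥ* blockProj p = vec 24 (act (blockRows p) x) :=
  vecMul_ofRows' 24 (length_blockRows p) x

theorem blockProj_injective : Function.Injective blockProj := by
  intro p q h
  have h1 : ∀ p q : Fin 3, p ≠ q →
      act (blockRows p) (2 ^ (8 * (p : ℕ))) < 2 ^ 24 ∧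
      act (blockRows q) (2 ^ (8 * (p : ℕ))) < 2 ^ 24 ∧
      act (blockRows p) (2 ^ (8 * (p : ℕ))) ≠ act (blockRows q) (2 ^ (8 * (p : ℕ))) := by
    decide +kernel
  by_contra hpq
  obtain ⟨h2, h3, h4⟩ := h1 p q hpq
  refine h4 (vec_injOn h2 h3 ?_)
  rw [← vecMul_blockProj, ← vecMul_blockProj, h]

/-- On row vectors this says that `g` sends block `perm g p` to block `p`; the direction is the one
that makes `perm` a homomorphism although rows are acted on from the right. -/
theorem Theta.blockProj_mul_rep (g : Theta) (p : Fin 3) :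
    blockProj (Theta.perm g p) * (Theta.rep g : Matrix (Fin 24) (Fin 24) (ZMod 2)) =
      (Theta.rep g : Matrix (Fin 24) (Fin 24) (ZMod 2)) * blockProj p := by
  induction g using Theta.induction generalizing p with
  | one => simp
  | gen_mul i g ih =>
    have h : ∀ p : Fin 6 × Fin 3, (blockRows (genPerm p.1 p.2)).map (act (genRows p.1)) =
        (genRows p.1).map (act (blockRows p.2)) := by decide +kernel
    rw [Theta.val_rep_gen_mul, map_mul, Equiv.Perm.mul_apply, Theta.perm_gen, mul_assoc, ← ih,
      ← mul_assoc, ← mul_assoc, coe_gen, blockProj, blockProj,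
      ofRows_mul 24 (length_blockRows _) (length_genRows _), h (i, _),
      ofRows_mul 24 (length_genRows _) (length_blockRows _)]

/-- The matrix determines the permutation of the blocks because the three projections differ. This
lets the action descend from `Θ` to the matrix group. -/
theorem Theta.ker_rep_le : Theta.rep.ker ≤ Theta.perm.ker := by
  intro g hg
  rw [MonoidHom.mem_ker] at hg ⊢
  ext1 p
  have h := Theta.blockProj_mul_rep g p
  rw [hg, Units.val_one, mul_one, one_mul] at h
  exact blockProj_injective h

end Blocks

/-! ### The invariant triality product -/

section Product

/-- The products of the basis vectors. -/
def prodTable : List (List ℕ) :=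
  [[0, 0, 0, 0, 0, 0, 0, 0, 3145728, 1048576, 12582912, 4194304, 131072, 196608, 524288,
    786432, 12288, 4096, 49152, 16384, 512, 768, 2048, 3072],
   [0, 0, 0, 0, 0, 0, 0, 0, 2097152, 3145728, 8388608, 12582912, 196608, 65536, 786432, 262144,
    8192, 12288, 32768, 49152, 768, 256, 3072, 1024],
   [0, 0, 0, 0, 0, 0, 0, 0, 12582912, 8388608, 3145728, 2097152, 786432, 524288, 196608,
    131072, 49152, 32768, 12288, 8192, 3072, 2048, 768, 512],
   [0, 0, 0, 0, 0, 0, 0, 0, 4194304, 12582912, 1048576, 3145728, 262144, 786432, 65536, 196608,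
    16384, 49152, 4096, 12288, 1024, 3072, 256, 768],
   [0, 0, 0, 0, 0, 0, 0, 0, 131072, 196608, 786432, 262144, 3145728, 1048576, 8388608,
    12582912, 768, 256, 2048, 3072, 8192, 12288, 49152, 16384],
   [0, 0, 0, 0, 0, 0, 0, 0, 196608, 65536, 524288, 786432, 2097152, 3145728, 12582912, 4194304,
    512, 768, 3072, 1024, 12288, 4096, 32768, 49152],
   [0, 0, 0, 0, 0, 0, 0, 0, 524288, 786432, 196608, 65536, 8388608, 12582912, 3145728, 1048576,
    2048, 3072, 768, 256, 32768, 49152, 12288, 4096],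
   [0, 0, 0, 0, 0, 0, 0, 0, 786432, 262144, 131072, 196608, 12582912, 4194304, 2097152,
    3145728, 3072, 1024, 512, 768, 49152, 16384, 8192, 12288],
   [3145728, 2097152, 12582912, 4194304, 131072, 196608, 524288, 786432, 0, 0, 0, 0, 0, 0, 0,
    0, 48, 16, 192, 64, 3, 2, 8, 12],
   [1048576, 3145728, 8388608, 12582912, 196608, 65536, 786432, 262144, 0, 0, 0, 0, 0, 0, 0, 0,
    32, 48, 128, 192, 1, 3, 12, 4],
   [12582912, 8388608, 3145728, 1048576, 786432, 524288, 196608, 131072, 0, 0, 0, 0, 0, 0, 0,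
    0, 192, 128, 48, 32, 8, 12, 3, 2],
   [4194304, 12582912, 2097152, 3145728, 262144, 786432, 65536, 196608, 0, 0, 0, 0, 0, 0, 0, 0,
    64, 192, 16, 48, 12, 4, 1, 3],
   [131072, 196608, 786432, 262144, 3145728, 2097152, 8388608, 12582912, 0, 0, 0, 0, 0, 0, 0,
    0, 3, 1, 8, 12, 48, 32, 192, 64],
   [196608, 65536, 524288, 786432, 1048576, 3145728, 12582912, 4194304, 0, 0, 0, 0, 0, 0, 0, 0,
    2, 3, 12, 4, 16, 48, 128, 192],
   [524288, 786432, 196608, 65536, 8388608, 12582912, 3145728, 2097152, 0, 0, 0, 0, 0, 0, 0, 0,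
    8, 12, 3, 1, 192, 128, 48, 16],
   [786432, 262144, 131072, 196608, 12582912, 4194304, 1048576, 3145728, 0, 0, 0, 0, 0, 0, 0,
    0, 12, 4, 2, 3, 64, 192, 32, 48],
   [12288, 8192, 49152, 16384, 768, 512, 2048, 3072, 48, 32, 192, 64, 3, 2, 8, 12, 0, 0, 0, 0,
    0, 0, 0, 0],
   [4096, 12288, 32768, 49152, 256, 768, 3072, 1024, 16, 48, 128, 192, 1, 3, 12, 4, 0, 0, 0, 0,
    0, 0, 0, 0],
   [49152, 32768, 12288, 4096, 2048, 3072, 768, 512, 192, 128, 48, 16, 8, 12, 3, 2, 0, 0, 0, 0,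
    0, 0, 0, 0],
   [16384, 49152, 8192, 12288, 3072, 1024, 256, 768, 64, 192, 32, 48, 12, 4, 1, 3, 0, 0, 0, 0,
    0, 0, 0, 0],
   [512, 768, 3072, 1024, 8192, 12288, 32768, 49152, 3, 1, 8, 12, 48, 16, 192, 64, 0, 0, 0, 0,
    0, 0, 0, 0],
   [768, 256, 2048, 3072, 12288, 4096, 49152, 16384, 2, 3, 12, 4, 32, 48, 128, 192, 0, 0, 0, 0,
    0, 0, 0, 0],
   [2048, 3072, 768, 256, 49152, 32768, 12288, 8192, 8, 12, 3, 1, 192, 128, 48, 32, 0, 0, 0, 0,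
    0, 0, 0, 0],
   [3072, 1024, 512, 768, 16384, 49152, 4096, 12288, 12, 4, 2, 3, 64, 192, 16, 48, 0, 0, 0, 0,
    0, 0, 0, 0]]
/-- The product of two vectors in terms of binary digits. -/
def mulBits (x y : ℕ) : ℕ := act (prodTable.map fun M => act M y) x

/-- An invariant product. -/
def mulVec : (Fin 24 → ZMod 2) →ₗ[ZMod 2] (Fin 24 → ZMod 2) →ₗ[ZMod 2] (Fin 24 → ZMod 2) :=
  ∑ i : Fin 24, (LinearMap.proj i : (Fin 24 → ZMod 2) →ₗ[ZMod 2] ZMod 2).smulRight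
    (Matrix.vecMulLinear (ofRows 24 24 (prodTable.getD i [])))

theorem mulVec_vec (x y : ℕ) : mulVec (vec 24 x) (vec 24 y) = vec 24 (mulBits x y) := by
  have hl : ∀ i : Fin 24, (prodTable.getD i []).length = 24 := by decide +kernel
  rw [mulBits, ← vecMul_ofRows' 24 (List.length_map _)]
  ext j
  simp only [mulVec, LinearMap.sum_apply, LinearMap.smulRight_apply, LinearMap.smul_apply,
    LinearMap.proj_apply, Finset.sum_apply, Pi.smul_apply, smul_eq_mul, Matrix.vecMul, dotProduct]
  refine Finset.sum_congr rfl fun i _ => congrArg _ ?_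
  have h := congrFun (vecMul_ofRows' 24 (hl i) y) j
  have : (i : ℕ) < prodTable.length := i.2
  refine h.trans (congrArg (fun x => vec 24 x j) ?_)
  simp [this]

attribute [irreducible] mulVec

/-- The product vanishes on pairs from one block and sends pairs from two different blocks to the
third. By bilinearity its invariance has to be checked only on basis vectors. Its connection with
the generators is visible in `prodTable`: multiplication by the first basis vector agrees with `f̂`
on the second and third blocks. -/
theorem mulBits_genRows : ((List.range 6).all fun k => (List.range 24).all fun i =>
    forced (act (genRows k) (2 ^ i)) fun x => (List.range 24).all fun j =>
    forced (act (genRows k) (2 ^ j)) fun y => forced (mulBits (2 ^ i) (2 ^ j)) fun z =>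
    Nat.beq (mulBits x y) (act (genRows k) z)) = true := by decide +kernel

theorem mulVec_gen (i : Fin 6) (x y : Fin 24 → ZMod 2) :
    mulVec (x ᵥ* (gen i : Matrix (Fin 24) (Fin 24) (ZMod 2)))
      (y ᵥ* (gen i : Matrix (Fin 24) (Fin 24) (ZMod 2))) =
    mulVec x y ᵥ* (gen i : Matrix (Fin 24) (Fin 24) (ZMod 2)) := by
  let T := Matrix.vecMulLinear (ofRows 24 24 (genRows i))
  have hT : ∀ x, T (vec 24 x) = vec 24 (act (genRows i) x) :=
    vecMul_ofRows' 24 (length_genRows i)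
  have h2 : (mulVec.compl₁₂ T T) = mulVec.compr₂ T := by
    refine linearMap_ext_vec fun j hj => linearMap_ext_vec fun k hk => ?_
    have h := List.all_eq_true.1 (List.all_eq_true.1 mulBits_genRows i
      (List.mem_range.2 i.2)) j (List.mem_range.2 hj)
    rw [forced_eq] at h
    have h := List.all_eq_true.1 h k (List.mem_range.2 hk)
    rw [forced_eq, forced_eq] at h
    rw [LinearMap.compl₁₂_apply, LinearMap.compr₂_apply, hT, hT, mulVec_vec, mulVec_vec, hT,
      Nat.eq_of_beq_eq_true h]
  have h3 := LinearMap.congr_fun₂ h2 x y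
  rw [LinearMap.compl₁₂_apply, LinearMap.compr₂_apply] at h3
  rw [coe_gen]
  exact h3

theorem Theta.mulVec_rep (g : Theta) (x y : Fin 24 → ZMod 2) :
    mulVec (x ᵥ* (Theta.rep g : Matrix (Fin 24) (Fin 24) (ZMod 2)))
      (y ᵥ* (Theta.rep g : Matrix (Fin 24) (Fin 24) (ZMod 2))) =
    mulVec x y ᵥ* (Theta.rep g : Matrix (Fin 24) (Fin 24) (ZMod 2)) := by
  induction g using Theta.induction generalizing x y with
  | one => simp only [map_one, Units.val_one, Matrix.vecMul_one]
  | gen_mul i g ih =>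
    simp only [Theta.val_rep_gen_mul, ← Matrix.vecMul_vecMul]
    rw [ih, mulVec_gen]

end Product

/-! ### Faithfulness on a block and the trivial centralizer -/

section ThetaHat

/-- The group that is generated by the matrices. -/
abbrev ThetaHat : Subgroup (GL (Fin 24) (ZMod 2)) := Theta.rep.range

/-- The elements of the matrix group as matrices. -/
def toMatrix : ThetaHat →* Matrix (Fin 24) (Fin 24) (ZMod 2) :=
  (Units.coeHom _).comp ThetaHat.subtype

theorem toMatrix_injective : Function.Injective toMatrix :=
  fun _ _ h => Subtype.ext (Units.ext h)

theorem toMatrix_rangeRestrict (g : Theta) : toMatrix (Theta.rep.rangeRestrict g) =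
    (Theta.rep g : Matrix (Fin 24) (Fin 24) (ZMod 2)) := rfl

/-- The action of the matrix group on the three blocks. -/
noncomputable def blockPerm : ThetaHat →* Equiv.Perm (Fin 3) :=
  Theta.rep.rangeRestrict.liftOfSurjective Theta.rep.rangeRestrict_surjective
    ⟨Theta.perm, by
      rw [MonoidHom.ker_rangeRestrict]
      exact Theta.ker_rep_le⟩

theorem blockPerm_rangeRestrict (g : Theta) :
    blockPerm (Theta.rep.rangeRestrict g) = Theta.perm g :=
  MonoidHom.liftOfRightInverse_comp_apply _ _ _ _ _

theorem blockProj_mul_toMatrix (g : ThetaHat) (p : Fin 3) :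
    blockProj (blockPerm g p) * toMatrix g = toMatrix g * blockProj p := by
  obtain ⟨g, rfl⟩ := Theta.rep.rangeRestrict_surjective g
  rw [blockPerm_rangeRestrict]
  exact Theta.blockProj_mul_rep g p

theorem Phi_vecMul_toMatrix (g : ThetaHat) (x : Fin 24 → ZMod 2) :
    Phi (x ᵥ* toMatrix g) = Phi x := by
  obtain ⟨g, rfl⟩ := Theta.rep.rangeRestrict_surjective g
  exact Theta.Phi_vecMul_rep g x

theorem mulVec_toMatrix (g : ThetaHat) (x y : Fin 24 → ZMod 2) :
    mulVec (x ᵥ* toMatrix g) (y ᵥ* toMatrix g) = mulVec x y ᵥ* toMatrix g := by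
  obtain ⟨g, rfl⟩ := Theta.rep.rangeRestrict_surjective g
  exact Theta.mulVec_rep g x y

/-- The generators of the matrix group. -/
def hatGen (i : Fin 6) : ThetaHat := Theta.rep.rangeRestrict (Theta.gen i)

theorem toMatrix_hatGen (i : Fin 6) : toMatrix (hatGen i) = ofRows 24 24 (genRows i) := by
  rw [hatGen, toMatrix_rangeRestrict, Theta.rep_gen, coe_gen]

theorem vecMul_hatGen (i : Fin 6) (x : ℕ) :
    vec 24 x ᵥ* toMatrix (hatGen i) = vec 24 (act (genRows i) x) := by
  rw [toMatrix_hatGen, vecMul_ofRows' 24 (length_genRows i)]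

theorem blockPerm_hatGen (i : Fin 6) : blockPerm (hatGen i) = genPerm i := by
  rw [hatGen, blockPerm_rangeRestrict, Theta.perm_gen]

theorem toMatrix_mul_inv (g : ThetaHat) : toMatrix g * toMatrix g⁻¹ = 1 := by
  rw [← map_mul, mul_inv_cancel, map_one]

theorem vecMul_toMatrix_injective (g : ThetaHat) :
    Function.Injective fun x : Fin 24 → ZMod 2 => x ᵥ* toMatrix g := by
  intro x y h
  have := congrArg (· ᵥ* toMatrix g⁻¹) h
  simpa only [Matrix.vecMul_vecMul, toMatrix_mul_inv, Matrix.vecMul_one] using this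

theorem add_self_vec {n : ℕ} (u : Fin n → ZMod 2) : u + u = 0 := by
  ext i
  exact CharTwo.add_self_eq_zero _

/-- A matrix that commutes with a linear map of rank one fixes the image of the latter. -/
theorem vecMul_eq_of_rank_one {g : ThetaHat} {f : (Fin 24 → ZMod 2) →ₗ[ZMod 2] Fin 24 → ZMod 2}
    {u : Fin 24 → ZMod 2} (h : ∀ i < 24, f (vec 24 (2 ^ i)) = 0 ∨ f (vec 24 (2 ^ i)) = u)
    {v : Fin 24 → ZMod 2} (hv : f v = u) (hf : ∀ y, f (y ᵥ* toMatrix g) = f y ᵥ* toMatrix g) :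
    u ᵥ* toMatrix g = u := by
  have h1 : ∀ y, f y = 0 ∨ f y = u := by
    intro y
    rw [← (Pi.basisFun (ZMod 2) (Fin 24)).sum_repr y]
    refine Finset.sum_induction _ (fun y => f y = 0 ∨ f y = u) ?_ (Or.inl (map_zero f))
      fun i _ => ?_
    · rintro x y (hx | hx) (hy | hy) <;> rw [map_add, hx, hy]
      · exact Or.inl (add_zero 0)
      · exact Or.inr (zero_add u)
      · exact Or.inr (add_zero u)
      · exact Or.inl (add_self_vec u)
    · rw [map_smul, Pi.basisFun_apply]
      rcases zmod_two_cases ((Pi.basisFun (ZMod 2) (Fin 24)).repr y i) with h0 | h0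
      · rw [h0, zero_smul]
        exact Or.inl rfl
      · rw [h0, one_smul]
        have := h i i.2
        rwa [vec_two_pow i.2] at this
  -- The image `u g = f (v g)` is `0` or `u`; the value `0` would force `u = 0`, as `g` is
  -- invertible.
  have h2 := hf v
  rw [hv] at h2
  rcases h1 (v ᵥ* toMatrix g) with h3 | h3
  · rw [h3] at h2
    have h4 : u = 0 := vecMul_toMatrix_injective g (h2.symm.trans (Matrix.zero_vecMul _).symm)
    rw [h4, Matrix.zero_vecMul]
  · rw [← h2, h3]

/-- The list of vectors contains two whose difference is the given basis vector. -/
def spansBasis (l : List ℕ) (js : List ℕ) : Bool :=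
  js.all fun j => l.any fun y => forced (y ^^^ 2 ^ j) fun z => l.any (Nat.beq z)

theorem vecMul_eq_of_spansBasis {l js : List ℕ} (h : spansBasis l js = true)
    {M : Matrix (Fin 24) (Fin 24) (ZMod 2)} (hM : ∀ y ∈ l, vec 24 y ᵥ* M = vec 24 y) {j : ℕ}
    (hj : j ∈ js) : vec 24 (2 ^ j) ᵥ* M = vec 24 (2 ^ j) := by
  obtain ⟨y, hy, h⟩ := List.any_eq_true.1 (List.all_eq_true.1 h j hj)
  rw [forced_eq] at h
  obtain ⟨z, hz, h⟩ := List.any_eq_true.1 h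
  have h1 := hM z hz
  rw [← Nat.eq_of_beq_eq_true h, vec_xor, Matrix.add_vecMul, hM y hy] at h1
  exact add_left_cancel h1

/-- The image of a vector under multiplication by several vectors. -/
def mulBitsList : List ℕ → ℕ → ℕ
  | [], y => y
  | x :: l, y => mulBits x (mulBitsList l y)

/-- The vectors `160, 80, 10, 5` are singular and pairwise orthogonal and span a maximal totally
singular subspace of the first block. Successive multiplication by them has rank one, as for a pure
spinor; the image is spanned by `61440`, a vector of the second block. -/
theorem mulBitsList_rank_one : ∀ i < 24,
    mulBitsList [160, 80, 10, 5] (2 ^ i) = 0 ∨ mulBitsList [160, 80, 10, 5] (2 ^ i) = 61440 := by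
  decide +kernel

theorem mulBitsList_twelve : mulBitsList [160, 80, 10, 5] (2 ^ 12) = 61440 := by
  decide +kernel

/-- Multiplying `61440` repeatedly by basis vectors of the first block produces enough vectors to
express every basis vector of the other two blocks as a difference. -/
theorem spansBasis_mul :
    spansBasis (orbitList ((List.range 8).map (prodTable.getD · [])) 36 61440)
      ((List.range 16).map (· + 8)) = true := by
  decide +kernel

/-- Multiplication by several vectors. -/
def mulVecList (l : List ℕ) : (Fin 24 → ZMod 2) →ₗ[ZMod 2] Fin 24 → ZMod 2 :=
  (l.map fun x => mulVec (vec 24 x)).prod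

theorem mulVecList_vec (l : List ℕ) (y : ℕ) :
    mulVecList l (vec 24 y) = vec 24 (mulBitsList l y) := by
  induction l with
  | nil => rfl
  | cons x l ih =>
    have ih' : (l.map fun x => mulVec (vec 24 x)).prod (vec 24 y) =
      vec 24 (mulBitsList l y) := ih
    rw [mulVecList, List.map_cons, List.prod_cons, Module.End.mul_apply, ih', mulVec_vec,
      mulBitsList]

theorem mulVecList_vecMul {g : ThetaHat} {l : List ℕ}
    (h : ∀ x ∈ l, vec 24 x ᵥ* toMatrix g = vec 24 x) (y : Fin 24 → ZMod 2) :
    mulVecList l (y ᵥ* toMatrix g) = mulVecList l y ᵥ* toMatrix g := by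
  induction l with
  | nil => rfl
  | cons x l ih =>
    have ih := ih fun z hz => h z (List.mem_cons_of_mem _ hz)
    rw [mulVecList] at ih
    rw [mulVecList, List.map_cons, List.prod_cons, Module.End.mul_apply, ih, Module.End.mul_apply,
      ← mulVec_toMatrix, h x List.mem_cons_self]

/-- The pointwise stabilizer of the first block is trivial. -/
theorem eq_one_of_fixes_block {g : ThetaHat}
    (h : ∀ x < 2 ^ 8, vec 24 x ᵥ* toMatrix g = vec 24 x) : g = 1 := by
  -- Multiplication by vectors of the first block commutes with `g`, so `g` fixes the image of the
  -- rank-one composite.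
  have hu : vec 24 61440 ᵥ* toMatrix g = vec 24 61440 := by
    refine vecMul_eq_of_rank_one (f := mulVecList [160, 80, 10, 5]) (v := vec 24 (2 ^ 12))
      (fun i hi => ?_) ?_ (mulVecList_vecMul ?_)
    · rw [mulVecList_vec]
      rcases mulBitsList_rank_one i hi with h | h <;> rw [h]
      · exact Or.inl (vec_zero 24)
      · exact Or.inr rfl
    · rw [mulVecList_vec, mulBitsList_twelve]
    · intro x hx
      refine h x ?_
      revert x
      decide
  have hl := (orbitList_spec (Ms := (List.range 8).map (prodTable.getD · []))
    (R := fun y => vec 24 y ᵥ* toMatrix g = vec 24 y) hu (by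
      intro M hM y hy
      obtain ⟨i, hi, rfl⟩ := List.mem_map.1 hM
      have hi := List.mem_range.1 hi
      have h1 : ∀ i : Fin 8, ∀ y, mulBits (2 ^ (i : ℕ)) y = act (prodTable.getD i []) y := by
        intro i y
        fin_cases i <;> exact Nat.xor_zero _
      rw [← h1 ⟨i, hi⟩, ← mulVec_vec, ← mulVec_toMatrix, hy,
        h _ (Nat.pow_lt_pow_right (by norm_num) hi)]) 36).2
  refine toMatrix_injective ((map_one toMatrix).symm ▸ matrix_ext_vec fun j hj => ?_)
  rw [Matrix.vecMul_one]
  rcases lt_or_ge j 8 with hj' | hj'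
  · exact h _ (Nat.pow_lt_pow_right (by norm_num) hj')
  · refine vecMul_eq_of_spansBasis spansBasis_mul hl (List.mem_map.2 ⟨j - 8, ?_, ?_⟩)
    · exact List.mem_range.2 (by omega)
    · omega

/-- Both `ĉ` and its conjugate by `d̂` fix all blocks, so an element centralizing the kernel
commutes with `(1 + ĉ)(1 + d̂ĉd̂)`. This map has rank one and singles out the vector `60`. -/
theorem act_commutator_rank_one : ∀ i < 24,
    (2 ^ i ^^^ actWord [2] (2 ^ i)) ^^^ actWord [3, 2, 3] (2 ^ i ^^^ actWord [2] (2 ^ i)) = 0 ∨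
    (2 ^ i ^^^ actWord [2] (2 ^ i)) ^^^ actWord [3, 2, 3] (2 ^ i ^^^ actWord [2] (2 ^ i)) = 60 := by
  decide +kernel

theorem spansBasis_gen :
    spansBasis (orbitList ([1, 2, 3, 4, 5].map genRows) 162 60) (List.range 24) = true := by
  decide +kernel

/-- The linear map `(1 + g) (1 + h)`. -/
def oneAddMul (g h : ThetaHat) : (Fin 24 → ZMod 2) →ₗ[ZMod 2] Fin 24 → ZMod 2 :=
  Matrix.vecMulLinear ((1 + toMatrix g) * (1 + toMatrix h))

theorem vecMul_sixty {g : ThetaHat} (h : ∀ k ∈ blockPerm.ker, g * k = k * g) :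
    vec 24 60 ᵥ* toMatrix g = vec 24 60 := by
  have hw : ∀ x, vec 24 x ᵥ* toMatrix (hatGen 2) = vec 24 (actWord [2] x) := fun x => by
    rw [vecMul_hatGen, actWord, forced_eq, actWord]
    rfl
  have hw' : ∀ x, vec 24 x ᵥ* toMatrix (hatGen 3 * hatGen 2 * hatGen 3) =
      vec 24 (actWord [3, 2, 3] x) := fun x => by
    simp only [map_mul, ← Matrix.vecMul_vecMul, vecMul_hatGen, actWord, forced_eq]
    rfl
  have hc : ∀ k, blockPerm k = 1 → Commute (1 + toMatrix k) (toMatrix g) := by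
    intro k hk
    rw [Commute, SemiconjBy, add_mul, mul_add, one_mul, mul_one, ← map_mul, ← map_mul,
      h k hk]
  have hf : ∀ x, oneAddMul (hatGen 2) (hatGen 3 * hatGen 2 * hatGen 3) (vec 24 x) =
      vec 24 ((x ^^^ actWord [2] x) ^^^ actWord [3, 2, 3] (x ^^^ actWord [2] x)) := fun x => by
    simp only [oneAddMul, Matrix.vecMulLinear_apply, ← Matrix.vecMul_vecMul, Matrix.vecMul_add,
      Matrix.vecMul_one, hw, ← vec_xor, hw']
  refine vecMul_eq_of_rank_one (f := oneAddMul (hatGen 2) (hatGen 3 * hatGen 2 * hatGen 3))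
    (v := vec 24 (2 ^ 2)) (fun i hi => ?_) ?_ fun y => ?_
  · rw [hf]
    rcases act_commutator_rank_one i hi with h | h <;> rw [h]
    · exact Or.inl (vec_zero 24)
    · exact Or.inr rfl
  · rw [hf]
    congr 1
  · have h1 := (hc (hatGen 2) (by rw [blockPerm_hatGen]; rfl)).mul_left
      (hc (hatGen 3 * hatGen 2 * hatGen 3) (by
        simp only [map_mul, blockPerm_hatGen]
        decide))
    rw [oneAddMul, Matrix.vecMulLinear_apply, Matrix.vecMulLinear_apply, Matrix.vecMul_vecMul,
      Matrix.vecMul_vecMul, h1.eq]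

/-- The kernel of the action on the blocks has a trivial centralizer. -/
theorem eq_one_of_commute_ker {g : ThetaHat} (h : ∀ k ∈ blockPerm.ker, g * k = k * g) :
    g = 1 := by
  -- The property propagated is to be fixed by every element centralizing the kernel. It is stable
  -- under the generators because the centralizer of a normal subgroup is normal.
  have hl := (orbitList_spec (Ms := [1, 2, 3, 4, 5].map genRows) (x := 60)
    (R := fun y => ∀ g : ThetaHat, (∀ k ∈ blockPerm.ker, g * k = k * g) →
      vec 24 y ᵥ* toMatrix g = vec 24 y) (fun g => vecMul_sixty) (by
      intro M hM y hy g hg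
      obtain ⟨i, hi, rfl⟩ := List.mem_map.1 hM
      have hi' : i < 6 := by
        revert i
        decide
      have h1 := hy (hatGen ⟨i, hi'⟩ * g * (hatGen ⟨i, hi'⟩)⁻¹) fun k hk => by
        have h2 := hg _ (blockPerm.normal_ker.conj_mem k hk (hatGen ⟨i, hi'⟩)⁻¹)
        rw [inv_inv] at h2
        have h3 := congrArg (fun x => hatGen ⟨i, hi'⟩ * x * (hatGen ⟨i, hi'⟩)⁻¹) h2
        simpa only [mul_assoc, mul_inv_cancel_left, mul_inv_cancel, mul_one] using h3
      have h2 := congrArg (· ᵥ* toMatrix (hatGen ⟨i, hi'⟩)) h1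
      simp only [Matrix.vecMul_vecMul, ← map_mul, inv_mul_cancel_right] at h2
      rw [map_mul, ← Matrix.vecMul_vecMul, vecMul_hatGen] at h2
      exact h2) 162).2
  refine toMatrix_injective ((map_one toMatrix).symm ▸ matrix_ext_vec fun j hj => ?_)
  rw [Matrix.vecMul_one]
  exact vecMul_eq_of_spansBasis spansBasis_gen (fun y hy => hl y hy g h) (List.mem_range.2 hj)

end ThetaHat

/-! ### The block stabilizer is the full orthogonal group -/

section BlockGroup

/-- The stabilizer of the first block. -/
noncomputable def blockStabilizer : Subgroup ThetaHat :=
  (MulAction.stabilizer (Equiv.Perm (Fin 3)) (0 : Fin 3)).comap blockPerm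

theorem mem_blockStabilizer {g : ThetaHat} : g ∈ blockStabilizer ↔ blockPerm g 0 = 0 := Iff.rfl

/-- The rows of an isometry from the hyperbolic space to the first block. -/
def inclRows : List ℕ := [5, 6, 11, 15, 80, 96, 176, 240]

/-- The rows of a linear map from the first block to the hyperbolic space. -/
def projRows : List ℕ := [13, 14, 12, 7, 208, 224, 192, 112] ++ List.replicate 16 0

/-- An isometry from the hyperbolic space to the first block. -/
def inclMatrix : Matrix (Fin 8) (Fin 24) (ZMod 2) := ofRows 8 24 inclRows

/-- A left inverse of the isometry that vanishes on the other blocks. -/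
def projMatrix : Matrix (Fin 24) (Fin 8) (ZMod 2) := ofRows 24 8 projRows

theorem vecMul_inclMatrix (x : ℕ) : vec 8 x ᵥ* inclMatrix = vec 24 (act inclRows x) :=
  vecMul_ofRows' 24 (M := inclRows) rfl x

theorem vecMul_projMatrix (x : ℕ) : vec 24 x ᵥ* projMatrix = vec 8 (act projRows x) :=
  vecMul_ofRows' 8 (M := projRows) rfl x

theorem inclMatrix_mul_projMatrix : inclMatrix * projMatrix = 1 := by
  have h : ∀ i < 8, act projRows (act inclRows (2 ^ i)) = 2 ^ i := by decide +kernel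
  refine matrix_ext_vec fun i hi => ?_
  rw [← Matrix.vecMul_vecMul, vecMul_inclMatrix, vecMul_projMatrix, h i hi, Matrix.vecMul_one]

theorem projMatrix_mul_inclMatrix : projMatrix * inclMatrix = blockProj 0 := by
  have h : ∀ i < 24, act inclRows (act projRows (2 ^ i)) = act (blockRows 0) (2 ^ i) := by
    decide +kernel
  refine matrix_ext_vec fun i hi => ?_
  rw [← Matrix.vecMul_vecMul, vecMul_projMatrix, vecMul_inclMatrix, h i hi, vecMul_blockProj]
  rfl

theorem Phi_vecMul_inclMatrix (x : Fin 8 → ZMod 2) : Phi (x ᵥ* inclMatrix) = hyperbolicForm x := by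
  have h : ∀ x < 2 ^ 8, quadBits phiMonomials (act inclRows x) = quadBits hypMonomials x := by
    decide +kernel
  obtain ⟨x, hx, rfl⟩ := exists_vec x
  rw [vecMul_inclMatrix, Phi_vec, hyperbolicForm_vec, h x hx]

/-- The restriction of a matrix to the first block, in hyperbolic coordinates. -/
def blockMatrix (g : ThetaHat) : Matrix (Fin 8) (Fin 8) (ZMod 2) :=
  inclMatrix * toMatrix g * projMatrix

theorem inclMatrix_mul_blockProj : inclMatrix * blockProj 0 = inclMatrix := by
  rw [← projMatrix_mul_inclMatrix, ← Matrix.mul_assoc, inclMatrix_mul_projMatrix, Matrix.one_mul]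

theorem blockMatrix_one : blockMatrix 1 = 1 := by
  rw [blockMatrix, map_one, Matrix.mul_one, inclMatrix_mul_projMatrix]

theorem blockMatrix_mul_inclMatrix {g : ThetaHat} (hg : g ∈ blockStabilizer) :
    blockMatrix g * inclMatrix = inclMatrix * toMatrix g := by
  have h := blockProj_mul_toMatrix g 0
  rw [mem_blockStabilizer.1 hg] at h
  rw [blockMatrix, Matrix.mul_assoc, projMatrix_mul_inclMatrix, Matrix.mul_assoc, ← h,
    ← Matrix.mul_assoc, inclMatrix_mul_blockProj]

/-- Multiplicativity requires only the left factor to preserve the first block: then nothing is lost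
by projecting to the block before the second factor acts. -/
theorem blockMatrix_mul {g : ThetaHat} (hg : g ∈ blockStabilizer) (h : ThetaHat) :
    blockMatrix (g * h) = blockMatrix g * blockMatrix h := by
  rw [blockMatrix, map_mul, ← Matrix.mul_assoc, ← blockMatrix_mul_inclMatrix hg, blockMatrix,
    blockMatrix]
  simp only [Matrix.mul_assoc]

theorem hyperbolicForm_vecMul_blockMatrix {g : ThetaHat} (hg : g ∈ blockStabilizer)
    (x : Fin 8 → ZMod 2) : hyperbolicForm (x ᵥ* blockMatrix g) = hyperbolicForm x := by
  rw [← Phi_vecMul_inclMatrix, Matrix.vecMul_vecMul, blockMatrix_mul_inclMatrix hg,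
    ← Matrix.vecMul_vecMul, Phi_vecMul_toMatrix, Phi_vecMul_inclMatrix]

/-- The linear map given by the restriction of a matrix to the first block. -/
noncomputable def blockEquivLinear (g : blockStabilizer) :
    (Fin 8 → ZMod 2) ≃ₗ[ZMod 2] (Fin 8 → ZMod 2) :=
  LinearEquiv.ofLinearMap (Matrix.vecMulLinear (blockMatrix (g⁻¹ : blockStabilizer)))
    (Matrix.vecMulLinear (blockMatrix g))
    (LinearMap.ext fun x => by
      simp only [LinearMap.comp_apply, Matrix.vecMulLinear_apply, LinearMap.id_apply,
        Matrix.vecMul_vecMul]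
      rw [← blockMatrix_mul g.2, ← Subgroup.coe_mul, mul_inv_cancel, Subgroup.coe_one,
        blockMatrix_one, Matrix.vecMul_one])
    (LinearMap.ext fun x => by
      simp only [LinearMap.comp_apply, Matrix.vecMulLinear_apply, LinearMap.id_apply,
        Matrix.vecMul_vecMul]
      rw [← blockMatrix_mul (g⁻¹).2, ← Subgroup.coe_mul, inv_mul_cancel, Subgroup.coe_one,
        blockMatrix_one, Matrix.vecMul_one])

/-- The restriction to the first block. -/
noncomputable def restrict : blockStabilizer →* OrthGroup where
  toFun g := ⟨blockEquivLinear g, fun x => hyperbolicForm_vecMul_blockMatrix (g⁻¹).2 x⟩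
  map_one' := by
    refine Subtype.ext (LinearEquiv.ext fun x => ?_)
    change x ᵥ* blockMatrix ((1⁻¹ : blockStabilizer) : ThetaHat) = x
    rw [inv_one, Subgroup.coe_one, blockMatrix_one, Matrix.vecMul_one]
  map_mul' g h := by
    refine Subtype.ext (LinearEquiv.ext fun x => ?_)
    change x ᵥ* blockMatrix (((g * h)⁻¹ : blockStabilizer) : ThetaHat) =
      (x ᵥ* blockMatrix ((h⁻¹ : blockStabilizer) : ThetaHat)) ᵥ*
        blockMatrix ((g⁻¹ : blockStabilizer) : ThetaHat)
    rw [mul_inv_rev, Subgroup.coe_mul, blockMatrix_mul (h⁻¹).2, Matrix.vecMul_vecMul]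

theorem orthAction_restrict (g : blockStabilizer) (x : Fin 8 → ZMod 2) :
    orthAction (restrict g) x = x ᵥ* blockMatrix (g⁻¹ : blockStabilizer) := rfl

theorem restrict_injective : Function.Injective restrict := by
  refine (injective_iff_map_eq_one restrict).2 fun g hg => ?_
  have h : ∀ x, x ᵥ* blockMatrix (g⁻¹ : blockStabilizer) = x := fun x => by
    rw [← orthAction_restrict, hg]
    rfl
  have h1 : ((g⁻¹ : blockStabilizer) : ThetaHat) = 1 := by
    refine eq_one_of_fixes_block fun x hx => ?_
    have h2 : ∀ x < 2 ^ 8, act inclRows (act projRows x) = x := by decide +kernel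
    have h3 : vec 24 x = vec 8 (act projRows x) ᵥ* inclMatrix := by
      rw [vecMul_inclMatrix, h2 x hx]
    rw [h3, Matrix.vecMul_vecMul, ← blockMatrix_mul_inclMatrix (g⁻¹).2, ← Matrix.vecMul_vecMul, h]
  exact inv_eq_one.1 (Subtype.ext h1)

/-- The element `d` as an element of the stabilizer of the first block. -/
noncomputable def stabGen : blockStabilizer := ⟨hatGen 3, by
  rw [mem_blockStabilizer, blockPerm_hatGen]
  decide⟩

theorem hyperbolicForm_fortyEight : hyperbolicForm (vec 8 48) = 1 := by
  rw [hyperbolicForm_vec, ← bz_true, bz_inj]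
  decide +kernel

/-- On the first block `d̂` interchanges two coordinates that form one of the planes of `Φ`, which
is the reflection in their sum. That vector has the code `48` both in the block and in hyperbolic
coordinates. -/
theorem restrict_stabGen :
    restrict stabGen = orthReflection (vec 8 48) hyperbolicForm_fortyEight := by
  have h : ∀ i < 8, act projRows (act (genRows 3) (act inclRows (2 ^ i))) =
      2 ^ i ^^^ bif polarBits hypMonomials 48 (2 ^ i) then 48 else 0 := by decide +kernel
  have hinv : ((stabGen⁻¹ : blockStabilizer) : ThetaHat) = hatGen 3 := by
    change (hatGen 3)⁻¹ = hatGen 3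
    rw [hatGen, ← map_inv, Theta.gen_inv]
  refine Subtype.ext (LinearEquiv.toLinearMap_injective (linearMap_ext_vec fun i hi => ?_))
  change vec 8 (2 ^ i) ᵥ* blockMatrix (stabGen⁻¹ : blockStabilizer) =
    vec 8 (2 ^ i) + QuadraticMap.polar hyperbolicForm (vec 8 48) (vec 8 (2 ^ i)) • vec 8 48
  rw [hinv, blockMatrix, ← Matrix.vecMul_vecMul, ← Matrix.vecMul_vecMul, vecMul_inclMatrix,
    vecMul_hatGen, polar_vec hyperbolicForm_vec]
  refine (vecMul_projMatrix _).trans ?_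
  refine (congrArg (vec 8) (h i hi)).trans ?_
  rw [vec_xor]
  cases polarBits hypMonomials 48 (2 ^ i)
  · simp [bz]
  · simp [bz]

/-- The bound `360 = 3 · 120` allows for the vectors of norm 1 in all three blocks. -/
theorem mem_orbitList_fortyEight : ((List.range 256).all fun x =>
    !quadBits hypMonomials x || forced (act inclRows x) fun y =>
      (orbitList ((List.range 6).map genRows) 360 48).any (Nat.beq y)) = true := by
  decide +kernel

theorem exists_restrict_map {v : Fin 8 → ZMod 2} (hv : hyperbolicForm v = 1) :
    ∃ g, orthAction (restrict g) (vec 8 48) = v := by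
  obtain ⟨x, hx, rfl⟩ := exists_vec v
  have hl := (orbitList_spec (Ms := (List.range 6).map genRows) (x := 48)
    (R := fun y => ∃ g, vec 24 48 ᵥ* toMatrix g = vec 24 y)
    ⟨1, by rw [map_one, Matrix.vecMul_one]⟩ (by
      rintro M hM y ⟨g, hg⟩
      obtain ⟨i, hi, rfl⟩ := List.mem_map.1 hM
      refine ⟨g * hatGen ⟨i, List.mem_range.1 hi⟩, ?_⟩
      rw [map_mul, ← Matrix.vecMul_vecMul, hg, vecMul_hatGen]) 360).2
  have h := List.all_eq_true.1 mem_orbitList_fortyEight x (List.mem_range.2 hx)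
  rw [hyperbolicForm_vec, ← bz_true, bz_inj] at hv
  rw [hv, forced_eq, Bool.not_true, Bool.false_or] at h
  obtain ⟨y, hy, h⟩ := List.any_eq_true.1 h
  obtain ⟨g, hg⟩ := hl y hy
  rw [← Nat.eq_of_beq_eq_true h, ← vecMul_inclMatrix] at hg
  have h48 : vec 8 48 ᵥ* inclMatrix = vec 24 48 := vecMul_inclMatrix 48
  -- An element that sends one non-zero vector of the first block into that block preserves the
  -- block.
  have hgS : g ∈ blockStabilizer := by
    have h1 := congrArg (· ᵥ* blockProj 0) hg
    simp only [Matrix.vecMul_vecMul, inclMatrix_mul_blockProj, ← blockProj_mul_toMatrix] at h1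
    rw [← hg, ← Matrix.vecMul_vecMul] at h1
    have h2 := vecMul_toMatrix_injective g h1
    rw [vecMul_blockProj] at h2
    have h3 : ∀ p : Fin 3, act (blockRows p) 48 < 2 ^ 24 ∧ (act (blockRows p) 48 = 48 → p = 0) := by
      decide +kernel
    exact (h3 _).2 (vec_injOn (h3 _).1 (by norm_num) h2)
  refine ⟨(⟨g, hgS⟩ : blockStabilizer)⁻¹, ?_⟩
  rw [orthAction_restrict, inv_inv, blockMatrix, ← Matrix.vecMul_vecMul, ← Matrix.vecMul_vecMul,
    h48, hg, Matrix.vecMul_vecMul, inclMatrix_mul_projMatrix, Matrix.vecMul_one]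

/-- The image contains one reflection and is transitive on vectors of norm 1, so by conjugation it
contains all reflections. -/
theorem restrict_surjective : Function.Surjective restrict := by
  rw [← MonoidHom.range_eq_top, eq_top_iff, ← reflectionGroup_eq_top, reflectionGroup,
    Subgroup.closure_le]
  rintro _ ⟨v, hv, rfl⟩
  obtain ⟨g, hg⟩ := exists_restrict_map hv
  refine ⟨g * stabGen * g⁻¹, ?_⟩
  rw [map_mul, map_mul, map_inv, restrict_stabGen, conj_orthReflection _ _ hv hg]

end BlockGroup

/-! ### The extension of `O₈⁺(2)` by `S₃` -/

section Structure

/-- A word in the generators `d` and `e` that induces the given permutation of the blocks. -/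
def permWord (s : Equiv.Perm (Fin 3)) : List (Fin 6) :=
  ([[], [3], [4], [3, 4], [4, 3], [3, 4, 3]].find? fun w =>
    decide ((w.map fun i : Fin 6 => genPerm i).prod = s)).getD []

theorem prod_permWord : ∀ s, ((permWord s).map fun i : Fin 6 => genPerm i).prod = s := by
  decide +kernel

theorem actWord_permWord_mul : ∀ p : Equiv.Perm (Fin 3) × Equiv.Perm (Fin 3), ∀ i < 24,
    actWord ((permWord (p.1 * p.2)).map Fin.val) (2 ^ i) =
      actWord ((permWord p.1 ++ permWord p.2).map Fin.val) (2 ^ i) := by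
  decide +kernel

theorem toMatrix_prod_hatGen (w : List (Fin 6)) :
    toMatrix (w.map hatGen).prod = wordMatrix (w.map Fin.val) := by
  rw [map_list_prod, List.map_map, wordMatrix, List.map_map]
  exact congrArg List.prod (List.map_congr_left fun i _ => toMatrix_hatGen i)

/-- The complement `⟨d, e⟩` of the kernel of the action on the blocks. -/
def blockSection : Equiv.Perm (Fin 3) →* ThetaHat :=
  MonoidHom.mk' (fun s => ((permWord s).map hatGen).prod) fun s t => by
    rw [← List.prod_append, ← List.map_append]
    refine toMatrix_injective ?_
    rw [toMatrix_prod_hatGen, toMatrix_prod_hatGen]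
    refine matrix_ext_vec fun i hi => ?_
    rw [vecMul_wordMatrix, vecMul_wordMatrix, actWord_permWord_mul (s, t) i hi]

theorem blockPerm_blockSection (s : Equiv.Perm (Fin 3)) : blockPerm (blockSection s) = s := by
  refine Eq.trans ?_ (prod_permWord s)
  change blockPerm ((permWord s).map hatGen).prod = _
  rw [map_list_prod, List.map_map]
  exact congrArg List.prod (List.map_congr_left fun i _ => blockPerm_hatGen i)

theorem index_blockStabilizer : blockStabilizer.index = 3 := by
  rw [blockStabilizer, Subgroup.index_comap_of_surjective _ fun s => ⟨_, blockPerm_blockSection s⟩,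
    MulAction.index_stabilizer_of_transitive, Nat.card_eq_fintype_card, Fintype.card_fin]

theorem card_range_rep : Nat.card Theta.rep.range = 1045094400 := by
  rw [← Subgroup.card_mul_index blockStabilizer, index_blockStabilizer,
    Nat.card_congr (Equiv.ofBijective restrict ⟨restrict_injective, restrict_surjective⟩),
    card_orthGroup]

/-- The sign of the permutation of the blocks. -/
noncomputable def blockSign : blockStabilizer →* ℤˣ :=
  Equiv.Perm.sign.comp (blockPerm.comp blockStabilizer.subtype)

/-- A permutation of three blocks that fixes the first is determined by its sign. Hence the kernel
of the block action is also the kernel of a map to an abelian group, as needed to compare it with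
the commutator subgroup. -/
theorem mem_ker_blockSign {g : blockStabilizer} :
    g ∈ blockSign.ker ↔ (g : ThetaHat) ∈ blockPerm.ker := by
  have h : ∀ s : Equiv.Perm (Fin 3), s 0 = 0 → (Equiv.Perm.sign s = 1 ↔ s = 1) := by
    decide +kernel
  exact h _ (mem_blockStabilizer.1 g.2)

/-- The image of the kernel contains the commutator subgroup because `ℤˣ` is abelian. They are equal
because the commutator subgroup has index at most 2 and `d̂`, which interchanges two blocks, is
outside the kernel. -/
theorem map_restrict_ker : blockSign.ker.map restrict = commutator OrthGroup := by
  have hle : commutator OrthGroup ≤ blockSign.ker.map restrict := by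
    have h := Subgroup.map_commutator ⊤ ⊤ restrict
    rw [← MonoidHom.range_eq_map, MonoidHom.range_eq_top.2 restrict_surjective] at h
    rw [commutator_def, ← h]
    exact Subgroup.map_mono (Abelianization.commutator_subset_ker blockSign)
  refine le_antisymm ?_ hle
  rintro _ ⟨g, hg, rfl⟩
  refine (mem_commutator_or hyperbolicForm_fortyEight (restrict g)).resolve_right fun h => ?_
  rw [← restrict_stabGen, ← map_mul] at h
  obtain ⟨k, hk, hkg⟩ := hle h
  rw [restrict_injective hkg] at hk
  have h1 := mem_ker_blockSign.1 ((Subgroup.mul_mem_cancel_right _ hg).1 hk)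
  rw [MonoidHom.mem_ker] at h1
  change blockPerm (hatGen 3) = 1 at h1
  rw [blockPerm_hatGen] at h1
  revert h1
  decide

theorem ker_blockPerm_le : blockPerm.ker ≤ blockStabilizer := by
  intro g hg
  rw [mem_blockStabilizer, MonoidHom.mem_ker.1 hg]
  rfl

/-- The kernel of the action on the blocks is the simple group. -/
noncomputable def kerEquiv : blockPerm.ker ≃* O8Plus2 :=
  (Subgroup.subgroupOfEquivOfLe ker_blockPerm_le).symm.trans <|
    (MulEquiv.subgroupCongr (SetLike.ext fun _ => mem_ker_blockSign.symm)).trans <|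
      (blockSign.ker.equivMapOfInjective restrict restrict_injective).trans
        (MulEquiv.subgroupCongr map_restrict_ker)

/-- A group with a homomorphism onto `S₃` that splits and whose kernel is the simple group and has
trivial centralizer is an extension as in the theorem. -/
theorem isO8Plus2S3_of_section {G : Type*} [Group G] {f : G →* Equiv.Perm (Fin 3)}
    {s : Equiv.Perm (Fin 3) →* G} (hs : ∀ x, f (s x) = x) (e : f.ker ≃* O8Plus2)
    (hc : ∀ g, (∀ k ∈ f.ker, g * k = k * g) → g = 1) : IsO8Plus2S3 G := by
  let φ : Equiv.Perm (Fin 3) →* MulAut f.ker := MulAut.conjNormal.comp s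
  have hlift : ∀ x, f.ker.subtype.comp (φ x).toMonoidHom =
      (MulAut.conj (s x)).toMonoidHom.comp f.ker.subtype := fun x => by
    ext k
    rfl
  let ψ : f.ker ⋊[φ] Equiv.Perm (Fin 3) →* G := SemidirectProduct.lift f.ker.subtype s hlift
  have hψ : ∀ x, ψ x = x.left * s x.right := fun x => rfl
  have hker : ∀ k : f.ker, f k = 1 := fun k => k.2
  have hbij : Function.Bijective ψ := by
    refine ⟨(injective_iff_map_eq_one ψ).2 fun x hx => ?_, fun g => ?_⟩
    · rw [hψ] at hx
      have h1 : x.right = 1 := by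
        have := congrArg f hx
        rwa [map_mul, hker, hs, one_mul, map_one] at this
      rw [h1, map_one, mul_one] at hx
      exact SemidirectProduct.ext (Subtype.ext hx) h1
    · refine ⟨⟨⟨g * (s (f g))⁻¹, ?_⟩, f g⟩, ?_⟩
      · rw [MonoidHom.mem_ker, map_mul, map_inv, hs, mul_inv_cancel]
      · rw [hψ]
        exact inv_mul_cancel_right _ _
  -- The seemingly idle `MulEquiv.refl` brings the action into the form produced by
  -- `SemidirectProduct.congr'`.
  refine ⟨(MulAut.congr e).toMonoidHom.comp (φ.comp (MulEquiv.refl _).symm.toMonoidHom), ?_,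
    ⟨(MulEquiv.ofBijective ψ hbij).symm.trans (SemidirectProduct.congr' e (MulEquiv.refl _))⟩⟩
  rintro x ⟨k, hk⟩
  have h1 : ∀ n : f.ker, s x * n * (s x)⁻¹ = e.symm k * n * (e.symm k : G)⁻¹ := fun n => by
    have h2 : k * e n * k⁻¹ = e (φ x (e.symm (e n))) := DFunLike.congr_fun hk (e n)
    rw [e.symm_apply_apply, ← e.apply_symm_apply k, ← map_inv, ← map_mul, ← map_mul] at h2
    exact congrArg Subtype.val (e.injective h2).symm
  -- If `s x` acts on the kernel like its element `e.symm k`, the quotient of the two centralizes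
  -- the kernel and is trivial; applying `f` then gives `x = 1`.
  have h2 : (e.symm k : G)⁻¹ * s x = 1 := by
    refine hc _ fun n hn => ?_
    have h3 := h1 ⟨n, hn⟩
    rw [mul_inv_eq_iff_eq_mul] at h3
    rw [mul_assoc, h3]
    group
  have h3 := congrArg f h2
  rwa [map_mul, map_inv, hker, hs, inv_one, one_mul, map_one] at h3

theorem isO8Plus2S3_range_rep : IsO8Plus2S3 Theta.rep.range :=
  isO8Plus2S3_of_section blockPerm_blockSection kerEquiv fun _ => eq_one_of_commute_ker

end Structure

end Polytope33433

theorem lemma4p1 :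
    ∃ ρ : Polytope33433.Theta →* GL (Fin 24) (ZMod 2),
      (∀ i, (ρ (Polytope33433.Theta.gen i) : Matrix (Fin 24) (Fin 24) (ZMod 2)) = Polytope33433.hat i) ∧
      (∀ (g : Polytope33433.Theta) (x : Fin 24 → ZMod 2),
        Polytope33433.Phi (x ᵥ* (ρ g : Matrix (Fin 24) (Fin 24) (ZMod 2))) = Polytope33433.Phi x) ∧
      Polytope33433.IsO8Plus2S3 ρ.range ∧
      Polytope33433.IsGroupOfGammaOne (fun i => ρ (Polytope33433.Theta.gen i)) := by
  refine ⟨Polytope33433.Theta.rep, fun i => ?_, Polytope33433.Theta.Phi_vecMul_rep,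
    Polytope33433.isO8Plus2S3_range_rep, ?_⟩
  · rw [Polytope33433.Theta.rep_gen, Polytope33433.coe_gen, Polytope33433.hat_eq]
  · simp only [Polytope33433.Theta.rep_gen]
    exact Polytope33433.isGroupOfGammaOne_gen Polytope33433.card_range_rep
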